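/- Conventions. A pentagon is a simple (not necessarily convex) closed pentagonal region in the Euclidean plane. A unit-area pentagon is Cairo, respectively Prismatic, if it is circumscribed about a circle and has three angles of $2\pi/3$ and two right angles which are nonadjacent, respectively adjacent. A unit-area pentagon is efficient if its perimeter is at most that of a unit-area Cairo pentagon. A Type 2 non-convex pentagon is a pentagon with exactly two interior angles larger than $\pi$. Given a family of angles $(a_i)$, the angle $a_j$ is said to tile if there are non-negative integers $m_i$, only finitely many of them nonzero, with $m_j\ge 1$ and $\sum_i m_i a_i = 2\pi$. The perimeter of a tiling of a torus is the total length of its edges, each edge counted once. Proposition. Let $\mathbb{R}^2/\Lambda$ be a flat torus ($\Lambda$ a lattice of rank two) with an edge-to-edge tiling by finitely many unit-area pentagons, each of which is an efficient pentagon or a Type 2 non-convex pentagon. Assume that each efficient pentagon of the tiling has at most four angles (among its five, counted vertex by vertex) that tile with respect to the family of all interior angles of all efficient pentagons of the tiling. Then the perimeter per tile (the perimeter of the tiling divided by the number of tiles) is strictly greater than half the perimeter of a unit-area Prismatic pentagon. -/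

import Mathlib

open Set MeasureTheory Filter Topology

noncomputable section

/-- A (simple, not necessarily convex) pentagon in the Euclidean plane `ℂ`: five vertices in cyclic
order whose edges form a simple closed polygonal curve, together with the compact region bounded by
that curve.  (By the Jordan curve theorem the curve bounds exactly one nonempty regular closed
compact set, so `region` is determined by the vertices.) -/
structure Pentagon extends Polygon ℂ 5 where
  /-- consecutive edges meet only in their common vertex -/
  edge_inter_succ : ∀ k : Fin 5,
    toPolygon.edgeSet ℝ k ∩ toPolygon.edgeSet ℝ (k + 1) = {vertices (k + 1)}
  /-- non-consecutive edges are disjoint -/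
  edge_disjoint : ∀ k : Fin 5, Disjoint (toPolygon.edgeSet ℝ k) (toPolygon.edgeSet ℝ (k + 2))
  /-- the closed region bounded by the polygonal curve -/
  region : Set ℂ
  isCompact_region : IsCompact region
  closure_interior_region : closure (interior region) = region
  frontier_region : frontier region = toPolygon.boundary ℝ

namespace Pentagon

/-- The `k`-th edge, the segment from vertex `k` to vertex `k + 1`. -/
def edge (P : Pentagon) (k : Fin 5) : Set ℂ := P.toPolygon.edgeSet ℝ k

/-- The length of the `k`-th edge. -/
def edgeLength (P : Pentagon) (k : Fin 5) : ℝ := dist (P.vertices k) (P.vertices (k + 1))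

def perimeter (P : Pentagon) : ℝ := ∑ k, P.edgeLength k

def area (P : Pentagon) : ℝ := volume.real P.region

/-- The interior angle (in radians, between `0` and `2π`) at the `k`-th vertex: the total measure
of the directions `θ` which point from the vertex into the pentagon. -/
def angle (P : Pentagon) (k : Fin 5) : ℝ :=
  volume.real {θ : ℝ | θ ∈ Ioc (-Real.pi) Real.pi ∧
    ∀ᶠ t : ℝ in 𝓝[>] 0, P.vertices k + t * Complex.exp (θ * Complex.I) ∈ P.region}

/-- The pentagon is circumscribed about a circle: it contains a disk whose bounding circle
touches every edge. -/
def IsCircumscribed (P : Pentagon) : Prop :=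
  ∃ (c : ℂ) (r : ℝ), 0 < r ∧ Metric.closedBall c r ⊆ P.region ∧
    ∀ k, ∃ z ∈ P.edge k, dist z c = r

/-- Three angles of `2π/3` and two nonadjacent right angles, circumscribed about a circle. -/
def IsCairo (P : Pentagon) : Prop :=
  P.IsCircumscribed ∧ ∃ k, P.angle k = Real.pi / 2 ∧ P.angle (k + 1) = 2 * Real.pi / 3 ∧
    P.angle (k + 2) = Real.pi / 2 ∧ P.angle (k + 3) = 2 * Real.pi / 3 ∧
    P.angle (k + 4) = 2 * Real.pi / 3

/-- Three angles of `2π/3` and two adjacent right angles, circumscribed about a circle. -/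
def IsPrismatic (P : Pentagon) : Prop :=
  P.IsCircumscribed ∧ ∃ k, P.angle k = Real.pi / 2 ∧ P.angle (k + 1) = Real.pi / 2 ∧
    P.angle (k + 2) = 2 * Real.pi / 3 ∧ P.angle (k + 3) = 2 * Real.pi / 3 ∧
    P.angle (k + 4) = 2 * Real.pi / 3

/-- A unit-area pentagon is efficient if its perimeter is at most that of a unit-area Cairo
pentagon. -/
def IsEfficient (P : Pentagon) : Prop :=
  P.area = 1 ∧ ∃ C : Pentagon, C.IsCairo ∧ C.area = 1 ∧ P.perimeter ≤ C.perimeter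

/-- A Type 2 non-convex pentagon: exactly two interior angles are larger than `π`. -/
def IsType2 (P : Pentagon) : Prop := {k | Real.pi < P.angle k}.ncard = 2

/-- Two tiles meet edge-to-edge: each common point is a vertex of both, or lies on an entire edge
common to both. -/
def EdgeToEdge (P Q : Pentagon) : Prop :=
  ∀ z ∈ P.region ∩ Q.region,
    (∃ k l, z = P.vertices k ∧ z = Q.vertices l) ∨ ∃ k l, P.edge k = Q.edge l ∧ z ∈ P.edge k

theorem edge_eq_segment (P : Pentagon) (k : Fin 5) :
    P.edge k = segment ℝ (P.vertices k) (P.vertices (k + 1)) := by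
  simp [edge, Polygon.edgeSet, affineSegment_eq_segment]

theorem edgeLength_eq_diam (P : Pentagon) (k : Fin 5) :
    P.edgeLength k = Metric.diam (P.edge k) := by
  rw [edge_eq_segment, ← convexHull_pair, convexHull_diam, Metric.diam_pair, edgeLength]

theorem edgeSet_translate (p : Polygon ℂ 5) (w : ℂ) (k : Fin 5) :
    (⟨fun j => w + p.vertices j⟩ : Polygon ℂ 5).edgeSet ℝ k = (w + ·) '' p.edgeSet ℝ k := by
  simp only [Polygon.edgeSet, affineSegment_eq_segment, segment_translate_image]

/-- The translate of a pentagon by the vector `w`. -/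
def translate (P : Pentagon) (w : ℂ) : Pentagon where
  vertices k := w + P.vertices k
  edge_inter_succ k := by
    rw [edgeSet_translate, edgeSet_translate, ← image_inter (add_right_injective w),
      P.edge_inter_succ, image_singleton]
  edge_disjoint k := by
    rw [edgeSet_translate, edgeSet_translate, disjoint_image_iff (add_right_injective w)]
    exact P.edge_disjoint k
  region := (w + ·) '' P.region
  isCompact_region := P.isCompact_region.image (by fun_prop)
  closure_interior_region := by
    rw [show ((w + ·) : ℂ → ℂ) = Homeomorph.addLeft w from rfl, ← Homeomorph.image_interior,
      ← Homeomorph.image_closure, P.closure_interior_region]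
  frontier_region := by
    rw [show ((w + ·) : ℂ → ℂ) = Homeomorph.addLeft w from rfl, ← Homeomorph.image_frontier,
      P.frontier_region]
    simp only [Polygon.boundary, image_iUnion, edgeSet_translate]
    rfl

theorem translate_edge (P : Pentagon) (w : ℂ) (k : Fin 5) :
    (P.translate w).edge k = (w + ·) '' P.edge k :=
  edgeSet_translate P.toPolygon w k

theorem translate_edgeLength (P : Pentagon) (w : ℂ) (k : Fin 5) :
    (P.translate w).edgeLength k = P.edgeLength k := by
  simp [edgeLength, translate]

end Pentagon

/-- An edge-to-edge tiling of the flat torus `ℂ / Λ` by finitely many pentagons, indexed by `ι`.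
It is given by a lift of each tile to the plane: the translates of these lifts by the lattice `Λ`
cover the plane without overlaps and meet edge-to-edge.  Each tile of the torus has exactly one
index, because translates with different `(i, w)` have disjoint interiors. -/
structure TorusTiling (Λ : Submodule ℤ ℂ) (ι : Type*) where
  tile : ι → Pentagon
  cover : ⋃ p : ι × Λ, ((tile p.1).translate p.2).region = univ
  disjoint : Pairwise fun p q : ι × Λ =>
    Disjoint (interior ((tile p.1).translate p.2).region)
      (interior ((tile q.1).translate q.2).region)
  edgeToEdge : Pairwise fun p q : ι × Λ =>
    ((tile p.1).translate p.2).EdgeToEdge ((tile q.1).translate q.2)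

namespace TorusTiling

variable {Λ : Submodule ℤ ℂ} {ι : Type*}

/-- Two edges of (lifted) tiles are the same edge of the torus if they differ by a lattice
translation. -/
def edgeSetoid (T : TorusTiling Λ ι) : Setoid (ι × Fin 5) where
  r e f := ∃ w ∈ Λ, ((T.tile e.1).translate w).edge e.2 = (T.tile f.1).edge f.2
  iseqv := by
    simp only [Pentagon.translate_edge]
    refine ⟨fun e => ⟨0, Λ.zero_mem, by simp⟩, ?_, ?_⟩
    · rintro e f ⟨w, hw, h⟩
      exact ⟨-w, Λ.neg_mem hw, by rw [← h, image_image]; simp⟩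
    · rintro e f g ⟨w, hw, h⟩ ⟨w', hw', h'⟩
      exact ⟨w' + w, Λ.add_mem hw' hw, by rw [← h', ← h, image_image]; simp [add_assoc]⟩

/-- The edges of the tiled torus (an edge common to two tiles is a single element). -/
def Edge (T : TorusTiling Λ ι) : Type _ := Quotient T.edgeSetoid

/-- The length of an edge of the tiled torus. -/
def edgeLength (T : TorusTiling Λ ι) : T.Edge → ℝ :=
  Quotient.lift (fun e => (T.tile e.1).edgeLength e.2) <| by
    rintro e f ⟨w, -, h⟩
    rw [← Pentagon.translate_edgeLength _ w, Pentagon.edgeLength_eq_diam, h,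
      Pentagon.edgeLength_eq_diam]

/-- The perimeter of the tiling: the total length of its edges in the torus, each counted once
(a finite sum when `ι` is finite). -/
def perimeter (T : TorusTiling Λ ι) : ℝ := ∑ᶠ e : T.Edge, T.edgeLength e

def perimeterPerTile (T : TorusTiling Λ ι) : ℝ := T.perimeter / Nat.card ι

/-- The indices of all angles of the efficient tiles. -/
def EfficientCorner (T : TorusTiling Λ ι) : Type _ := {i : ι // (T.tile i).IsEfficient} × Fin 5

/-- The angle at a corner of an efficient tile. -/
def cornerAngle (T : TorusTiling Λ ι) (c : T.EfficientCorner) : ℝ := (T.tile c.1.1).angle c.2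

end TorusTiling

/-- Given a family of angles `a`, the angle `a j` tiles if some angles of the family, with positive
multiplicities and `a j` among them, add up to `2π`. -/
def AngleTiles {κ : Type*} (a : κ → ℝ) (j : κ) : Prop :=
  ∃ m : κ →₀ ℕ, m j ≠ 0 ∧ (m.sum fun i n => n * a i) = 2 * Real.pi

end

/-- The signed area enclosed by a closed polygonal curve. -/
noncomputable def shoelace {n : ℕ} [NeZero n] (z : Fin n → ℂ) : ℝ :=
  (∑ k, ((z k).re * (z (k + 1)).im - (z k).im * (z (k + 1)).re)) / 2

/-- The length of a closed polygonal curve. -/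
noncomputable def polyLength {n : ℕ} [NeZero n] (z : Fin n → ℂ) : ℝ := ∑ k, dist (z k) (z (k + 1))

theorem sum_update_cyclic {n : ℕ} [NeZero n] (F : ℂ → ℂ → ℝ) (z : Fin n → ℂ) (k : Fin n) (C : ℂ)
    (h1 : k - 1 ≠ k) :
    ∑ j, F (Function.update z k C j) (Function.update z k C (j + 1)) =
      ∑ j, F (z j) (z (j + 1)) + (F (z (k - 1)) C + F C (z (k + 1)) - F (z (k - 1)) (z k)
        - F (z k) (z (k + 1))) := by
  have h2 : k + 1 ≠ k := fun h => h1 (by rw [sub_eq_iff_eq_add, h])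
  have hs : ∀ f : Fin n → ℝ, ∑ j, f j = f (k - 1) + f k + ∑ j ∈ {k - 1, k}ᶜ, f j := by
    intro f
    rw [← Finset.sum_pair h1, Finset.sum_add_sum_compl]
  rw [hs (fun j => F (z j) (z (j + 1))), hs]
  have : ∑ j ∈ ({k - 1, k} : Finset (Fin n))ᶜ,
      F (Function.update z k C j) (Function.update z k C (j + 1)) =
      ∑ j ∈ ({k - 1, k} : Finset (Fin n))ᶜ, F (z j) (z (j + 1)) := by
    refine Finset.sum_congr rfl fun j hj => ?_
    simp only [Finset.mem_compl, Finset.mem_insert, Finset.mem_singleton, not_or] at hj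
    rw [Function.update_of_ne hj.2, Function.update_of_ne]
    intro h
    exact hj.1 (by rw [← h]; simp)
  rw [this]
  simp only [sub_add_cancel, Function.update_self, Function.update_of_ne h1,
    Function.update_of_ne h2]
  ring

/-- Among triangles with base `B D` and given sum of the other two sides, the isosceles one has
the largest area. -/
theorem exists_isosceles (B C D : ℂ) (hne : dist B C ≠ dist C D) : ∃ C' : ℂ,
    dist B C' = (dist B C + dist C D) / 2 ∧ dist C' D = (dist B C + dist C D) / 2 ∧
    (B.re * C.im - B.im * C.re) + (C.re * D.im - C.im * D.re) ≤
      (B.re * C'.im - B.im * C'.re) + (C'.re * D.im - C'.im * D.re) := by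
  set p := dist B C with hp
  set q := dist C D with hq
  have hBD : D - B ≠ 0 := by
    intro h
    rw [sub_eq_zero] at h
    exact hne (by rw [hp, hq, h, dist_comm])
  set d := ‖D - B‖ with hd
  have hd0 : 0 < d := norm_pos_iff.2 hBD
  set u : ℂ := (D - B) / d with hu
  have hdu : D - B = d * u := by
    rw [hu, mul_div_cancel₀]; exact_mod_cast hd0.ne'
  have hunorm : ‖u‖ = 1 := by
    rw [hu, norm_div, Complex.norm_real, Real.norm_of_nonneg hd0.le, ← hd, div_self hd0.ne']
  have hu2 : u.re ^ 2 + u.im ^ 2 = 1 := by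
    have := Complex.sq_norm u
    rw [hunorm, Complex.normSq_apply] at this
    nlinarith
  set w : ℂ := (C - (B + D) / 2) / u with hw
  have hu0 : u ≠ 0 := by
    intro h; rw [h] at hunorm; simp at hunorm
  have hC : C = (B + D) / 2 + w * u := by
    rw [hw]; field_simp; ring
  have hpw : p = ‖w + d / 2‖ := by
    rw [hp, dist_comm, dist_eq_norm, show C - B = (w + d / 2) * u by
      rw [hC]; linear_combination (1 / 2 : ℂ) * hdu, norm_mul, hunorm, mul_one]
  have hqw : q = ‖(d / 2 : ℂ) - w‖ := by
    rw [hq, dist_comm, dist_eq_norm, show D - C = (d / 2 - w) * u by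
      rw [hC]; linear_combination (1 / 2 : ℂ) * hdu, norm_mul, hunorm, mul_one]
  have key : d ^ 2 + 4 * w.im ^ 2 ≤ (p + q) ^ 2 := by
    have h1 : ‖(w + d / 2) + (starRingEnd ℂ) (d / 2 - w)‖ ≤ p + q := by
      refine (norm_add_le _ _).trans ?_
      rw [Complex.norm_conj, hpw, hqw]
    have h2 := Complex.sq_norm ((w + d / 2) + (starRingEnd ℂ) (d / 2 - w))
    have h3 := pow_le_pow_left₀ (norm_nonneg _) h1 2
    rw [h2, Complex.normSq_apply] at h3
    have e1 : ((d : ℂ) / 2).re = d / 2 := by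
      rw [show ((d : ℂ) / 2) = ((d / 2 : ℝ) : ℂ) by push_cast; ring]; exact Complex.ofReal_re _
    have e2 : ((d : ℂ) / 2).im = 0 := by
      rw [show ((d : ℂ) / 2) = ((d / 2 : ℝ) : ℂ) by push_cast; ring]; exact Complex.ofReal_im _
    simp only [Complex.add_re, Complex.sub_re, Complex.conj_re, Complex.conj_im, Complex.add_im,
      Complex.sub_im, e1, e2] at h3
    nlinarith
  set h := Real.sqrt (((p + q) / 2) ^ 2 - (d / 2) ^ 2) with hh
  have hh2 : h ^ 2 = ((p + q) / 2) ^ 2 - (d / 2) ^ 2 := Real.sq_sqrt (by nlinarith [sq_nonneg w.im])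
  have hpq : 0 ≤ (p + q) / 2 := by positivity
  have hwh : -w.im ≤ h := by
    apply Real.le_sqrt_of_sq_le
    nlinarith
  have hn : ∀ s : ℝ, s ^ 2 = (d / 2) ^ 2 → ‖(s : ℂ) + (-h : ℝ) * Complex.I‖ = (p + q) / 2 := by
    intro s hs
    rw [Complex.norm_add_mul_I, Real.sqrt_eq_iff_mul_self_eq (by positivity) hpq]
    nlinarith
  refine ⟨(B + D) / 2 - (h * Complex.I) * u, ?_, ?_, ?_⟩
  · rw [dist_comm, dist_eq_norm, show (B + D) / 2 - (h * Complex.I) * u - B =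
      (((d / 2 : ℝ) : ℂ) + (-h : ℝ) * Complex.I) * u by
        push_cast; linear_combination (1 / 2 : ℂ) * hdu, norm_mul, hunorm, mul_one, hn _ rfl]
  · rw [dist_eq_norm, show (B + D) / 2 - (h * Complex.I) * u - D =
      (((-(d / 2) : ℝ) : ℂ) + (-h : ℝ) * Complex.I) * u by
        push_cast; linear_combination (-1 / 2 : ℂ) * hdu, norm_mul, hunorm, mul_one,
        hn _ (by ring)]
  · have hDre : D.re = B.re + d * u.re := by
      have := congrArg Complex.re hdu
      simp at this; linarith
    have hDim : D.im = B.im + d * u.im := by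
      have := congrArg Complex.im hdu
      simp at this; linarith
    have t1 : ∀ v : ℂ, (B.re * ((B + D) / 2 + v * u).im - B.im * ((B + D) / 2 + v * u).re) +
        (((B + D) / 2 + v * u).re * D.im - ((B + D) / 2 + v * u).im * D.re) =
        B.re * D.im - B.im * D.re - v.im * d := by
      intro v
      have e1 : ((B + D) / 2).re = (B.re + D.re) / 2 := by simp
      have e2 : ((B + D) / 2).im = (B.im + D.im) / 2 := by simp
      simp only [Complex.add_re, Complex.add_im, Complex.mul_re, Complex.mul_im, e1, e2] 
      rw [hDre, hDim]
      linear_combination (-v.im * d) * hu2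
    have t2 : (B + D) / 2 - (h * Complex.I) * u = (B + D) / 2 + (-(h * Complex.I)) * u := by ring
    rw [t2, t1, hC, t1]
    have : (-((h : ℂ) * Complex.I)).im = -h := by simp
    rw [this]
    nlinarith

theorem shoelace_sub_const {n : ℕ} [NeZero n] (z : Fin n → ℂ) (a : ℂ) :
    shoelace (fun k => z k - a) = shoelace z := by
  unfold shoelace
  congr 1
  have e1 : ∑ k : Fin n, (z (k + 1)).im = ∑ k, (z k).im :=
    Equiv.sum_comp (Equiv.addRight (1 : Fin n)) (fun k => (z k).im)
  have e2 : ∑ k : Fin n, (z (k + 1)).re = ∑ k, (z k).re :=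
    Equiv.sum_comp (Equiv.addRight (1 : Fin n)) (fun k => (z k).re)
  have : ∀ k : Fin n, (z k - a).re * (z (k + 1) - a).im - (z k - a).im * (z (k + 1) - a).re =
      ((z k).re * (z (k + 1)).im - (z k).im * (z (k + 1)).re) +
      (a.re * ((z k).im - (z (k + 1)).im) + a.im * ((z (k + 1)).re - (z k).re)) := by
    intro k
    simp only [Complex.sub_re, Complex.sub_im]
    ring
  rw [Finset.sum_congr rfl fun k _ => this k, Finset.sum_add_distrib, Finset.sum_add_distrib,
    ← Finset.mul_sum, ← Finset.mul_sum, Finset.sum_sub_distrib (fun k => (z k).im),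
    Finset.sum_sub_distrib (fun k => (z (k + 1)).re), e1, e2]
  ring

/-- A quadratic inequality `c * area ≤ ∑ side²` implies the isoperimetric inequality. -/
theorem isoperimetric {m : ℕ} (hm : 1 ≤ m) {c : ℝ} (hc : 0 ≤ c)
    (hquad : ∀ z : Fin (m + 1) → ℂ, c * shoelace z ≤ ∑ k, dist (z k) (z (k + 1)) ^ 2)
    (z : Fin (m + 1) → ℂ) : (m + 1) * c * shoelace z ≤ polyLength z ^ 2 := by
  set L := polyLength z with hL
  have hL0 : 0 ≤ L := Finset.sum_nonneg fun _ _ => dist_nonneg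
  set K : Set (Fin (m + 1) → ℂ) := {y | y 0 = 0 ∧ polyLength y ≤ L} with hK
  have contS : Continuous (shoelace : (Fin (m + 1) → ℂ) → ℝ) := by
    unfold shoelace; fun_prop
  have contL : Continuous (polyLength : (Fin (m + 1) → ℂ) → ℝ) := by
    unfold polyLength; fun_prop
  have contE : Continuous (fun y : Fin (m + 1) → ℂ => ∑ k, dist (y k) (y (k + 1)) ^ 2) := by
    fun_prop
  have hbound : ∀ y ∈ K, ∀ k : Fin (m + 1), ‖y k‖ ≤ m * L := by
    intro y hy k
    have : ∀ k : Fin (m + 1), ‖y k‖ ≤ (k : ℕ) * L := by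
      intro k
      induction k using Fin.induction with
      | zero => simp [hy.1]
      | succ i ih =>
        have h1 : dist (y i.castSucc) (y i.succ) ≤ L := by
          refine le_trans ?_ hy.2
          have := Finset.single_le_sum (f := fun k => dist (y k) (y (k + 1)))
            (fun _ _ => dist_nonneg) (Finset.mem_univ i.castSucc)
          simpa [Fin.coeSucc_eq_succ, polyLength] using this
        have h2 : ‖y i.succ‖ ≤ ‖y i.castSucc‖ + dist (y i.castSucc) (y i.succ) := by
          rw [dist_comm, dist_eq_norm]
          have := norm_add_le (y i.castSucc) (y i.succ - y i.castSucc)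
          simpa using this
        simp only [Fin.val_succ, Fin.val_castSucc] at ih ⊢
        push_cast
        linarith
    refine (this k).trans ?_
    gcongr
    exact_mod_cast Nat.lt_succ_iff.1 k.2
  have hKc : IsCompact K := by
    refine (isCompact_closedBall (0 : Fin (m + 1) → ℂ) (m * L)).of_isClosed_subset ?_ ?_
    · exact (isClosed_eq (continuous_apply 0) continuous_const).inter
        (isClosed_le contL continuous_const)
    · intro y hy
      rw [mem_closedBall_zero_iff, pi_norm_le_iff_of_nonneg (by positivity)]
      exact hbound y hy
  have hz' : (fun k => z k - z 0) ∈ K := by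
    refine ⟨sub_self _, le_of_eq ?_⟩
    simp [hL, polyLength]
  have hSz := shoelace_sub_const z (z 0)
  obtain ⟨y₀, hy₀, hmax⟩ := hKc.exists_isMaxOn ⟨_, hz'⟩ contS.continuousOn
  have hK2 : IsCompact (K ∩ {y | shoelace y₀ ≤ shoelace y}) :=
    hKc.inter_right (isClosed_le continuous_const contS)
  obtain ⟨y, ⟨hy, hyS⟩, hmin⟩ := hK2.exists_isMinOn ⟨y₀, hy₀, le_refl (shoelace y₀)⟩ contE.continuousOn
  have hadj : ∀ k : Fin (m + 1), k ≠ 0 → dist (y (k - 1)) (y k) = dist (y k) (y (k + 1)) := by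
    intro k hk
    by_contra hne
    have hk1 : k - 1 ≠ k := by
      intro h
      rw [sub_eq_self] at h
      obtain ⟨l, rfl⟩ : ∃ l, m = l + 1 := ⟨m - 1, by omega⟩
      exact one_ne_zero h
    obtain ⟨C, h1, h2, h3⟩ := exists_isosceles _ _ _ hne
    set y' := Function.update y k C with hy'
    have uL := sum_update_cyclic (fun a b => dist a b) y k C hk1
    have uS := sum_update_cyclic (fun a b => a.re * b.im - a.im * b.re) y k C hk1
    have uE := sum_update_cyclic (fun a b => dist a b ^ 2) y k C hk1
    simp only [← hy'] at uL uS uE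
    have hmem : y' ∈ K ∩ {y | shoelace y₀ ≤ shoelace y} := by
      refine ⟨⟨?_, ?_⟩, ?_⟩
      · rw [hy', Function.update_of_ne (Ne.symm hk)]; exact hy.1
      · refine le_trans (le_of_eq ?_) hy.2
        unfold polyLength
        rw [uL, h1, h2]; ring
      · refine le_trans (show shoelace y₀ ≤ shoelace y from hyS) ?_
        unfold shoelace
        rw [uS]
        linarith
    have := isMinOn_iff.1 hmin y' hmem
    rw [uE, h1, h2] at this
    have : 0 < (dist (y (k - 1)) (y k) - dist (y k) (y (k + 1))) ^ 2 :=
      sq_pos_of_ne_zero (sub_ne_zero.2 hne)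
    nlinarith
  have heq : ∀ k : Fin (m + 1), dist (y k) (y (k + 1)) = dist (y 0) (y (0 + 1)) := by
    intro k
    induction k using Fin.induction with
    | zero => rfl
    | succ i ih =>
      rw [← hadj _ (Fin.succ_ne_zero i), ← ih, ← Fin.coeSucc_eq_succ, add_sub_cancel_right]
  have hLy := hy.2
  have hq := hquad y
  unfold polyLength at hLy
  simp only [heq, Finset.sum_const, Finset.card_univ, Fintype.card_fin, nsmul_eq_mul] at hLy hq
  have hm' := isMaxOn_iff.1 hmax _ hz'
  rw [hSz] at hm'
  push_cast at hLy hq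
  have hyS' : shoelace y₀ ≤ shoelace y := hyS
  set ℓ := dist (y 0) (y (0 + 1))
  have hℓ : 0 ≤ ℓ := dist_nonneg
  calc (m + 1) * c * shoelace z ≤ (m + 1) * c * shoelace y := by gcongr; linarith
    _ ≤ (m + 1) * ((m + 1) * ℓ ^ 2) := by rw [mul_assoc]; gcongr
    _ = ((m + 1) * ℓ) ^ 2 := by ring
    _ ≤ L ^ 2 := by gcongr

/-- The discrete Wirtinger inequality implies the isoperimetric inequality for the sum of the
squares of the sides. -/
theorem shoelace_le_of_wirtinger {n : ℕ} [NeZero n] {c s : ℝ} (hcs : c ^ 2 + s ^ 2 = 1)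
    (hW : ∀ x : Fin n → ℝ, ∑ k, x k = 0 →
      2 * (1 - c) * ∑ k, x k ^ 2 ≤ ∑ k, (x (k + 1) - x k) ^ 2)
    (z : Fin n → ℂ) : 4 * s * shoelace z ≤ (1 + c) * ∑ k, dist (z k) (z (k + 1)) ^ 2 := by
  have hn : (n : ℝ) ≠ 0 := by exact_mod_cast NeZero.ne n
  set a : ℂ := ⟨(∑ k, (z k).re) / n, (∑ k, (z k).im) / n⟩ with ha
  rw [← shoelace_sub_const z a]
  set x : Fin n → ℝ := fun k => (z k).re - a.re with hx
  set y : Fin n → ℝ := fun k => (z k).im - a.im with hy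
  have hx0 : ∑ k, x k = 0 := by
    simp [hx, ha, Finset.sum_sub_distrib]; field_simp; ring
  have hy0 : ∑ k, y k = 0 := by
    simp [hy, ha, Finset.sum_sub_distrib]; field_simp; ring
  have hd : ∀ k, dist (z k) (z (k + 1)) ^ 2 = (x (k + 1) - x k) ^ 2 + (y (k + 1) - y k) ^ 2 := by
    intro k
    rw [Complex.dist_eq, Complex.sq_norm, Complex.normSq_apply]
    simp only [hx, hy, Complex.sub_re, Complex.sub_im]
    ring
  have hS : 2 * shoelace (fun k => z k - a) = ∑ k, (x k * y (k + 1) - y k * x (k + 1)) := by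
    unfold shoelace
    rw [mul_div_cancel₀ _ two_ne_zero]
    simp [hx, hy]
  simp only [hd, Finset.sum_add_distrib]
  have h1 := hW x hx0
  have h2 := hW y hy0
  have shx : ∑ k : Fin n, x (k + 1) ^ 2 = ∑ k, x k ^ 2 :=
    Equiv.sum_comp (Equiv.addRight (1 : Fin n)) (fun k => x k ^ 2)
  have shy : ∑ k : Fin n, y (k + 1) ^ 2 = ∑ k, y k ^ 2 :=
    Equiv.sum_comp (Equiv.addRight (1 : Fin n)) (fun k => y k ^ 2)
  have hpos : 0 ≤ ∑ k, ((x (k + 1) - (c * x k - s * y k)) ^ 2 +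
      (y (k + 1) - (s * x k + c * y k)) ^ 2) := Finset.sum_nonneg fun _ _ => by positivity
  have hid : ∀ k, (x (k + 1) - (c * x k - s * y k)) ^ 2 + (y (k + 1) - (s * x k + c * y k)) ^ 2 =
      (1 - c) * (x (k + 1) ^ 2 + y (k + 1) ^ 2 + x k ^ 2 + y k ^ 2) +
      c * ((x (k + 1) - x k) ^ 2 + (y (k + 1) - y k) ^ 2) -
      2 * s * (x k * y (k + 1) - y k * x (k + 1)) := by
    intro k
    linear_combination (x k ^ 2 + y k ^ 2) * hcs
  rw [Finset.sum_congr rfl fun k _ => hid k, Finset.sum_sub_distrib, Finset.sum_add_distrib,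
    ← Finset.mul_sum, ← Finset.mul_sum, ← Finset.mul_sum, Finset.sum_add_distrib,
    Finset.sum_add_distrib, Finset.sum_add_distrib, Finset.sum_add_distrib, shx, shy, ← hS] at hpos
  linarith

theorem isoperimetric_of_wirtinger {m : ℕ} (hm : 1 ≤ m) {c s : ℝ} (hcs : c ^ 2 + s ^ 2 = 1)
    (hs : 0 ≤ s) (hc : -1 < c)
    (hW : ∀ x : Fin (m + 1) → ℝ, ∑ k, x k = 0 →
      2 * (1 - c) * ∑ k, x k ^ 2 ≤ ∑ k, (x (k + 1) - x k) ^ 2)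
    (z : Fin (m + 1) → ℂ) : (m + 1) * (4 * s / (1 + c)) * shoelace z ≤ polyLength z ^ 2 := by
  have h1 : 0 < 1 + c := by linarith
  refine isoperimetric hm (by positivity) (fun z => ?_) z
  have := shoelace_le_of_wirtinger hcs hW z
  rw [div_mul_eq_mul_div, div_le_iff₀ h1]
  linarith

theorem isoperimetric_triangle (z : Fin 3 → ℂ) : 20.784 * shoelace z ≤ polyLength z ^ 2 := by
  have h3 : √3 ^ 2 = 3 := Real.sq_sqrt (by norm_num)
  have h3' : 1.732 ≤ √3 := Real.le_sqrt_of_sq_le (by norm_num)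
  have hW : ∀ x : Fin 3 → ℝ, ∑ k, x k = 0 →
      2 * (1 - (-1 / 2)) * ∑ k, x k ^ 2 ≤ ∑ k, (x (k + 1) - x k) ^ 2 := by
    intro x hx
    simp only [Fin.sum_univ_three, Fin.isValue, Fin.reduceAdd, zero_add] at hx ⊢
    have : x 2 = -x 0 - x 1 := by linarith
    rw [this]; nlinarith
  have := isoperimetric_of_wirtinger (m := 2) (by norm_num) (c := -1 / 2) (s := √3 / 2)
    (by linarith) (by positivity) (by norm_num) hW z
  rcases le_total (shoelace z) 0 with h | h
  · nlinarith [sq_nonneg (polyLength z)]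
  · refine le_trans ?_ this
    gcongr
    push_cast
    rw [show ((2 : ℝ) + 1) * (4 * (√3 / 2) / (1 + -1 / 2)) = 12 * √3 by ring]
    linarith

theorem isoperimetric_quadrilateral (z : Fin 4 → ℂ) : 16 * shoelace z ≤ polyLength z ^ 2 := by
  have hW : ∀ x : Fin 4 → ℝ, ∑ k, x k = 0 →
      2 * (1 - (0)) * ∑ k, x k ^ 2 ≤ ∑ k, (x (k + 1) - x k) ^ 2 := by
    intro x hx
    simp only [Fin.sum_univ_four, Fin.isValue, Fin.reduceAdd, zero_add] at hx ⊢
    have : x 3 = -x 0 - x 1 - x 2 := by linarith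
    rw [this]; nlinarith [sq_nonneg (x 0 + x 2)]
  have := isoperimetric_of_wirtinger (m := 3) (by norm_num) (c := 0) (s := 1)
    (by norm_num) (by positivity) (by norm_num) hW z
  norm_num at this
  linarith

theorem isoperimetric_hexagon (z : Fin 6 → ℂ) : 13.856 * shoelace z ≤ polyLength z ^ 2 := by
  have h3 : √3 ^ 2 = 3 := Real.sq_sqrt (by norm_num)
  have h3' : 1.732 ≤ √3 := Real.le_sqrt_of_sq_le (by norm_num)
  have hW : ∀ x : Fin 6 → ℝ, ∑ k, x k = 0 →
      2 * (1 - (1 / 2)) * ∑ k, x k ^ 2 ≤ ∑ k, (x (k + 1) - x k) ^ 2 := by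
    intro x hx
    simp only [Fin.sum_univ_six, Fin.isValue, Fin.reduceAdd, zero_add] at hx ⊢
    have h5 : x 5 = -x 0 - x 1 - x 2 - x 3 - x 4 := by linarith
    rw [h5]
    nlinarith [sq_nonneg (x 0 + x 3), sq_nonneg (x 1 + x 4), sq_nonneg (x 0 + x 1 + x 3 + x 4),
      sq_nonneg (x 0 - x 1 + x 3 - x 4), sq_nonneg (x 0 + x 2 + x 4), sq_nonneg (x 0 - x 1 + x 2),
      sq_nonneg (x 1 - x 2 + x 3), sq_nonneg (x 2 - x 3 + x 4)]
  have := isoperimetric_of_wirtinger (m := 5) (by norm_num) (c := 1 / 2) (s := √3 / 2)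
    (by linarith) (by positivity) (by norm_num) hW z
  rcases le_total (shoelace z) 0 with h | h
  · nlinarith [sq_nonneg (polyLength z)]
  · refine le_trans ?_ this
    gcongr
    push_cast
    rw [show ((5 : ℝ) + 1) * (4 * (√3 / 2) / (1 + 1 / 2)) = 8 * √3 by ring]
    linarith

theorem isoperimetric_pentagon (z : Fin 5 → ℂ) : 14.53 * shoelace z ≤ polyLength z ^ 2 := by
  have h5 : √5 ^ 2 = 5 := Real.sq_sqrt (by norm_num)
  have h5' : √5 ≤ 2.23607 := Real.sqrt_le_iff.2 (by norm_num)
  have h5'' : 2.23606 ≤ √5 := Real.le_sqrt_of_sq_le (by norm_num)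
  have hs : √(1 - ((√5 - 1) / 4) ^ 2) ^ 2 = 1 - ((√5 - 1) / 4) ^ 2 :=
    Real.sq_sqrt (by nlinarith)
  have hs' : 0.951055 ≤ √(1 - ((√5 - 1) / 4) ^ 2) := by
    apply Real.le_sqrt_of_sq_le
    nlinarith
  have hW : ∀ x : Fin 5 → ℝ, ∑ k, x k = 0 →
      2 * (1 - ((√5 - 1) / 4)) * ∑ k, x k ^ 2 ≤ ∑ k, (x (k + 1) - x k) ^ 2 := by
    intro x hx
    simp only [Fin.sum_univ_five, Fin.isValue, Fin.reduceAdd, zero_add] at hx ⊢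
    have h4 : x 4 = -x 0 - x 1 - x 2 - x 3 := by linarith
    have key : (x 1 - x 0) ^ 2 + (x 2 - x 1) ^ 2 + (x 3 - x 2) ^ 2 + (x 4 - x 3) ^ 2
        + (x 0 - x 4) ^ 2 - 2 * (1 - (√5 - 1) / 4) *
        (x 0 ^ 2 + x 1 ^ 2 + x 2 ^ 2 + x 3 ^ 2 + x 4 ^ 2) = √5 / 5 *
        ((x 1 + x 4 - (√5 - 1) / 2 * x 0) ^ 2 + (x 2 + x 0 - (√5 - 1) / 2 * x 1) ^ 2 +
        (x 3 + x 1 - (√5 - 1) / 2 * x 2) ^ 2 + (x 4 + x 2 - (√5 - 1) / 2 * x 3) ^ 2 +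
        (x 0 + x 3 - (√5 - 1) / 2 * x 4) ^ 2) := by
      rw [h4]
      set r := √5
      have h3 : r ^ 3 = 5 * r := by rw [pow_succ, h5]
      ring_nf
      simp only [h3, h5]
      ring
    have : 0 ≤ √5 / 5 *
        ((x 1 + x 4 - (√5 - 1) / 2 * x 0) ^ 2 + (x 2 + x 0 - (√5 - 1) / 2 * x 1) ^ 2 +
        (x 3 + x 1 - (√5 - 1) / 2 * x 2) ^ 2 + (x 4 + x 2 - (√5 - 1) / 2 * x 3) ^ 2 +
        (x 0 + x 3 - (√5 - 1) / 2 * x 4) ^ 2) := by positivity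
    linarith
  have := isoperimetric_of_wirtinger (m := 4) (by norm_num) (c := (√5 - 1) / 4)
    (s := √(1 - ((√5 - 1) / 4) ^ 2))
    (by linarith) (by positivity) (by linarith) hW z
  rcases le_total (shoelace z) 0 with h | h
  · nlinarith [sq_nonneg (polyLength z)]
  · refine le_trans ?_ this
    gcongr
    push_cast
    rw [mul_div_assoc', le_div_iff₀ (by linarith)]
    linarith

theorem shoelace_rotate {n : ℕ} [NeZero n] (z : Fin n → ℂ) (k : Fin n) :
    shoelace (fun j => z (j + k)) = shoelace z := by
  unfold shoelace
  congr 1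
  have := Equiv.sum_comp (Equiv.addRight k)
    (fun j => (z j).re * (z (j + 1)).im - (z j).im * (z (j + 1)).re)
  simpa only [Equiv.coe_addRight, add_right_comm _ k] using this

theorem polyLength_rotate {n : ℕ} [NeZero n] (z : Fin n → ℂ) (k : Fin n) :
    polyLength (fun j => z (j + k)) = polyLength z := by
  unfold polyLength
  have := Equiv.sum_comp (Equiv.addRight k) (fun j => dist (z j) (z (j + 1)))
  simpa only [Equiv.coe_addRight, add_right_comm _ k] using this

theorem polyLength_nonneg {n : ℕ} [NeZero n] (z : Fin n → ℂ) : 0 ≤ polyLength z :=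
  Finset.sum_nonneg fun _ _ => dist_nonneg

theorem polyLength_four (a b c d : ℂ) :
    polyLength ![a, b, c, d] = dist a b + dist b c + dist c d + dist d a := by
  simp [polyLength, Fin.sum_univ_four]

theorem polyLength_five (a b c d e : ℂ) :
    polyLength ![a, b, c, d, e] = dist a b + dist b c + dist c d + dist d e + dist e a := by
  simp [polyLength, Fin.sum_univ_five]

theorem polyLength_six (a b c d e f : ℂ) : polyLength ![a, b, c, d, e, f] =
    dist a b + dist b c + dist c d + dist d e + dist e f + dist f a := by
  simp [polyLength, Fin.sum_univ_six]

theorem shoelace_three (a b c : ℂ) : shoelace ![a, b, c] = ((a.re * b.im - a.im * b.re) +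
    (b.re * c.im - b.im * c.re) + (c.re * a.im - c.im * a.re)) / 2 := by
  rw [shoelace, Fin.sum_univ_three]; rfl

theorem polyLength_three (a b c : ℂ) :
    polyLength ![a, b, c] = dist a b + dist b c + dist c a := by
  rw [polyLength, Fin.sum_univ_three]; rfl

theorem shoelace_four (a b c d : ℂ) : shoelace ![a, b, c, d] = ((a.re * b.im - a.im * b.re) +
    (b.re * c.im - b.im * c.re) + (c.re * d.im - c.im * d.re) + (d.re * a.im - d.im * a.re)) / 2
    := by
  rw [shoelace, Fin.sum_univ_four]; rfl

theorem shoelace_five (a b c d e : ℂ) : shoelace ![a, b, c, d, e] =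
    ((a.re * b.im - a.im * b.re) + (b.re * c.im - b.im * c.re) + (c.re * d.im - c.im * d.re) +
    (d.re * e.im - d.im * e.re) + (e.re * a.im - e.im * a.re)) / 2 := by
  rw [shoelace, Fin.sum_univ_five]; rfl

theorem shoelace_six (a b c d e f : ℂ) : shoelace ![a, b, c, d, e, f] =
    ((a.re * b.im - a.im * b.re) + (b.re * c.im - b.im * c.re) + (c.re * d.im - c.im * d.re) +
    (d.re * e.im - d.im * e.re) + (e.re * f.im - e.im * f.re) + (f.re * a.im - f.im * a.re)) / 2
    := by
  rw [shoelace, Fin.sum_univ_six]; rfl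

theorem eq_vecCons_five (z : Fin 5 → ℂ) : z = ![z 0, z 1, z 2, z 3, z 4] := by
  funext k; fin_cases k <;> rfl

theorem sin_half_le {α : ℝ} (h0 : 0 < α) (h1 : α ≤ 2 * Real.pi / 5) :
    Real.sin (α / 2) ≤ 0.5878 ∧ Real.sin α ≤ 0.9511 := by
  have hpi := Real.pi_pos
  have h5 : √5 ^ 2 = 5 := Real.sq_sqrt (by norm_num)
  have h5' : √5 ≤ 2.23607 := Real.sqrt_le_iff.2 (by norm_num)
  have h5'' : 2.236067 ≤ √5 := Real.le_sqrt_of_sq_le (by norm_num)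
  have hs : Real.sin (Real.pi / 5) ≤ 0.587786 := by
    have := Real.sin_sq_add_cos_sq (Real.pi / 5)
    rw [Real.cos_pi_div_five] at this
    nlinarith
  have hs0 : 0 ≤ Real.sin (Real.pi / 5) :=
    (Real.sin_pos_of_pos_of_lt_pi (by positivity) (by linarith)).le
  constructor
  · have := Real.sin_le_sin_of_le_of_le_pi_div_two (x := α / 2) (y := Real.pi / 5)
      (by linarith) (by linarith) (by linarith)
    linarith
  · have := Real.sin_le_sin_of_le_of_le_pi_div_two (x := α) (y := 2 * (Real.pi / 5))
      (by linarith) (by linarith) (by linarith)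
    rw [Real.sin_two_mul, Real.cos_pi_div_five] at this
    nlinarith

theorem norm_one_sub_exp {α : ℝ} (h0 : 0 ≤ α) (h1 : α ≤ 2 * Real.pi) :
    ‖Complex.exp (α * Complex.I) - 1‖ = 2 * Real.sin (α / 2) := by
  have : 0 ≤ Real.sin (α / 2) := Real.sin_nonneg_of_nonneg_of_le_pi (by linarith) (by linarith)
  rw [← sq_eq_sq₀ (norm_nonneg _) (by positivity), Complex.sq_norm, Complex.normSq_apply,
    Complex.exp_mul_I]
  simp only [← Complex.ofReal_cos, ← Complex.ofReal_sin, Complex.sub_re, Complex.add_re,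
    Complex.ofReal_re, Complex.mul_re, Complex.I_re, Complex.I_im, Complex.ofReal_im,
    Complex.sub_im, Complex.add_im, Complex.mul_im, Complex.one_re, Complex.one_im]
  have h := Real.sin_sq_add_cos_sq α
  have h2 : Real.cos α = 1 - 2 * Real.sin (α / 2) ^ 2 := by
    rw [← Real.cos_sq_add_sin_sq (α / 2)]
    conv_lhs => rw [show α = 2 * (α / 2) by ring, Real.cos_two_mul']
    ring
  nlinarith

/-- A pentagonal curve enclosing unit area with an angle of at most `2π/5` is long. -/
theorem lt_polyLength_of_angle_le_aux {z : Fin 5 → ℂ} (hS : shoelace z = 1) {u : ℂ} (hu : ‖u‖ = 1)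
    {x y α : ℝ} (hx : 0 ≤ x) (hy : 0 ≤ y) (h0 : 0 < α) (h1 : α ≤ 2 * Real.pi / 5)
    (hB : z 1 = z 0 + x * u) (hE : z 4 = z 0 + y * (u * Complex.exp (α * Complex.I))) :
    3.8638 < polyLength z := by
  by_contra! hL
  obtain ⟨hs, hc⟩ := sin_half_le h0 h1
  have hpi := Real.pi_pos
  have hexp : ‖Complex.exp (α * Complex.I)‖ = 1 := Complex.norm_exp_ofReal_mul_I α
  have hn := norm_one_sub_exp h0.le (by linarith)
  set s := Real.sin (α / 2)
  set w := u * Complex.exp (α * Complex.I) with hw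
  have hwn : ‖w‖ = 1 := by rw [hw, norm_mul, hu, hexp, one_mul]
  have hwu : ‖w - u‖ = 2 * s := by
    rw [hw, show u * Complex.exp (α * Complex.I) - u = u * (Complex.exp (α * Complex.I) - 1) by
      ring, norm_mul, hu, hn, one_mul]
  have hcross : u.re * w.im - u.im * w.re = Real.sin α := by
    have hu2 := Complex.sq_norm u
    rw [hu, Complex.normSq_apply] at hu2
    rw [hw, Complex.exp_mul_I, ← Complex.ofReal_cos, ← Complex.ofReal_sin]
    simp only [Complex.mul_re, Complex.add_re, Complex.ofReal_re, Complex.mul_im, Complex.add_im,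
      Complex.ofReal_im, Complex.I_re, Complex.I_im]
    linear_combination -Real.sin α * hu2
  have hsin : 0 ≤ Real.sin α := Real.sin_nonneg_of_nonneg_of_le_pi h0.le (by linarith)
  have hAB : dist (z 0) (z 1) = x := by
    rw [hB, dist_eq_norm, show z 0 - (z 0 + x * u) = -(x * u) by ring, norm_neg, norm_mul, hu,
      Complex.norm_real, Real.norm_of_nonneg hx, mul_one]
  have hEA : dist (z 4) (z 0) = y := by
    rw [hE, dist_eq_norm, show z 0 + y * w - z 0 = y * w by ring, norm_mul, hwn,
      Complex.norm_real, Real.norm_of_nonneg hy, mul_one]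
  have hFB : ∀ t ≤ x, dist (z 0 + t * u) (z 1) = x - t := by
    intro t ht
    rw [hB, dist_comm, dist_eq_norm, show z 0 + x * u - (z 0 + t * u) = ((x - t : ℝ) : ℂ) * u by
      push_cast; ring, norm_mul, hu, Complex.norm_real, Real.norm_of_nonneg (by linarith), mul_one]
  have hEG : ∀ t ≤ y, dist (z 4) (z 0 + t * w) = y - t := by
    intro t ht
    rw [hE, dist_eq_norm, show z 0 + y * w - (z 0 + t * w) = ((y - t : ℝ) : ℂ) * w by
      push_cast; ring, norm_mul, hwn, Complex.norm_real, Real.norm_of_nonneg (by linarith), mul_one]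
  have hGF : ∀ t : ℝ, 0 ≤ t → dist (z 0 + t * w) (z 0 + t * u) = t * (2 * s) := by
    intro t ht
    rw [dist_eq_norm, show z 0 + t * w - (z 0 + t * u) = t * (w - u) by ring, norm_mul, hwu,
      Complex.norm_real, Real.norm_of_nonneg ht]
  have hBr : (z 1).re = (z 0).re + x * u.re := by rw [hB]; simp
  have hBi : (z 1).im = (z 0).im + x * u.im := by rw [hB]; simp
  have hEr : (z 4).re = (z 0).re + y * w.re := by rw [hE]; simp
  have hEi : (z 4).im = (z 0).im + y * w.im := by rw [hE]; simp
  have tr : ∀ (t : ℝ) (v : ℂ), (z 0 + t * v).re = (z 0).re + t * v.re := by intros; simp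
  have ti : ∀ (t : ℝ) (v : ℂ), (z 0 + t * v).im = (z 0).im + t * v.im := by intros; simp
  have hLz : polyLength z = dist (z 0) (z 1) + dist (z 1) (z 2) + dist (z 2) (z 3) +
      dist (z 3) (z 4) + dist (z 4) (z 0) := by
    rw [← polyLength_five, ← eq_vecCons_five]
  rw [hAB, hEA] at hLz
  have hSz : shoelace z = ((z 0).re * (z 1).im - (z 0).im * (z 1).re +
      ((z 1).re * (z 2).im - (z 1).im * (z 2).re) + ((z 2).re * (z 3).im - (z 2).im * (z 3).re) +
      ((z 3).re * (z 4).im - (z 3).im * (z 4).re) + ((z 4).re * (z 0).im - (z 4).im * (z 0).re)) / 2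
      := by
    rw [← shoelace_five, ← eq_vecCons_five]
  rw [hS, hBr, hBi, hEr, hEi] at hSz
  have hexagon : ∀ t : ℝ, 0 ≤ t → t ≤ x → t ≤ y →
      shoelace ![z 0 + t * u, z 1, z 2, z 3, z 4, z 0 + t * w] = 1 - Real.sin α / 2 * t ^ 2 ∧
      polyLength ![z 0 + t * u, z 1, z 2, z 3, z 4, z 0 + t * w] =
        polyLength z - 2 * t * (1 - s) := by
    intro t ht htx hty
    constructor
    · rw [shoelace_six, tr, ti, tr, ti, hBr, hBi, hEr, hEi]
      linear_combination -hSz - t ^ 2 / 2 * hcross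
    · rw [polyLength_six, hFB t htx, hEG t hty, hGF t ht, hLz]
      ring
  have hpenta : ∀ t : ℝ, 0 ≤ t → t ≤ x → t ≤ y → (t = x ∨ t = y) →
      14.53 * (1 - Real.sin α / 2 * t ^ 2) ≤ (polyLength z - 2 * t * (1 - s)) ^ 2 := by
    intro t ht htx hty hor
    obtain ⟨e1, e2⟩ := hexagon t ht htx hty
    rw [← e1, ← e2]
    rcases hor with h | h
    · have hF : z 0 + t * u = z 1 := by rw [hB, h]
      rw [hF]
      have := isoperimetric_pentagon ![z 1, z 2, z 3, z 4, z 0 + t * w]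
      convert this using 2
      · rw [shoelace_six, shoelace_five]; ring
      · rw [polyLength_six, polyLength_five]; simp
    · have hG : z 0 + t * w = z 4 := by rw [hE, h]
      rw [hG]
      have := isoperimetric_pentagon ![z 0 + t * u, z 1, z 2, z 3, z 4]
      convert this using 2
      · rw [shoelace_six, shoelace_five]; ring
      · rw [polyLength_six, polyLength_five]; simp
  have hsmall : ∀ t M : ℝ, 0 ≤ t → 0 ≤ M → t * M = x * y → M ≤ polyLength z / 2 → 0.07 ≤ t := by
    intro t M ht hM hxy hML
    by_contra! hlt
    have h4 := isoperimetric_quadrilateral ![z 1, z 2, z 3, z 4]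
    have e1 : shoelace ![z 1, z 2, z 3, z 4] = 1 - Real.sin α / 2 * (x * y) := by
      rw [shoelace_four, hBr, hBi, hEr, hEi]
      linear_combination -hSz - x * y / 2 * hcross
    have e2 : polyLength ![z 1, z 2, z 3, z 4] ≤ polyLength z := by
      rw [polyLength_four]
      have := dist_triangle (z 4) (z 0) (z 1)
      rw [hAB, hEA] at this
      rw [hLz]
      linarith
    have e3 := pow_le_pow_left₀ (polyLength_nonneg _) (e2.trans hL) 2
    have : Real.sin α * (t * M) ≤ 0.9511 * (0.07 * 1.932) := by
      gcongr
      linarith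
    rw [e1, ← hxy] at h4
    norm_num at h4 e3 this
    linarith
  have hAE : y ≤ polyLength z / 2 := by
    have h1 := dist_triangle4 (z 1) (z 2) (z 3) (z 4)
    have h2 := dist_triangle (z 4) (z 1) (z 0)
    rw [hEA, dist_comm (z 4), dist_comm (z 1) (z 0), hAB] at h2
    linarith
  have hAB' : x ≤ polyLength z / 2 := by
    have h1 := dist_triangle4 (z 1) (z 2) (z 3) (z 4)
    have h2 := dist_triangle (z 1) (z 4) (z 0)
    rw [hEA, dist_comm (z 1) (z 0), hAB] at h2
    linarith
  have hmid : ∀ t : ℝ, 0 ≤ t → t ≤ x → t ≤ y → (t = x ∨ t = y) → 0.07 ≤ t → 0.44 < t := by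
    intro t ht htx hty hor h7
    by_contra! hlt
    have h5 := hpenta t ht htx hty hor
    have e0 : 0 ≤ polyLength z - 2 * t * (1 - s) := by
      rw [← (hexagon t ht htx hty).2]; exact polyLength_nonneg _
    have e3 : polyLength z - 2 * t * (1 - s) ≤ 3.8638 - 0.8244 * t := by
      have := mul_le_mul_of_nonneg_left (show 0.4122 ≤ 1 - s by linarith) ht
      linarith
    have e4 := pow_le_pow_left₀ e0 e3 2
    have e5 : Real.sin α / 2 * t ^ 2 ≤ 0.47555 * t ^ 2 := by gcongr; linarith
    exact absurd (h5.trans e4) (not_le.2 (by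
      nlinarith [mul_nonneg (sub_nonneg.2 h7) (sub_nonneg.2 hlt)]))
  have hbig : ¬ (0.44 ≤ x ∧ 0.44 ≤ y) := by
    rintro ⟨hx4, hy4⟩
    obtain ⟨e1, e2⟩ := hexagon 0.44 (by norm_num) hx4 hy4
    have h6 := isoperimetric_hexagon ![z 0 + (0.44 : ℝ) * u, z 1, z 2, z 3, z 4,
      z 0 + (0.44 : ℝ) * w]
    have e3 := polyLength_nonneg ![z 0 + (0.44 : ℝ) * u, z 1, z 2, z 3, z 4, z 0 + (0.44 : ℝ) * w]
    rw [e1, e2] at h6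
    rw [e2] at e3
    have e4 := pow_le_pow_left₀ e3 (show _ ≤ (3.502 : ℝ) by linarith) 2
    norm_num at e4 h6
    linarith
  rcases le_total x y with h | h
  · have := hmid x hx le_rfl h (Or.inl rfl) (hsmall x y hx hy rfl hAE)
    exact hbig ⟨this.le, this.le.trans h⟩
  · have := hmid y hy h le_rfl (Or.inr rfl) (hsmall y x hy hx (mul_comm _ _) hAB')
    exact hbig ⟨this.le.trans h, this.le⟩

theorem lt_polyLength_of_angle_le {z : Fin 5 → ℂ} (hS : shoelace z = 1) {k : Fin 5} {α : ℝ}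
    (hne : z (k + 1) ≠ z k) (h0 : 0 < α) (h1 : α ≤ 2 * Real.pi / 5)
    (hk : (z (k - 1) - z k) * dist (z k) (z (k + 1)) =
      (z (k + 1) - z k) * dist (z (k - 1)) (z k) * Complex.exp (α * Complex.I)) :
    3.8638 < polyLength z := by
  rw [← shoelace_rotate z k] at hS
  rw [← polyLength_rotate z k]
  have hd : (dist (z k) (z (k + 1)) : ℂ) ≠ 0 := by
    exact_mod_cast (dist_pos.2 hne.symm).ne'
  refine lt_polyLength_of_angle_le_aux hS (u := (z (k + 1) - z k) / dist (z k) (z (k + 1)))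
    ?_ dist_nonneg dist_nonneg h0 h1 (x := dist (z k) (z (k + 1)))
    (y := dist (z (k - 1)) (z k)) ?_ ?_
  · rw [norm_div, Complex.norm_real, Real.norm_of_nonneg dist_nonneg, ← dist_eq_norm, dist_comm,
      div_self (dist_pos.2 hne.symm).ne']
  · simp only [zero_add]
    rw [mul_div_cancel₀ _ hd, add_comm 1 k]; ring
  · simp only [zero_add]
    rw [show (4 : Fin 5) + k = k - 1 by rw [sub_eq_neg_add]; rfl, ← sub_eq_iff_eq_add']
    field_simp
    linear_combination hk

/-- Twice the signed area of the triangle `a b c`. -/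
def crossArea (a b c : ℂ) : ℝ := (b.re - a.re) * (c.im - a.im) - (b.im - a.im) * (c.re - a.re)

/-- If a path `A B C D` without crossing of its outer edges turns right at `B` and `C`, the
signed area of the quadrilateral `A B C D` is not positive. -/
theorem crossArea_add_nonpos {A B C D : ℂ} (hB : crossArea A B C < 0) (hC : crossArea B C D < 0)
    (hdisj : Disjoint (segment ℝ A B) (segment ℝ C D)) :
    crossArea A B C + crossArea A C D ≤ 0 := by
  by_contra! hpos
  have hid : crossArea A B C + crossArea A C D = crossArea A B D + crossArea B C D := by
    unfold crossArea; ring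
  have hden : 0 < crossArea A C D - crossArea B C D := by linarith
  have hs : ∀ a b : ℝ, 0 ≤ a → a ≤ b → 0 < b → a / b ∈ Icc (0 : ℝ) 1 := fun a b h1 h2 h3 =>
    ⟨by positivity, (div_le_one h3).2 h2⟩
  have h1 : A + (crossArea A C D / (crossArea A C D - crossArea B C D)) • (B - A) ∈
      segment ℝ A B := by
    rw [segment_eq_image']
    exact ⟨_, hs _ _ (by linarith) (by linarith) hden, rfl⟩
  have h2 : C + (-crossArea A B C / (crossArea A C D - crossArea B C D)) • (D - C) ∈
      segment ℝ C D := by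
    rw [segment_eq_image']
    exact ⟨_, hs _ _ (by linarith) (by linarith) hden, rfl⟩
  refine Set.disjoint_left.1 hdisj h1 ?_
  convert h2 using 1
  apply Complex.ext
  · simp only [Complex.add_re, Complex.sub_re, Complex.real_smul, Complex.re_ofReal_mul]
    field_simp
    unfold crossArea
    ring
  · simp only [Complex.add_im, Complex.sub_im, Complex.real_smul, Complex.im_ofReal_mul]
    field_simp
    unfold crossArea
    ring

theorem le_polyLength_of_two_reflex_aux {z : Fin 5 → ℂ} (hS : shoelace z = 1)
    (h0 : crossArea (z 4) (z 0) (z 1) < 0)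
    (h : crossArea (z 0) (z 1) (z 2) < 0 ∧ Disjoint (segment ℝ (z 4) (z 0)) (segment ℝ (z 1) (z 2))
      ∨ crossArea (z 1) (z 2) (z 3) < 0) : 20.784 ≤ polyLength z ^ 2 := by
  have hLz : polyLength z = dist (z 0) (z 1) + dist (z 1) (z 2) + dist (z 2) (z 3) +
      dist (z 3) (z 4) + dist (z 4) (z 0) := by
    rw [← polyLength_five, ← eq_vecCons_five]
  have hSz : _ := shoelace_five (z 0) (z 1) (z 2) (z 3) (z 4)
  rw [← eq_vecCons_five, hS] at hSz
  rcases h with ⟨h1, hd⟩ | h2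
  · have h3 := isoperimetric_triangle ![z 4, z 2, z 3]
    have hq := crossArea_add_nonpos h0 h1 hd
    have e1 : 1 ≤ shoelace ![z 4, z 2, z 3] := by
      rw [shoelace_three]
      unfold crossArea at hq
      linarith
    have e2 : polyLength ![z 4, z 2, z 3] ≤ polyLength z := by
      rw [polyLength_three, hLz]
      have := dist_triangle4 (z 4) (z 0) (z 1) (z 2)
      linarith
    have e3 := pow_le_pow_left₀ (polyLength_nonneg _) e2 2
    linarith
  · have h3 := isoperimetric_triangle ![z 4, z 1, z 3]
    have e1 : 1 ≤ shoelace ![z 4, z 1, z 3] := by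
      rw [shoelace_three]
      unfold crossArea at h0 h2
      linarith
    have e2 : polyLength ![z 4, z 1, z 3] ≤ polyLength z := by
      rw [polyLength_three, hLz]
      have := dist_triangle (z 4) (z 0) (z 1)
      have := dist_triangle (z 1) (z 2) (z 3)
      linarith
    have e3 := pow_le_pow_left₀ (polyLength_nonneg _) e2 2
    linarith

/-- A simple pentagonal curve enclosing unit area with two reflex angles is at least as long as
an equilateral triangle of unit area. -/
theorem le_polyLength_of_two_reflex {z : Fin 5 → ℂ} (hS : shoelace z = 1)
    (hd : ∀ k, Disjoint (segment ℝ (z k) (z (k + 1))) (segment ℝ (z (k + 2)) (z (k + 3))))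
    {i j : Fin 5} (hij : i ≠ j) (hi : crossArea (z (i - 1)) (z i) (z (i + 1)) < 0)
    (hj : crossArea (z (j - 1)) (z j) (z (j + 1)) < 0) : 20.784 ≤ polyLength z ^ 2 := by
  have main : ∀ i j : Fin 5, crossArea (z (i - 1)) (z i) (z (i + 1)) < 0 →
      crossArea (z (j - 1)) (z j) (z (j + 1)) < 0 → (j = i + 1 ∨ j = i + 2) →
      20.784 ≤ polyLength z ^ 2 := by
    intro i j hi hj hor
    rw [← polyLength_rotate z i]
    have e4 : (4 : Fin 5) + i = i - 1 := by rw [sub_eq_neg_add]; rfl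
    refine le_polyLength_of_two_reflex_aux (by rw [shoelace_rotate, hS]) ?_ ?_
    · simp only [e4, zero_add, add_comm 1 i]; exact hi
    · rcases hor with rfl | rfl
      · left
        have := hd (i - 1)
        simp only [e4, add_comm _ i, add_zero]
        simp only [add_sub_cancel_right, add_assoc] at hj
        simp only [sub_add_cancel] at this
        have a1 : i - 1 + 2 = i + 1 := by rw [sub_add_eq_add_sub, add_sub_assoc]; rfl
        have a2 : i - 1 + 3 = i + 2 := by rw [sub_add_eq_add_sub, add_sub_assoc]; rfl
        rw [a1, a2] at this
        rw [show (1 : Fin 5) + 1 = 2 from rfl] at hj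
        exact ⟨hj, this⟩
      · right
        simp only [add_comm _ i]
        rw [add_sub_assoc, add_assoc] at hj
        exact hj
  have : (j = i + 1 ∨ j = i + 2) ∨ (i = j + 1 ∨ i = j + 2) := by
    clear hi hj
    revert i j; decide
  rcases this with h | h
  · exact main i j hi hj h
  · exact main j i hj hi h

theorem IsPreconnected.subset_interior_or_subset_compl {X : Type*} [TopologicalSpace X]
    {C R : Set X} (hC : IsPreconnected C) (hR : IsClosed R) (h : Disjoint C (frontier R)) :
    C ⊆ interior R ∨ C ⊆ Rᶜ := by
  refine hC.subset_or_subset isOpen_interior hR.isOpen_compl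
    (disjoint_compl_right.mono_left interior_subset) ?_
  intro x hx
  by_cases hxR : x ∈ R
  · left
    by_contra hi
    exact Set.disjoint_left.1 h hx (hR.frontier_eq ▸ ⟨hxR, hi⟩)
  · exact Or.inr hxR

theorem exp_mul_I_ne_one {θ : ℝ} (h0 : θ ≠ 0) (h1 : -(2 * Real.pi) < θ) (h2 : θ < 2 * Real.pi) :
    Complex.exp (θ * Complex.I) ≠ 1 := by
  intro h
  obtain ⟨n, hn⟩ := Complex.exp_eq_one_iff.1 h
  have hpi := Real.pi_pos
  have hr : θ = n * (2 * Real.pi) := by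
    have := congrArg Complex.im hn
    simpa using this
  rw [hr] at h0 h1 h2
  have a1 : (-1 : ℝ) < n := by nlinarith
  have a2 : (n : ℝ) < 1 := by nlinarith
  have a3 : -1 < n := by exact_mod_cast a1
  have a4 : n < 1 := by exact_mod_cast a2
  have : n = 0 := by omega
  simp [this] at h0

/-- Points close to the positive real axis lie in a thin triangle. -/
theorem exp_mem_thin {δ r φ : ℝ} (hr : 0 < r) (hr' : r ≤ 1 / 2) (hφ : |φ| ≤ 1) (hδ : |φ| < δ / 2) :
    |(r * Complex.exp (φ * Complex.I)).im| < δ * (r * Complex.exp (φ * Complex.I)).re ∧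
    |(r * Complex.exp (φ * Complex.I)).im| < δ * (1 - (r * Complex.exp (φ * Complex.I)).re) := by
  rw [Complex.re_ofReal_mul, Complex.im_ofReal_mul, Complex.exp_ofReal_mul_I_re,
    Complex.exp_ofReal_mul_I_im, abs_mul, abs_of_pos hr]
  have h1 : |Real.sin φ| ≤ |φ| := Real.abs_sin_le_abs
  have h2 := Real.one_sub_sq_div_two_le_cos (x := φ)
  have h3 : φ ^ 2 ≤ 1 := by rw [← sq_abs]; nlinarith [abs_nonneg φ]
  have h4 := Real.cos_le_one φ
  have hδ0 : 0 < δ := by linarith [abs_nonneg φ]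
  constructor
  · rw [mul_left_comm]
    refine mul_lt_mul_of_pos_left ?_ hr
    nlinarith
  · have h5 : r * |Real.sin φ| ≤ 1 / 2 * |φ| := by gcongr
    have h6 : r * Real.cos φ ≤ 1 / 2 := by nlinarith
    nlinarith [abs_nonneg φ]

theorem Fin.five_cases (j k : Fin 5) :
    j = k ∨ j = k + 1 ∨ j = k + 2 ∨ j = k + 3 ∨ j = k - 1 := by
  revert j k; decide

namespace Pentagon

theorem mem_edge {P : Pentagon} {k : Fin 5} {z : ℂ} : z ∈ P.edge k ↔
    ∃ t : ℝ, 0 ≤ t ∧ t ≤ 1 ∧ z = P.vertices k + t * (P.vertices (k + 1) - P.vertices k) := by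
  rw [edge_eq_segment, segment_eq_image']
  simp only [mem_image, mem_Icc, Complex.real_smul, and_assoc, eq_comm]

theorem vertex_mem_edge (P : Pentagon) (k : Fin 5) : P.vertices k ∈ P.edge k :=
  mem_edge.2 ⟨0, le_rfl, zero_le_one, by simp⟩

theorem vertex_succ_mem_edge (P : Pentagon) (k : Fin 5) : P.vertices (k + 1) ∈ P.edge k :=
  mem_edge.2 ⟨1, zero_le_one, le_rfl, by simp⟩

theorem edge_inter (P : Pentagon) (k : Fin 5) :
    P.edge k ∩ P.edge (k + 1) = {P.vertices (k + 1)} := P.edge_inter_succ k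

theorem disjoint_edge (P : Pentagon) (k : Fin 5) : Disjoint (P.edge k) (P.edge (k + 2)) :=
  P.edge_disjoint k

theorem disjoint_edge' (P : Pentagon) (k : Fin 5) : Disjoint (P.edge k) (P.edge (k + 3)) := by
  have : Disjoint (P.edge (k + 3)) (P.edge (k + 3 + 2)) := P.edge_disjoint (k + 3)
  rw [add_assoc, show (3 : Fin 5) + 2 = 0 from rfl, add_zero] at this
  exact this.symm

theorem vertices_succ_ne (P : Pentagon) (k : Fin 5) : P.vertices (k + 1) ≠ P.vertices k := by
  intro h
  refine Set.disjoint_left.1 (P.disjoint_edge' (k + 1)) (?_ : P.vertices k ∈ _) ?_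
  · rw [← h]; exact P.vertex_mem_edge _
  · have := P.vertex_succ_mem_edge (k + 4)
    rw [add_assoc, show (4 : Fin 5) + 1 = 0 from rfl, add_zero] at this
    rw [add_assoc, show (1 : Fin 5) + 3 = 4 from rfl]
    exact this

theorem frontier_eq (P : Pentagon) : frontier P.region = ⋃ k, P.edge k := P.frontier_region

theorem isClosed_region (P : Pentagon) : IsClosed P.region := P.isCompact_region.isClosed

theorem isClosed_edge (P : Pentagon) (k : Fin 5) : IsClosed (P.edge k) := by
  rw [edge_eq_segment, segment_eq_image']
  exact (isCompact_Icc.image (by fun_prop)).isClosed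

theorem isCompact_edge (P : Pentagon) (k : Fin 5) : IsCompact (P.edge k) := by
  rw [edge_eq_segment, segment_eq_image']
  exact isCompact_Icc.image (by fun_prop)

theorem edge_subset_region (P : Pentagon) (k : Fin 5) : P.edge k ⊆ P.region := by
  refine Subset.trans ?_ P.isClosed_region.frontier_subset
  rw [frontier_eq]
  exact subset_iUnion _ k

theorem vertex_notMem_edge (P : Pentagon) {j k : Fin 5} (h1 : j ≠ k) (h2 : j + 1 ≠ k) :
    P.vertices k ∉ P.edge j := by
  have : j = k + 1 ∨ j = k + 2 ∨ j = k + 3 := by clear P; revert j k; decide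
  intro hmem
  rcases this with rfl | rfl | rfl
  · have : P.vertices k ∈ P.edge k ∩ P.edge (k + 1) := ⟨P.vertex_mem_edge k, hmem⟩
    rw [edge_inter] at this
    exact P.vertices_succ_ne k (mem_singleton_iff.1 this).symm
  · exact Set.disjoint_left.1 (P.disjoint_edge k) (P.vertex_mem_edge k) hmem
  · exact Set.disjoint_left.1 (P.disjoint_edge' k) (P.vertex_mem_edge k) hmem

theorem vertices_injective (P : Pentagon) : Function.Injective P.vertices := by
  intro j k h
  by_contra hne
  by_cases h1 : j + 1 = k
  · exact P.vertices_succ_ne j (by rw [h1, h])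
  · exact P.vertex_notMem_edge hne h1 (h ▸ P.vertex_mem_edge j)

theorem eventually_thin_notMem (P : Pentagon) (k j : Fin 5) : ∀ᶠ δ in 𝓝[>] (0 : ℝ), ∀ ζ : ℂ,
    ζ.im ≠ 0 → |ζ.im| < δ * ζ.re → |ζ.im| < δ * (1 - ζ.re) →
    P.vertices k + ζ * (P.vertices (k + 1) - P.vertices k) ∉ P.edge j := by
  have he : P.vertices (k + 1) - P.vertices k ≠ 0 := sub_ne_zero.2 (P.vertices_succ_ne k)
  set e := P.vertices (k + 1) - P.vertices k with hedef
  have hray : ∀ q : ℂ, ∀ᶠ δ in 𝓝[>] (0 : ℝ), ∀ t : ℝ, 0 ≤ t → ∀ ζ : ℂ, ζ = t * q → ζ.im ≠ 0 →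
      ¬ |ζ.im| < δ * ζ.re := by
    intro q
    by_cases hq : q.im = 0
    · refine Eventually.of_forall fun δ t _ ζ hζ him => ?_
      exact absurd (by rw [hζ, Complex.im_ofReal_mul, hq, mul_zero]) him
    · have hpos : 0 < |q.im| / (|q.re| + 1) := by positivity
      filter_upwards [Ioo_mem_nhdsGT hpos] with δ hδ t ht ζ hζ him hlt
      rw [hζ, Complex.im_ofReal_mul, Complex.re_ofReal_mul, abs_mul, abs_of_nonneg ht] at hlt
      have h1 := (lt_div_iff₀ (by positivity)).1 hδ.2
      have h2 : δ * q.re ≤ δ * (|q.re| + 1) := by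
        have := hδ.1; gcongr; linarith [le_abs_self q.re]
      nlinarith
  have hsep : Disjoint (P.edge k) (P.edge j) → ∀ᶠ δ in 𝓝[>] (0 : ℝ), ∀ ζ : ℂ,
      ζ.im ≠ 0 → |ζ.im| < δ * ζ.re → |ζ.im| < δ * (1 - ζ.re) →
      P.vertices k + ζ * e ∉ P.edge j := by
    intro hd
    obtain ⟨r, hr, hrd⟩ := Metric.exists_pos_forall_lt_edist (P.isCompact_edge k)
      (P.isClosed_edge j) hd
    have hpos : 0 < (r : ℝ) / ‖e‖ := div_pos (by exact_mod_cast hr) (norm_pos_iff.2 he)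
    filter_upwards [Ioo_mem_nhdsGT hpos] with δ hδ ζ him h1 h2 hmem
    have hre0 : 0 < ζ.re := by
      by_contra! h
      nlinarith [abs_nonneg ζ.im, mul_nonneg hδ.1.le (neg_nonneg.2 h)]
    have hre1 : ζ.re < 1 := by
      by_contra! h
      nlinarith [abs_nonneg ζ.im, mul_nonneg hδ.1.le (sub_nonneg.2 h)]
    have := hrd (P.vertices k + ζ.re * e) (mem_edge.2 ⟨ζ.re, hre0.le, hre1.le, rfl⟩) _ hmem
    rw [edist_nndist, ENNReal.coe_lt_coe, ← NNReal.coe_lt_coe, coe_nndist, dist_eq_norm,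
      show P.vertices k + ζ.re * e - (P.vertices k + ζ * e) = (ζ.re - ζ) * e by ring, norm_mul]
      at this
    have h3 : ‖(ζ.re : ℂ) - ζ‖ = |ζ.im| := by
      have : (ζ.re : ℂ) - ζ = ((-ζ.im : ℝ) : ℂ) * Complex.I := by
        apply Complex.ext <;> simp
      rw [this, norm_mul, Complex.norm_I, mul_one, Complex.norm_real, Real.norm_eq_abs, abs_neg]
    have h4 := (lt_div_iff₀ (norm_pos_iff.2 he)).1 hδ.2
    rw [h3] at this
    have h5 : |ζ.im| ≤ δ := by nlinarith [hδ.1]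
    nlinarith [norm_nonneg e]
  rcases Fin.five_cases j k with rfl | rfl | rfl | rfl | rfl
  · refine Eventually.of_forall fun δ ζ him _ _ hmem => him ?_
    obtain ⟨t, -, -, ht⟩ := mem_edge.1 hmem
    have : ζ = t := mul_right_cancel₀ he (add_left_cancel ht)
    rw [this]; simp
  · filter_upwards [hray (-(P.vertices (k + 1 + 1) - P.vertices (k + 1)) / e)]
      with δ hδ ζ him h1 h2 hmem
    obtain ⟨t, ht0, -, ht⟩ := mem_edge.1 hmem
    refine hδ t ht0 (1 - ζ) ?_ (by simpa using him) (by simpa using h2)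
    field_simp
    linear_combination -ht + hedef
  · exact hsep (P.disjoint_edge k)
  · exact hsep (P.disjoint_edge' k)
  · filter_upwards [hray ((P.vertices (k - 1) - P.vertices k) / e)] with δ hδ ζ him h1 h2 hmem
    obtain ⟨t, -, ht1, ht⟩ := mem_edge.1 hmem
    rw [sub_add_cancel] at ht
    refine hδ (1 - t) (by linarith) ζ ?_ him h1
    push_cast
    field_simp
    linear_combination ht

/-- The side of the `k`-th edge given by the sign `σ` (left for `1`, right for `-1`) is inside the
pentagon, the other side is outside. -/
def SideIn (P : Pentagon) (k : Fin 5) (σ : ℝ) : Prop :=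
  ∃ δ > 0, ∀ ζ : ℂ, |ζ.im| < δ * ζ.re → |ζ.im| < δ * (1 - ζ.re) →
    (0 < σ * ζ.im → P.vertices k + ζ * (P.vertices (k + 1) - P.vertices k) ∈ interior P.region) ∧
    (σ * ζ.im < 0 → P.vertices k + ζ * (P.vertices (k + 1) - P.vertices k) ∉ P.region)

theorem exists_sideIn (P : Pentagon) (k : Fin 5) : ∃ σ : ℝ, (σ = 1 ∨ σ = -1) ∧ P.SideIn k σ := by
  have he : P.vertices (k + 1) - P.vertices k ≠ 0 := sub_ne_zero.2 (P.vertices_succ_ne k)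
  set e := P.vertices (k + 1) - P.vertices k with hedef
  obtain ⟨δ, hδ, hδ0⟩ := ((Filter.eventually_all.2 fun j => P.eventually_thin_notMem k j).and
    self_mem_nhdsWithin).exists
  have hδ0 : 0 < δ := hδ0
  set U : ℝ → Set ℂ := fun s => {ζ | 0 < s * ζ.im ∧ |ζ.im| < δ * ζ.re ∧ |ζ.im| < δ * (1 - ζ.re)}
    with hU
  have hconv : ∀ s, IsPreconnected ((fun ζ => P.vertices k + ζ * e) '' U s) := by
    intro s
    refine IsPreconnected.image ?_ _ (by fun_prop)
    refine Convex.isPreconnected ?_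
    have hlin : ∀ a b c : ℝ, Convex ℝ {ζ : ℂ | a * ζ.im + b * ζ.re < c} := by
      intro a b c
      exact convex_halfSpace_lt (f := fun ζ : ℂ => a * ζ.im + b * ζ.re)
        ⟨fun x y => by simp; ring, fun t x => by simp; ring⟩ c
    have : U s = {ζ : ℂ | -s * ζ.im + 0 * ζ.re < 0} ∩ ({ζ : ℂ | 1 * ζ.im + -δ * ζ.re < 0} ∩
        {ζ : ℂ | -1 * ζ.im + -δ * ζ.re < 0} ∩ ({ζ : ℂ | 1 * ζ.im + δ * ζ.re < δ} ∩
        {ζ : ℂ | -1 * ζ.im + δ * ζ.re < δ})) := by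
      ext ζ
      simp only [hU, mem_ofPred_eq, mem_inter_iff, abs_lt]
      constructor
      · rintro ⟨h1, ⟨h2, h3⟩, h4, h5⟩
        refine ⟨by linarith, ⟨by linarith, by linarith⟩, by linarith, by linarith⟩
      · rintro ⟨h1, ⟨h2, h3⟩, h4, h5⟩
        refine ⟨by linarith, ⟨by linarith, by linarith⟩, by linarith, by linarith⟩
    rw [this]
    exact (hlin _ _ _).inter (((hlin _ _ _).inter (hlin _ _ _)).inter
      ((hlin _ _ _).inter (hlin _ _ _)))
  have hdis : ∀ s, Disjoint ((fun ζ => P.vertices k + ζ * e) '' U s) (frontier P.region) := by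
    intro s
    rw [Set.disjoint_left]
    rintro _ ⟨ζ, ⟨h1, h2, h3⟩, rfl⟩ hf
    rw [frontier_eq, mem_iUnion] at hf
    obtain ⟨j, hj⟩ := hf
    exact hδ j ζ (fun h => by rw [h, mul_zero] at h1; exact lt_irrefl _ h1) h2 h3 hj
  have hdich := fun s => (hconv s).subset_interior_or_subset_compl P.isClosed_region (hdis s)
  -- near the midpoint of the edge
  have hmid : P.vertices k + (1 / 2 : ℂ) * e ∈ P.edge k :=
    mem_edge.2 ⟨1 / 2, by norm_num, by norm_num, by push_cast; rfl⟩
  have hmidf : P.vertices k + (1 / 2 : ℂ) * e ∈ frontier P.region := by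
    rw [frontier_eq]; exact mem_iUnion_of_mem k hmid
  set f : ℂ → ℂ := fun z => (z - P.vertices k) / e with hf
  have hfc : Continuous f := by fun_prop
  have hfm : f (P.vertices k + (1 / 2 : ℂ) * e) = 1 / 2 := by simp [hf, he]
  have hff : ∀ z, P.vertices k + f z * e = z := by intro z; simp [hf, he]
  have hnear : ∀ᶠ z in 𝓝 (P.vertices k + (1 / 2 : ℂ) * e),
      |(f z).im| < δ * (f z).re ∧ |(f z).im| < δ * (1 - (f z).re) := by
    have h0 : |((1 : ℂ) / 2).im| = 0 := by simp
    have h1 : ((1 : ℂ) / 2).re = 1 / 2 := by simp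
    have c1 : ContinuousAt (fun z => |(f z).im|) (P.vertices k + (1 / 2 : ℂ) * e) := by
      have := Complex.continuous_im.comp hfc
      exact (continuous_abs.comp this).continuousAt
    have c2 : ContinuousAt (fun z => δ * (f z).re) (P.vertices k + (1 / 2 : ℂ) * e) :=
      (continuous_const.mul (Complex.continuous_re.comp hfc)).continuousAt
    have c3 : ContinuousAt (fun z => δ * (1 - (f z).re)) (P.vertices k + (1 / 2 : ℂ) * e) :=
      (continuous_const.mul (continuous_const.sub
        (Complex.continuous_re.comp hfc))).continuousAt
    refine (c1.eventually_lt c2 ?_).and (c1.eventually_lt c3 ?_)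
    · rw [hfm, h0, h1]; linarith
    · rw [hfm, h0, h1]; linarith
  have hU2 : ∀ z, |(f z).im| < δ * (f z).re ∧ |(f z).im| < δ * (1 - (f z).re) →
      z ∈ (fun ζ => P.vertices k + ζ * e) '' U 1 ∨ z ∈ (fun ζ => P.vertices k + ζ * e) '' U (-1) ∨
      z ∈ P.edge k := by
    rintro z ⟨h1, h2⟩
    rcases lt_trichotomy (f z).im 0 with h | h | h
    · exact Or.inr (Or.inl ⟨f z, ⟨by linarith, h1, h2⟩, hff z⟩)
    · refine Or.inr (Or.inr (mem_edge.2 ⟨(f z).re, ?_, ?_, ?_⟩))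
      · rw [h, abs_zero] at h1; exact (pos_of_mul_pos_right h1 hδ0.le).le
      · rw [h, abs_zero] at h2; linarith [pos_of_mul_pos_right h2 hδ0.le]
      · rw [← hedef]
        conv_lhs => rw [← hff z]
        congr 2
        apply Complex.ext <;> simp [h]
    · exact Or.inl ⟨f z, ⟨by linarith, h1, h2⟩, hff z⟩
  have key : ∀ σ : ℝ, (fun ζ => P.vertices k + ζ * e) '' U σ ⊆ interior P.region →
      (fun ζ => P.vertices k + ζ * e) '' U (-σ) ⊆ P.regionᶜ → P.SideIn k σ := by
    intro σ h1 h2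
    refine ⟨δ, hδ0, fun ζ hζ hζ' => ⟨fun h => h1 ⟨ζ, ⟨h, hζ, hζ'⟩, rfl⟩,
      fun h => h2 ⟨ζ, ⟨by linarith, hζ, hζ'⟩, rfl⟩⟩⟩
  rcases hdich 1 with h1 | h1 <;> rcases hdich (-1) with h2 | h2
  · exfalso
    have : P.vertices k + (1 / 2 : ℂ) * e ∈ interior P.region := by
      rw [mem_interior_iff_mem_nhds]
      filter_upwards [hnear] with z hz
      rcases hU2 z hz with h | h | h
      · exact interior_subset (h1 h)
      · exact interior_subset (h2 h)
      · exact P.edge_subset_region k h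
    exact hmidf.2 this
  · exact ⟨1, Or.inl rfl, key 1 h1 h2⟩
  · exact ⟨-1, Or.inr rfl, key (-1) h2 (by rw [neg_neg]; exact h1)⟩
  · exfalso
    have hcl : P.vertices k + (1 / 2 : ℂ) * e ∈ closure (interior P.region) := by
      rw [P.closure_interior_region]; exact P.edge_subset_region k hmid
    obtain ⟨z, hz, hzi⟩ := mem_closure_iff_nhds.1 hcl _ hnear
    rcases hU2 z hz with h | h | h
    · exact h1 h (interior_subset hzi)
    · exact h2 h (interior_subset hzi)
    · have : z ∈ frontier P.region := by rw [frontier_eq]; exact mem_iUnion_of_mem k h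
      exact this.2 hzi

end Pentagon

/-- A complex number off the nonnegative real axis has an argument in `(0, 2π)`, measured
counterclockwise or clockwise. -/
theorem exists_angle {q : ℂ} (hne : ∀ t : ℝ, 0 ≤ t → q ≠ t) {σ : ℝ}
    (hσ : σ = 1 ∨ σ = -1) : ∃ α ∈ Ioo (0 : ℝ) (2 * Real.pi),
      q = ‖q‖ * Complex.exp ((σ * α : ℝ) * Complex.I) := by
  have hpi := Real.pi_pos
  have hnorm := Complex.norm_mul_exp_arg_mul_I q
  have h0 : q.arg ≠ 0 := by
    intro h
    rw [Complex.arg_eq_zero_iff] at h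
    exact hne q.re h.1 (by apply Complex.ext <;> simp [h.2])
  have h1 := Complex.neg_pi_lt_arg q
  have h2 := Complex.arg_le_pi q
  have hper : ∀ θ : ℝ, Complex.exp ((θ + 2 * Real.pi : ℝ) * Complex.I) =
      Complex.exp (θ * Complex.I) := by
    intro θ
    rw [← Complex.exp_periodic (θ * Complex.I)]
    congr 1
    push_cast; ring
  have hccw : ∃ α ∈ Ioo (0 : ℝ) (2 * Real.pi), q = ‖q‖ * Complex.exp (α * Complex.I) := by
    rcases lt_or_gt_of_ne h0 with h | h
    · exact ⟨q.arg + 2 * Real.pi, ⟨by linarith, by linarith⟩, by rw [hper, hnorm]⟩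
    · exact ⟨q.arg, ⟨h, by linarith⟩, hnorm.symm⟩
  obtain ⟨α, ⟨ha, hb⟩, hα⟩ := hccw
  rcases hσ with rfl | rfl
  · exact ⟨α, ⟨ha, hb⟩, by rw [one_mul]; exact hα⟩
  · refine ⟨2 * Real.pi - α, ⟨by linarith, by linarith⟩, ?_⟩
    rw [show -1 * (2 * Real.pi - α) = α - 2 * Real.pi by ring, ← hper, sub_add_cancel]
    exact hα

namespace Pentagon

/-- The pentagon fills the sector of angle `α` at the `k`-th vertex which starts at the `k`-th edge
and extends counterclockwise (`σ = 1`) or clockwise (`σ = -1`). -/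
def HasSector (P : Pentagon) (k : Fin 5) (σ α : ℝ) : Prop :=
  ∃ ε > 0, ∀ r : ℝ, 0 < r → r < ε → ∀ φ : ℝ,
    (0 < φ → φ < α → P.vertices k + r * Complex.exp ((σ * φ : ℝ) * Complex.I) *
      (P.vertices (k + 1) - P.vertices k) ∈ interior P.region) ∧
    (α < φ → φ < 2 * Real.pi → P.vertices k + r * Complex.exp ((σ * φ : ℝ) * Complex.I) *
      (P.vertices (k + 1) - P.vertices k) ∉ P.region)

theorem exists_near_vertex (P : Pentagon) (k : Fin 5) : ∃ ε > 0, ∀ ζ : ℂ, ‖ζ‖ < ε →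
    P.vertices k + ζ * (P.vertices (k + 1) - P.vertices k) ∈ frontier P.region →
    (∃ t : ℝ, 0 ≤ t ∧ ζ = t) ∨ ∃ t : ℝ, 0 ≤ t ∧
      ζ = t * ((P.vertices (k - 1) - P.vertices k) / (P.vertices (k + 1) - P.vertices k)) := by
  have he : P.vertices (k + 1) - P.vertices k ≠ 0 := sub_ne_zero.2 (P.vertices_succ_ne k)
  set e := P.vertices (k + 1) - P.vertices k with hedef
  have hfar : ∀ᶠ z in 𝓝 (P.vertices k), ∀ j : Fin 5, j ≠ k → j + 1 ≠ k → z ∉ P.edge j := by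
    refine Filter.eventually_all.2 fun j => ?_
    by_cases h1 : j ≠ k
    · by_cases h2 : j + 1 ≠ k
      · filter_upwards [(P.isClosed_edge j).isOpen_compl.mem_nhds (P.vertex_notMem_edge h1 h2)]
          with z hz _ _ using hz
      · exact Eventually.of_forall fun z _ h => absurd h h2
    · exact Eventually.of_forall fun z h => absurd h h1
  have hcont : Tendsto (fun ζ : ℂ => P.vertices k + ζ * e) (𝓝 0) (𝓝 (P.vertices k)) := by
    have : Continuous (fun ζ : ℂ => P.vertices k + ζ * e) := by fun_prop
    simpa using this.tendsto 0
  obtain ⟨ε, hε, hball⟩ := Metric.eventually_nhds_iff.1 (hcont.eventually hfar)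
  refine ⟨ε, hε, fun ζ hζ hf => ?_⟩
  rw [frontier_eq, mem_iUnion] at hf
  obtain ⟨j, hj⟩ := hf
  by_cases h1 : j = k
  · left
    subst h1
    obtain ⟨t, ht0, -, ht⟩ := mem_edge.1 hj
    exact ⟨t, ht0, mul_right_cancel₀ he (add_left_cancel ht)⟩
  · by_cases h2 : j + 1 = k
    · right
      subst h2
      obtain ⟨t, -, ht1, ht⟩ := mem_edge.1 hj
      refine ⟨1 - t, by linarith, ?_⟩
      rw [add_sub_cancel_right]
      push_cast
      field_simp
      linear_combination ht
    · exact absurd hj (hball (by simpa using hζ) j h1 h2)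

theorem prev_ratio_ne (P : Pentagon) (k : Fin 5) (t : ℝ) (ht : 0 ≤ t) :
    (P.vertices (k - 1) - P.vertices k) / (P.vertices (k + 1) - P.vertices k) ≠ t := by
  have he : P.vertices (k + 1) - P.vertices k ≠ 0 := sub_ne_zero.2 (P.vertices_succ_ne k)
  have he' : P.vertices (k - 1) - P.vertices k ≠ 0 := by
    have := P.vertices_succ_ne (k - 1)
    rw [sub_add_cancel] at this
    exact sub_ne_zero.2 this.symm
  intro h
  rw [div_eq_iff he] at h
  have ht0 : 0 < t := ht.lt_of_ne (fun h0 => he' (by rw [h, ← h0]; simp))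
  have hm : 0 < min 1 t := lt_min one_pos ht0
  have : P.vertices k + (min 1 t : ℝ) * (P.vertices (k + 1) - P.vertices k) ∈
      P.edge (k - 1) ∩ P.edge (k - 1 + 1) := by
    constructor
    · refine mem_edge.2 ⟨1 - min 1 t / t, ?_, ?_, ?_⟩
      · rw [sub_nonneg, div_le_one ht0]; exact min_le_right _ _
      · have : 0 < min 1 t / t := by positivity
        linarith
      · rw [sub_add_cancel]
        have htc : (t : ℂ) ≠ 0 := by exact_mod_cast ht0.ne'
        push_cast
        rw [show P.vertices k - P.vertices (k - 1) = -(P.vertices (k - 1) - P.vertices k) by ring,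
          h, show P.vertices (k - 1) = P.vertices k + t * (P.vertices (k + 1) - P.vertices k) by
          rw [← h]; ring]
        field_simp
        ring
    · rw [sub_add_cancel]
      exact mem_edge.2 ⟨min 1 t, hm.le, min_le_left _ _, rfl⟩
  rw [edge_inter, sub_add_cancel, mem_singleton_iff] at this
  have h2 : ((min 1 t : ℝ) : ℂ) * (P.vertices (k + 1) - P.vertices k) = 0 := by
    linear_combination this
  rcases mul_eq_zero.1 h2 with h3 | h3
  · exact hm.ne' (by exact_mod_cast h3)
  · exact he h3

/-- The inner sides of consecutive edges agree, and bound the sector at the common vertex. -/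
theorem exists_sector (P : Pentagon) (k : Fin 5) {σ : ℝ} (hσ : σ = 1 ∨ σ = -1)
    (hside : P.SideIn k σ) : P.SideIn (k - 1) σ ∧ ∃ α ∈ Ioo (0 : ℝ) (2 * Real.pi),
      (P.vertices (k - 1) - P.vertices k) * dist (P.vertices k) (P.vertices (k + 1)) =
        (P.vertices (k + 1) - P.vertices k) * dist (P.vertices (k - 1)) (P.vertices k) *
          Complex.exp ((σ * α : ℝ) * Complex.I) ∧ P.HasSector k σ α := by
  have hpi := Real.pi_pos
  have he : P.vertices (k + 1) - P.vertices k ≠ 0 := sub_ne_zero.2 (P.vertices_succ_ne k)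
  have he' : P.vertices (k - 1) - P.vertices k ≠ 0 := by
    have := P.vertices_succ_ne (k - 1)
    rw [sub_add_cancel] at this
    exact sub_ne_zero.2 this.symm
  set q := (P.vertices (k - 1) - P.vertices k) / (P.vertices (k + 1) - P.vertices k) with hq
  have hq0 : q ≠ 0 := div_ne_zero he' he
  obtain ⟨α, hα, hqα⟩ := exists_angle (q := q) (fun t ht => P.prev_ratio_ne k t ht) hσ
  obtain ⟨ε, hε, hnear⟩ := P.exists_near_vertex k
  rw [← hq] at hnear
  set e := P.vertices (k + 1) - P.vertices k with hedef
  have hsin : ∀ r φ : ℝ, σ * (r * Complex.exp ((σ * φ : ℝ) * Complex.I)).im = r * Real.sin φ := by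
    intro r φ
    rw [Complex.im_ofReal_mul, Complex.exp_ofReal_mul_I_im]
    rcases hσ with rfl | rfl
    · simp
    · simp
  have habs : ∀ φ : ℝ, |σ * φ| = |φ| := by
    intro φ; rcases hσ with rfl | rfl <;> simp
  -- points at an angle strictly between those of the two edges are off the boundary
  have hoff : ∀ r φ : ℝ, 0 < r → r < ε → 0 < φ → φ < 2 * Real.pi → φ ≠ α →
      P.vertices k + r * Complex.exp ((σ * φ : ℝ) * Complex.I) * e ∉ frontier P.region := by
    intro r φ hr hrε h0 h1 hne hf
    have hn : ∀ r : ℝ, 0 ≤ r → ∀ φ : ℝ, ‖(r : ℂ) * Complex.exp ((φ : ℝ) * Complex.I)‖ = r := by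
      intro r hr φ
      rw [norm_mul, Complex.norm_exp_ofReal_mul_I, mul_one, Complex.norm_real,
        Real.norm_of_nonneg hr]
    rcases hnear _ (by rw [hn r hr.le]; exact hrε) hf with ⟨t, ht, h⟩ | ⟨t, ht, h⟩
    · have h2 := congrArg norm h
      rw [hn r hr.le, Complex.norm_real, Real.norm_of_nonneg ht] at h2
      rw [← h2, mul_eq_left₀ (by exact_mod_cast hr.ne')] at h
      refine exp_mul_I_ne_one ?_ ?_ ?_ h <;> rcases hσ with rfl | rfl <;> linarith
    · rw [hqα, ← mul_assoc, ← Complex.ofReal_mul] at h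
      have h2 := congrArg norm h
      rw [hn r hr.le, hn _ (by positivity)] at h2
      rw [← h2] at h
      have h3 := mul_left_cancel₀ (by exact_mod_cast hr.ne') h
      have h4 : Complex.exp ((σ * φ - σ * α : ℝ) * Complex.I) = 1 := by
        rw [Complex.ofReal_sub, sub_mul, Complex.exp_sub, h3, div_self (Complex.exp_ne_zero _)]
      obtain ⟨ha, hb⟩ := hα
      have h5 : φ - α ≠ 0 := sub_ne_zero.2 hne
      refine exp_mul_I_ne_one ?_ ?_ ?_ h4 <;> rcases hσ with rfl | rfl <;>
        first | linarith | skip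
      · simpa using h5
      · intro h6; apply h5; linarith
  have hsector : ∀ a b : ℝ, 0 ≤ a → b ≤ 2 * Real.pi → α ∉ Ioo a b →
      (∀ r φ : ℝ, 0 < r → r < ε → a < φ → φ < b →
        P.vertices k + r * Complex.exp ((σ * φ : ℝ) * Complex.I) * e ∈ interior P.region) ∨
      (∀ r φ : ℝ, 0 < r → r < ε → a < φ → φ < b →
        P.vertices k + r * Complex.exp ((σ * φ : ℝ) * Complex.I) * e ∉ P.region) := by
    intro a b ha hb hαab
    set C : Set ℂ := (fun p : ℝ × ℝ => P.vertices k + p.1 *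
      Complex.exp ((σ * p.2 : ℝ) * Complex.I) * e) '' (Ioo 0 ε ×ˢ Ioo a b) with hC
    have hpre : IsPreconnected C := by
      refine IsPreconnected.image (isPreconnected_Ioo.prod isPreconnected_Ioo) _ ?_
      fun_prop
    have hd : Disjoint C (frontier P.region) := by
      rw [Set.disjoint_left]
      rintro _ ⟨⟨r, φ⟩, ⟨⟨h1, h2⟩, h3, h4⟩, rfl⟩
      exact hoff r φ h1 h2 (by linarith) (by linarith) (fun h => hαab (h ▸ ⟨h3, h4⟩))
    refine (hpre.subset_interior_or_subset_compl P.isClosed_region hd).imp ?_ ?_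
    · intro h r φ h1 h2 h3 h4
      exact h ⟨(r, φ), ⟨⟨h1, h2⟩, h3, h4⟩, rfl⟩
    · intro h r φ h1 h2 h3 h4
      exact h ⟨(r, φ), ⟨⟨h1, h2⟩, h3, h4⟩, rfl⟩
  obtain ⟨ha, hb⟩ := hα
  obtain ⟨δ, hδ, hδs⟩ := hside
  set r₀ := min (ε / 2) (1 / 2) with hr₀
  have hr₀0 : 0 < r₀ := by positivity
  have hr₀h : r₀ ≤ 1 / 2 := min_le_right _ _
  have hr₀ε : r₀ < ε := (min_le_left _ _).trans_lt (by linarith)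
  have hin : ∀ r φ : ℝ, 0 < r → r < ε → 0 < φ → φ < α →
      P.vertices k + r * Complex.exp ((σ * φ : ℝ) * Complex.I) * e ∈ interior P.region := by
    refine (hsector 0 α le_rfl hb.le (fun h => lt_irrefl _ h.2)).resolve_right fun hout => ?_
    set φ := min (α / 2) (min 1 (δ / 4)) with hφ
    have hφ0 : 0 < φ := by positivity
    have hφ1 : φ ≤ 1 := (min_le_right _ _).trans (min_le_left _ _)
    have hφδ : φ < δ / 2 := ((min_le_right _ _).trans (min_le_right _ _)).trans_lt (by linarith)
    have hφα : φ < α := (min_le_left _ _).trans_lt (by linarith)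
    have hthin := exp_mem_thin (δ := δ) (φ := σ * φ) hr₀0 hr₀h
      (by rw [habs, abs_of_pos hφ0]; exact hφ1) (by rw [habs, abs_of_pos hφ0]; exact hφδ)
    refine hout r₀ φ hr₀0 hr₀ε hφ0 hφα (interior_subset ((hδs _ hthin.1 hthin.2).1 ?_))
    rw [hsin]
    exact mul_pos hr₀0 (Real.sin_pos_of_pos_of_lt_pi hφ0 (by linarith [Real.pi_gt_three]))
  have hout : ∀ r φ : ℝ, 0 < r → r < ε → α < φ → φ < 2 * Real.pi →
      P.vertices k + r * Complex.exp ((σ * φ : ℝ) * Complex.I) * e ∉ P.region := by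
    refine (hsector α (2 * Real.pi) ha.le le_rfl (fun h => lt_irrefl _ h.1)).resolve_left
      fun hin => ?_
    set φ := min ((2 * Real.pi - α) / 2) (min 1 (δ / 4)) with hφ
    have hφ0 : 0 < φ := lt_min (by linarith) (by positivity)
    have hφ1 : φ ≤ 1 := (min_le_right _ _).trans (min_le_left _ _)
    have hφδ : φ < δ / 2 := ((min_le_right _ _).trans (min_le_right _ _)).trans_lt (by linarith)
    have hφα : φ < 2 * Real.pi - α := (min_le_left _ _).trans_lt (by linarith)
    have hthin := exp_mem_thin (δ := δ) (φ := σ * (-φ)) hr₀0 hr₀h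
      (by rw [habs, abs_neg, abs_of_pos hφ0]; exact hφ1)
      (by rw [habs, abs_neg, abs_of_pos hφ0]; exact hφδ)
    have hexp : Complex.exp ((σ * (-φ) : ℝ) * Complex.I) =
        Complex.exp ((σ * (2 * Real.pi - φ) : ℝ) * Complex.I) := by
      rcases hσ with rfl | rfl
      · rw [← Complex.exp_periodic]; congr 1; push_cast; ring
      · rw [← Complex.exp_periodic ((-1 * (2 * Real.pi - φ) : ℝ) * Complex.I)]
        congr 1; push_cast; ring
    refine (hδs _ hthin.1 hthin.2).2 ?_ ?_
    · rw [hsin, Real.sin_neg, mul_neg, neg_lt_zero]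
      exact mul_pos hr₀0 (Real.sin_pos_of_pos_of_lt_pi hφ0 (by linarith [Real.pi_gt_three]))
    · rw [hexp]
      exact interior_subset (hin r₀ _ hr₀0 hr₀ε (by linarith) (by linarith))
  refine ⟨?_, α, ⟨ha, hb⟩, ?_, ε, hε, fun r hr hrε φ => ⟨hin r φ hr hrε, hout r φ hr hrε⟩⟩
  · obtain ⟨σ', hσ', hside'⟩ := P.exists_sideIn (k - 1)
    by_cases hs : σ' = σ
    · exact hs ▸ hside'
    exfalso
    have hs' : σ' = -σ := by
      rcases hσ with rfl | rfl <;> rcases hσ' with rfl | rfl <;>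
        first | exact absurd rfl hs | norm_num
    obtain ⟨δ', hδ', hδs'⟩ := hside'
    rw [sub_add_cancel] at hδs'
    have hqn : 0 < ‖q‖ := norm_pos_iff.2 hq0
    set r₁ := min (ε / ‖q‖ / 2) (1 / 2) with hr₁
    have hr₁0 : 0 < r₁ := by positivity
    have hr₁h : r₁ ≤ 1 / 2 := min_le_right _ _
    have hr₁ε : r₁ * ‖q‖ < ε := by
      have : r₁ < ε / ‖q‖ := (min_le_left _ _).trans_lt (by
        have : 0 < ε / ‖q‖ := by positivity
        linarith)
      exact (lt_div_iff₀ hqn).1 this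
    set φ := min (α / 2) (min 1 (δ' / 4)) with hφ
    have hφ0 : 0 < φ := by positivity
    have hφ1 : φ ≤ 1 := (min_le_right _ _).trans (min_le_left _ _)
    have hφδ : φ < δ' / 2 := ((min_le_right _ _).trans (min_le_right _ _)).trans_lt (by linarith)
    have hφα : φ < α := (min_le_left _ _).trans_lt (by linarith)
    have hthin := exp_mem_thin (δ := δ') (φ := σ * (-φ)) hr₁0 hr₁h
      (by rw [habs, abs_neg, abs_of_pos hφ0]; exact hφ1)
      (by rw [habs, abs_neg, abs_of_pos hφ0]; exact hφδ)
    set ξ := r₁ * Complex.exp ((σ * (-φ) : ℝ) * Complex.I) with hξ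
    have hi : (1 - ξ).im = -ξ.im := by simp
    have hre : (1 - ξ).re = 1 - ξ.re := by simp
    refine (hδs' (1 - ξ) ?_ ?_).2 ?_ ?_
    · rw [hi, hre, abs_neg]; exact hthin.2
    · rw [hi, hre, abs_neg, sub_sub_cancel]; exact hthin.1
    · rw [hi, hs', neg_mul_neg, hξ, hsin, Real.sin_neg, mul_neg, neg_lt_zero]
      exact mul_pos hr₁0 (Real.sin_pos_of_pos_of_lt_pi hφ0 (by linarith [Real.pi_gt_three]))
    · have := hin (r₁ * ‖q‖) (α - φ) (by positivity) hr₁ε (by linarith) (by linarith)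
      convert interior_subset this using 1
      have h1 : P.vertices (k - 1) = P.vertices k + q * e := by rw [hq, div_mul_cancel₀ _ he]; ring
      have h2 : ((r₁ * ‖q‖ : ℝ) : ℂ) * Complex.exp ((σ * (α - φ) : ℝ) * Complex.I) = ξ * q := by
        rw [hξ]
        conv_rhs => rw [hqα]
        rw [show ((σ * (α - φ) : ℝ) : ℂ) * Complex.I = (σ * (-φ) : ℝ) * Complex.I +
          (σ * α : ℝ) * Complex.I by push_cast; ring, Complex.exp_add]
        push_cast; ring
      rw [h2, h1]
      ring
  · have h1 : P.vertices (k - 1) - P.vertices k = q * e := by rw [hq, div_mul_cancel₀ _ he]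
    have h2 : dist (P.vertices (k - 1)) (P.vertices k) = ‖q‖ * ‖e‖ := by
      rw [dist_eq_norm, h1, norm_mul]
    have h3 : dist (P.vertices k) (P.vertices (k + 1)) = ‖e‖ := by
      rw [dist_comm, dist_eq_norm]
    rw [h1, h2, h3]
    conv_lhs => rw [hqα]
    push_cast; ring

/-- A pentagon is oriented: its region lies on the same side of all of its edges. -/
theorem exists_orientation (P : Pentagon) :
    ∃ σ : ℝ, (σ = 1 ∨ σ = -1) ∧ ∀ k, P.SideIn k σ := by
  obtain ⟨σ, hσ, h0⟩ := P.exists_sideIn 0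
  have h4 := (P.exists_sector 0 hσ h0).1
  have h3 := (P.exists_sector _ hσ h4).1
  have h2 := (P.exists_sector _ hσ h3).1
  have h1 := (P.exists_sector _ hσ h2).1
  refine ⟨σ, hσ, fun k => ?_⟩
  fin_cases k
  · exact h0
  · exact h1
  · exact h2
  · exact h3
  · exact h4

end Pentagon

namespace Pentagon

/-- The directions which point from the `k`-th vertex into the pentagon. -/
def directions (P : Pentagon) (k : Fin 5) : Set ℝ :=
  {θ : ℝ | θ ∈ Ioc (-Real.pi) Real.pi ∧
    ∀ᶠ t : ℝ in 𝓝[>] 0, P.vertices k + t * Complex.exp (θ * Complex.I) ∈ P.region}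

theorem angle_eq_volume_directions (P : Pentagon) (k : Fin 5) :
    P.angle k = volume.real (P.directions k) := rfl

theorem eventually_direction {P : Pentagon} {k : Fin 5} {σ α : ℝ} (hσ : σ = 1 ∨ σ = -1)
    (h : P.HasSector k σ α) {θ : ℝ} {n : ℤ} :
    (σ * (θ - (P.vertices (k + 1) - P.vertices k).arg) - n * (2 * Real.pi) ∈ Ioo 0 α →
      ∀ᶠ t : ℝ in 𝓝[>] 0, P.vertices k + t * Complex.exp (θ * Complex.I) ∈ interior P.region) ∧
    (σ * (θ - (P.vertices (k + 1) - P.vertices k).arg) - n * (2 * Real.pi) ∈ Ioo α (2 * Real.pi) →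
      ∀ᶠ t : ℝ in 𝓝[>] 0, P.vertices k + t * Complex.exp (θ * Complex.I) ∉ P.region) := by
  have he : P.vertices (k + 1) - P.vertices k ≠ 0 := sub_ne_zero.2 (P.vertices_succ_ne k)
  obtain ⟨ε, hε, hs⟩ := h
  set e := P.vertices (k + 1) - P.vertices k with hedef
  have hen : 0 < ‖e‖ := norm_pos_iff.2 he
  have hexp : ∀ t : ℝ, (t / ‖e‖ : ℝ) * Complex.exp ((σ * (σ * (θ - e.arg) - n * (2 * Real.pi)) : ℝ)
      * Complex.I) * e = t * Complex.exp (θ * Complex.I) := by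
    intro t
    have h1 : Complex.exp ((σ * (σ * (θ - e.arg) - n * (2 * Real.pi)) : ℝ) * Complex.I) =
        Complex.exp ((θ - e.arg : ℝ) * Complex.I) := by
      rw [Complex.exp_eq_exp_iff_exists_int]
      rcases hσ with rfl | rfl
      · exact ⟨-n, by push_cast; ring⟩
      · exact ⟨n, by push_cast; ring⟩
    rw [h1]
    have h3 := Complex.norm_mul_exp_arg_mul_I e
    have h2 : Complex.exp (θ * Complex.I) =
        Complex.exp ((θ - e.arg : ℝ) * Complex.I) * Complex.exp (e.arg * Complex.I) := by
      rw [← Complex.exp_add]; congr 1; push_cast; ring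
    rw [h2]
    have : (‖e‖ : ℂ) ≠ 0 := by exact_mod_cast hen.ne'
    rw [Complex.ofReal_div, div_mul_eq_mul_div, div_mul_eq_mul_div, div_eq_iff this]
    linear_combination -(t * Complex.exp ((θ - e.arg : ℝ) * Complex.I)) * h3
  have hev : ∀ᶠ t : ℝ in 𝓝[>] 0, 0 < t / ‖e‖ ∧ t / ‖e‖ < ε := by
    filter_upwards [Ioo_mem_nhdsGT (show 0 < ε * ‖e‖ by positivity)] with t ht
    exact ⟨div_pos ht.1 hen, (div_lt_iff₀ hen).2 ht.2⟩
  constructor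
  · rintro ⟨h1, h2⟩
    filter_upwards [hev] with t ht
    have := (hs _ ht.1 ht.2 _).1 h1 h2
    rwa [hexp] at this
  · rintro ⟨h1, h2⟩
    filter_upwards [hev] with t ht
    have := (hs _ ht.1 ht.2 _).2 h1 h2
    rwa [hexp] at this

theorem ae_exists_int_mem (σ a α : ℝ) (hσ : σ = 1 ∨ σ = -1) : ∀ᵐ θ : ℝ, ∃ n : ℤ,
    σ * (θ - a) - n * (2 * Real.pi) ∈ Ioo 0 α ∨
    σ * (θ - a) - n * (2 * Real.pi) ∈ Ioo α (2 * Real.pi) := by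
  have hpi := Real.pi_pos
  have hσ2 : σ * σ = 1 := by rcases hσ with rfl | rfl <;> norm_num
  have hc : (⋃ n : ℤ, ({a + σ * (n * (2 * Real.pi)), a + σ * (α + n * (2 * Real.pi))} :
      Set ℝ)).Countable := countable_iUnion fun n => (Set.toFinite _).countable
  filter_upwards [hc.ae_notMem volume] with θ hθ
  set n := ⌊σ * (θ - a) / (2 * Real.pi)⌋ with hn
  refine ⟨n, ?_⟩
  have h1 : n * (2 * Real.pi) ≤ σ * (θ - a) := by
    rw [← le_div_iff₀ (by positivity)]; exact Int.floor_le _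
  have h2 : σ * (θ - a) < (n + 1) * (2 * Real.pi) := by
    rw [← div_lt_iff₀ (by positivity)]; exact Int.lt_floor_add_one _
  simp only [mem_iUnion, mem_insert_iff, mem_singleton_iff, not_exists, not_or] at hθ
  have h3 : σ * (θ - a) - n * (2 * Real.pi) ≠ 0 := by
    intro h
    apply (hθ n).1
    linear_combination σ * h - (θ - a) * hσ2
  have h4 : σ * (θ - a) - n * (2 * Real.pi) ≠ α := by
    intro h
    apply (hθ n).2
    linear_combination σ * h - (θ - a) * hσ2
  rcases lt_or_gt_of_ne h4 with h | h
  · exact Or.inl ⟨lt_of_le_of_ne (by linarith) h3.symm, h⟩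
  · exact Or.inr ⟨h, by linarith⟩

/-- Almost every direction at a vertex points into the interior or into the exterior. -/
theorem ae_direction (P : Pentagon) (k : Fin 5) : ∀ᵐ θ : ℝ,
    (∀ᶠ t : ℝ in 𝓝[>] 0, P.vertices k + t * Complex.exp (θ * Complex.I) ∈ interior P.region) ∨
    ∀ᶠ t : ℝ in 𝓝[>] 0, P.vertices k + t * Complex.exp (θ * Complex.I) ∉ P.region := by
  obtain ⟨σ, hσ, hs⟩ := P.exists_orientation
  obtain ⟨-, α, -, -, hsec⟩ := P.exists_sector k hσ (hs k)
  filter_upwards [ae_exists_int_mem σ (P.vertices (k + 1) - P.vertices k).arg α hσ] with θ hθ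
  obtain ⟨n, h | h⟩ := hθ
  · exact Or.inl ((eventually_direction hσ hsec).1 h)
  · exact Or.inr ((eventually_direction hσ hsec).2 h)

theorem directions_ae_eq {P : Pentagon} {k : Fin 5} {σ α : ℝ} (hσ : σ = 1 ∨ σ = -1)
    (h : P.HasSector k σ α) : P.directions k =ᵐ[volume] ((⋃ n : ℤ,
      {θ : ℝ | σ * (θ - (P.vertices (k + 1) - P.vertices k).arg) - n * (2 * Real.pi) ∈ Ioo 0 α}) ∩
      Ioc (-Real.pi) Real.pi : Set ℝ) := by
  filter_upwards [ae_exists_int_mem σ (P.vertices (k + 1) - P.vertices k).arg α hσ] with θ hθ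
  apply propext
  constructor
  · rintro ⟨h1, h2⟩
    refine ⟨?_, h1⟩
    obtain ⟨n, hn | hn⟩ := hθ
    · exact mem_iUnion.2 ⟨n, hn⟩
    · obtain ⟨t, ht⟩ := (h2.and ((eventually_direction hσ h).2 hn)).exists
      exact absurd ht.1 ht.2
  · rintro ⟨h1, h2⟩
    obtain ⟨n, hn⟩ := mem_iUnion.1 h1
    exact ⟨h2, ((eventually_direction hσ h).1 hn).mono fun t ht => interior_subset ht⟩

theorem measurableSet_sector (σ a α : ℝ) : MeasurableSet (⋃ n : ℤ,
    {θ : ℝ | σ * (θ - a) - n * (2 * Real.pi) ∈ Ioo 0 α}) := by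
  refine MeasurableSet.iUnion fun n => ?_
  exact (isOpen_Ioo.preimage (by fun_prop : Continuous fun θ : ℝ =>
    σ * (θ - a) - n * (2 * Real.pi))).measurableSet

theorem nullMeasurableSet_directions (P : Pentagon) (k : Fin 5) :
    NullMeasurableSet (P.directions k) := by
  obtain ⟨σ, hσ, hs⟩ := P.exists_orientation
  obtain ⟨-, α, -, -, hsec⟩ := P.exists_sector k hσ (hs k)
  exact (((measurableSet_sector _ _ _).inter measurableSet_Ioc).nullMeasurableSet).congr
    (directions_ae_eq hσ hsec).symm

theorem angle_eq {P : Pentagon} {k : Fin 5} {σ α : ℝ} (hσ : σ = 1 ∨ σ = -1)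
    (h : P.HasSector k σ α) (hα : α ∈ Ioo (0 : ℝ) (2 * Real.pi)) : P.angle k = α := by
  have hpi := Real.pi_pos
  obtain ⟨ha, hb⟩ := hα
  set a := (P.vertices (k + 1) - P.vertices k).arg with hadef
  rw [angle_eq_volume_directions, measureReal_congr (directions_ae_eq hσ h), ← hadef]
  set A : Set ℝ := ⋃ n : ℤ, {θ : ℝ | σ * (θ - a) - n * (2 * Real.pi) ∈ Ioo 0 α} with hA
  have hinv : ∀ g : AddSubgroup.zmultiples (2 * Real.pi), (fun x => g +ᵥ x) ⁻¹' A = A := by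
    rintro ⟨g, m, rfl⟩
    ext θ
    simp only [hA, mem_preimage, mem_iUnion, AddSubgroup.mk_vadd, mem_ofPred_eq, vadd_eq_add,
      zsmul_eq_mul]
    rcases hσ with rfl | rfl
    · constructor
      · rintro ⟨n, hn⟩
        refine ⟨n - m, ?_⟩
        convert hn using 1
        push_cast; ring
      · rintro ⟨n, hn⟩
        refine ⟨n + m, ?_⟩
        convert hn using 1
        push_cast; ring
    · constructor
      · rintro ⟨n, hn⟩
        refine ⟨n + m, ?_⟩
        convert hn using 1
        push_cast; ring
      · rintro ⟨n, hn⟩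
        refine ⟨n - m, ?_⟩
        convert hn using 1
        push_cast; ring
  have hshift : ∀ s : ℝ, volume.real (A ∩ Ioc (-Real.pi) Real.pi) =
      volume.real (A ∩ Ioc s (s + 2 * Real.pi)) := by
    intro s
    have := (isAddFundamentalDomain_Ioc (show 0 < 2 * Real.pi by positivity)
      (-Real.pi)).measure_set_eq (μ := volume) (isAddFundamentalDomain_Ioc
      (show 0 < 2 * Real.pi by positivity) s) (measurableSet_sector σ a α) hinv
    rw [show -Real.pi + 2 * Real.pi = Real.pi by ring] at this
    simp only [measureReal_def, hA]
    rw [this]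
  rcases hσ with rfl | rfl
  · rw [hshift a, show A ∩ Ioc a (a + 2 * Real.pi) = Ioo a (a + α) by
      ext θ
      simp only [hA, mem_inter_iff, mem_iUnion, mem_ofPred_eq, mem_Ioo, mem_Ioc]
      constructor
      · rintro ⟨⟨n, h1, h2⟩, h3, h4⟩
        have n1 : (n : ℝ) < 1 := by nlinarith
        have n2 : (-1 : ℝ) < n := by nlinarith
        have n3 : n < 1 := by exact_mod_cast n1
        have n4 : -1 < n := by exact_mod_cast n2
        obtain rfl : n = 0 := by omega
        simp at h2
        exact ⟨h3, by linarith⟩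
      · rintro ⟨h1, h2⟩
        exact ⟨⟨0, by simp [h1], by simp; linarith⟩, h1, by linarith⟩]
    rw [Real.volume_real_Ioo_of_le (by linarith)]; ring
  · rw [hshift (a - 2 * Real.pi), show A ∩ Ioc (a - 2 * Real.pi) (a - 2 * Real.pi + 2 * Real.pi) =
      Ioo (a - α) a by
      ext θ
      simp only [hA, mem_inter_iff, mem_iUnion, mem_ofPred_eq, mem_Ioo, mem_Ioc]
      constructor
      · rintro ⟨⟨n, h1, h2⟩, h3, h4⟩
        have n1 : (n : ℝ) < 1 := by nlinarith
        have n2 : (-1 : ℝ) < n := by nlinarith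
        have n3 : n < 1 := by exact_mod_cast n1
        have n4 : -1 < n := by exact_mod_cast n2
        obtain rfl : n = 0 := by omega
        simp at h1 h2
        exact ⟨by linarith, by linarith⟩
      · rintro ⟨h1, h2⟩
        exact ⟨⟨0, by simp [h2], by simp; linarith⟩, by linarith, by linarith⟩]
    rw [Real.volume_real_Ioo_of_le (by linarith)]; ring

/-- A pentagon has an orientation `σ` with respect to which the edges turn by its angles. -/
theorem exists_orientation_angle (P : Pentagon) : ∃ σ : ℝ, (σ = 1 ∨ σ = -1) ∧
    (∀ k, P.SideIn k σ) ∧ ∀ k, P.angle k ∈ Ioo (0 : ℝ) (2 * Real.pi) ∧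
      P.HasSector k σ (P.angle k) ∧
      (P.vertices (k - 1) - P.vertices k) * dist (P.vertices k) (P.vertices (k + 1)) =
        (P.vertices (k + 1) - P.vertices k) * dist (P.vertices (k - 1)) (P.vertices k) *
          Complex.exp ((σ * P.angle k : ℝ) * Complex.I) := by
  obtain ⟨σ, hσ, hs⟩ := P.exists_orientation
  refine ⟨σ, hσ, hs, fun k => ?_⟩
  obtain ⟨-, α, hα, heq, hsec⟩ := P.exists_sector k hσ (hs k)
  rw [angle_eq hσ hsec hα]
  exact ⟨hα, hsec, heq⟩

end Pentagon

theorem exists_const_of_eventually_const {f : ℝ → ℝ}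
    (hf : ∀ y, ∃ c, ∀ᶠ t in 𝓝[≠] y, f t = c) : ∃ c, ∀ y, ∀ᶠ t in 𝓝[≠] y, f t = c := by
  choose c hc using hf
  have hloc : IsLocallyConstant c := by
    rw [IsLocallyConstant.iff_eventually_eq]
    intro y
    have h1 := eventually_nhdsWithin_iff.1 (hc y)
    filter_upwards [eventually_eventually_nhds.2 h1] with t ht
    have h2 : ∀ᶠ s in 𝓝[≠] t, s ≠ y := by
      by_cases hty : t = y
      · rw [hty]; exact self_mem_nhdsWithin
      · exact eventually_nhdsWithin_of_eventually_nhds (isOpen_ne.mem_nhds hty)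
    obtain ⟨s, hs1, hs2, hs3⟩ := ((hc t).and ((eventually_nhdsWithin_of_eventually_nhds ht).and
      h2)).exists
    rw [← hs1, hs2 hs3]
  exact ⟨c 0, fun y => by
    rw [← hloc.apply_eq_of_preconnectedSpace y 0]; exact hc y⟩

namespace Pentagon

/-- The height at which the `k`-th edge (or the line through it) crosses the vertical line at
`x`. -/
noncomputable def crossHeight (P : Pentagon) (k : Fin 5) (x : ℝ) : ℝ :=
  (P.vertices k).im + (x - (P.vertices k).re) / ((P.vertices (k + 1)).re - (P.vertices k).re) *
    ((P.vertices (k + 1)).im - (P.vertices k).im)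

open Classical in
/-- The direction (rightwards or leftwards) in which the `k`-th edge crosses the vertical line at
`x`. -/
noncomputable def crossSign (P : Pentagon) (k : Fin 5) (x : ℝ) : ℝ :=
  if (P.vertices k).re < x ∧ x < (P.vertices (k + 1)).re then 1
  else if (P.vertices (k + 1)).re < x ∧ x < (P.vertices k).re then -1 else 0

theorem crossSign_cases (P : Pentagon) (k : Fin 5) (x : ℝ) : P.crossSign k x = 0 ∨
    (P.crossSign k x = 1 ∧ 0 < (P.vertices (k + 1)).re - (P.vertices k).re ∨
      P.crossSign k x = -1 ∧ (P.vertices (k + 1)).re - (P.vertices k).re < 0) ∧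
    (x - (P.vertices k).re) / ((P.vertices (k + 1)).re - (P.vertices k).re) ∈ Ioo (0 : ℝ) 1 := by
  unfold crossSign
  split_ifs with h1 h2
  · have : 0 < (P.vertices (k + 1)).re - (P.vertices k).re := by linarith
    exact Or.inr ⟨Or.inl ⟨rfl, this⟩, div_pos (by linarith) this, (div_lt_one this).2 (by linarith)⟩
  · have : (P.vertices (k + 1)).re - (P.vertices k).re < 0 := by linarith
    exact Or.inr ⟨Or.inr ⟨rfl, this⟩, div_pos_of_neg_of_neg (by linarith) this,
      (div_lt_one_of_neg this).2 (by linarith)⟩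
  · exact Or.inl rfl

theorem mk_crossHeight_eq (P : Pentagon) {k : Fin 5} {x : ℝ} (h : P.crossSign k x ≠ 0) :
    (⟨x, P.crossHeight k x⟩ : ℂ) = P.vertices k +
      ((x - (P.vertices k).re) / ((P.vertices (k + 1)).re - (P.vertices k).re) : ℝ) *
      (P.vertices (k + 1) - P.vertices k) := by
  have hne : (P.vertices (k + 1)).re - (P.vertices k).re ≠ 0 := by
    rcases P.crossSign_cases k x with h0 | ⟨⟨-, h0⟩ | ⟨-, h0⟩, -⟩
    · exact absurd h0 h
    · exact h0.ne'
    · exact h0.ne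
  apply Complex.ext
  · rw [Complex.add_re, Complex.re_ofReal_mul, Complex.sub_re, div_mul_cancel₀ _ hne]; ring
  · rw [Complex.add_im, Complex.im_ofReal_mul, Complex.sub_im]; rfl

theorem crossHeight_mem_edge (P : Pentagon) {k : Fin 5} {x : ℝ} (h : P.crossSign k x ≠ 0) :
    (⟨x, P.crossHeight k x⟩ : ℂ) ∈ P.edge k := by
  obtain ⟨-, h1, h2⟩ := (P.crossSign_cases k x).resolve_left h
  exact mem_edge.2 ⟨_, h1.le, h2.le, P.mk_crossHeight_eq h⟩

/-- The vertical line at `x` changes sides at a crossing with the `k`-th edge. -/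
theorem eventually_cross {P : Pentagon} {k : Fin 5} {σ x : ℝ} (hs : P.SideIn k σ)
    (h : P.crossSign k x ≠ 0) : ∀ᶠ y in 𝓝 (P.crossHeight k x),
      (0 < σ * P.crossSign k x * (y - P.crossHeight k x) → (⟨x, y⟩ : ℂ) ∈ P.region) ∧
      (σ * P.crossSign k x * (y - P.crossHeight k x) < 0 → (⟨x, y⟩ : ℂ) ∉ P.region) := by
  obtain ⟨δ, hδ, hs⟩ := hs
  obtain ⟨hsgn, hlt⟩ := (P.crossSign_cases k x).resolve_left h
  have heq := P.mk_crossHeight_eq h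
  have he : P.vertices (k + 1) - P.vertices k ≠ 0 := sub_ne_zero.2 (P.vertices_succ_ne k)
  set s := (x - (P.vertices k).re) / ((P.vertices (k + 1)).re - (P.vertices k).re)
  set e := P.vertices (k + 1) - P.vertices k with hedef
  set Y := P.crossHeight k x
  have here : (P.vertices (k + 1)).re - (P.vertices k).re = e.re := by simp [hedef]
  rw [here] at hsgn
  have hn : 0 < Complex.normSq e := Complex.normSq_pos.2 he
  set ζ : ℝ → ℂ := fun y => s + ((y - Y : ℝ) : ℂ) * (Complex.I / e) with hζ
  have hz : ∀ y, (⟨x, y⟩ : ℂ) = P.vertices k + ζ y * e := by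
    intro y
    have : (⟨x, y⟩ : ℂ) = ⟨x, Y⟩ + ((y - Y : ℝ) : ℂ) * Complex.I := by
      apply Complex.ext <;> simp
    rw [this, heq, hζ]
    field_simp
    ring
  have hIe : (Complex.I / e).im = e.re / Complex.normSq e := by
    simp [Complex.div_im]
  have hzim : ∀ y, (ζ y).im = (y - Y) * (e.re / Complex.normSq e) := by
    intro y
    rw [hζ]
    simp only [Complex.add_im, Complex.ofReal_im, Complex.im_ofReal_mul, hIe, zero_add]
  have hc : Continuous ζ := by fun_prop
  have h0 : ζ Y = s := by simp [hζ]
  have c1 : Continuous fun y => |(ζ y).im| := continuous_abs.comp (Complex.continuous_im.comp hc)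
  have c2 : Continuous fun y => δ * (ζ y).re :=
    continuous_const.mul (Complex.continuous_re.comp hc)
  have c3 : Continuous fun y => δ * (1 - (ζ y).re) :=
    continuous_const.mul (continuous_const.sub (Complex.continuous_re.comp hc))
  have e1 : ∀ᶠ y in 𝓝 Y, |(ζ y).im| < δ * (ζ y).re :=
    c1.continuousAt.eventually_lt c2.continuousAt (by
      rw [h0, Complex.ofReal_im, abs_zero, Complex.ofReal_re]; exact mul_pos hδ hlt.1)
  have e2 : ∀ᶠ y in 𝓝 Y, |(ζ y).im| < δ * (1 - (ζ y).re) :=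
    c1.continuousAt.eventually_lt c3.continuousAt (by
      rw [h0, Complex.ofReal_im, abs_zero, Complex.ofReal_re]
      exact mul_pos hδ (by linarith [hlt.2]))
  have hsig : ∃ κ > 0, e.re = P.crossSign k x * κ := by
    rcases hsgn with ⟨h1, h2⟩ | ⟨h1, h2⟩
    · exact ⟨e.re, h2, by rw [h1, one_mul]⟩
    · exact ⟨-e.re, by linarith, by rw [h1]; ring⟩
  obtain ⟨κ, hκ, hκe⟩ := hsig
  have hfac : ∀ y, σ * (ζ y).im =
      (σ * P.crossSign k x * (y - Y)) * (κ / Complex.normSq e) := by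
    intro y
    rw [hzim, hκe]; ring
  have hpos : 0 < κ / Complex.normSq e := div_pos hκ hn
  filter_upwards [e1, e2] with y h1 h2
  obtain ⟨i1, i2⟩ := hs (ζ y) h1 h2
  rw [← hz y, hfac] at i1 i2
  exact ⟨fun h => interior_subset (i1 (mul_pos h hpos)),
    fun h => i2 (mul_neg_of_neg_of_pos h hpos)⟩

open Classical in
/-- Away from the boundary, a vertical line which misses all vertices is inside the pentagon where
the signed number of crossings below is not zero. -/
theorem indicator_eq_sum_cross {P : Pentagon} {σ x : ℝ} (hσ : σ = 1 ∨ σ = -1)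
    (hs : ∀ k, P.SideIn k σ) (hx : ∀ k, (P.vertices k).re ≠ x) {M : ℝ}
    (hM : ∀ z ∈ P.region, |z.im| ≤ M) {y : ℝ}
    (hy : ∀ k, P.crossSign k x ≠ 0 → P.crossHeight k x ≠ y) :
    (if (⟨x, y⟩ : ℂ) ∈ P.region then (1 : ℝ) else 0) =
      σ * ∑ k, P.crossSign k x * (if P.crossHeight k x < y then 1 else 0) := by
  set f : ℝ → ℝ := fun y => (if (⟨x, y⟩ : ℂ) ∈ P.region then (1 : ℝ) else 0) -
      σ * ∑ k, P.crossSign k x * (if P.crossHeight k x < y then 1 else 0) with hf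
  have hmk : Continuous fun y : ℝ => (⟨x, y⟩ : ℂ) := by
    have : (fun y : ℝ => (⟨x, y⟩ : ℂ)) = fun y : ℝ => (x : ℂ) + y * Complex.I := by
      funext y; apply Complex.ext <;> simp
    rw [this]; fun_prop
  have hstep : ∀ (k : Fin 5) (y : ℝ), (P.crossSign k x ≠ 0 → P.crossHeight k x ≠ y) →
      ∀ᶠ t in 𝓝 y, P.crossSign k x * (if P.crossHeight k x < t then (1 : ℝ) else 0) =
        P.crossSign k x * (if P.crossHeight k x < y then 1 else 0) := by
    intro k y hky
    by_cases h0 : P.crossSign k x = 0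
    · simp [h0]
    · rcases lt_or_gt_of_ne (hky h0) with h | h
      · filter_upwards [lt_mem_nhds h] with t ht
        rw [if_pos ht, if_pos h]
      · filter_upwards [gt_mem_nhds h] with t ht
        rw [if_neg (not_lt.2 (le_of_lt ht)), if_neg (not_lt.2 (le_of_lt h))]
  have hedge : ∀ (k : Fin 5) (y : ℝ), (⟨x, y⟩ : ℂ) ∈ P.edge k →
      P.crossSign k x ≠ 0 ∧ P.crossHeight k x = y := by
    intro k y hk
    obtain ⟨t, ht0, ht1, ht⟩ := mem_edge.1 hk
    have hre : x = (P.vertices k).re + t * ((P.vertices (k + 1)).re - (P.vertices k).re) := by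
      have := congrArg Complex.re ht
      rwa [Complex.add_re, Complex.re_ofReal_mul, Complex.sub_re] at this
    have him : y = (P.vertices k).im + t * ((P.vertices (k + 1)).im - (P.vertices k).im) := by
      have := congrArg Complex.im ht
      rwa [Complex.add_im, Complex.im_ofReal_mul, Complex.sub_im] at this
    have ht0' : 0 < t := ht0.lt_of_ne (fun h => hx k (by rw [hre, ← h]; ring))
    have ht1' : t < 1 := ht1.lt_of_ne (fun h => hx (k + 1) (by rw [hre, h]; ring))
    have hne : (P.vertices (k + 1)).re - (P.vertices k).re ≠ 0 := fun h =>
      hx k (by rw [hre, h]; ring)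
    constructor
    · unfold crossSign
      rcases lt_or_gt_of_ne hne with h | h
      · rw [if_neg, if_pos]
        · norm_num
        · constructor <;> nlinarith
        · rintro ⟨h1, h2⟩; linarith
      · rw [if_pos]
        · norm_num
        · constructor <;> nlinarith
    · unfold crossHeight
      rw [show x - (P.vertices k).re = t * ((P.vertices (k + 1)).re - (P.vertices k).re) by
        rw [hre]; ring, mul_div_cancel_right₀ _ hne, him]
  have hreg : ∀ y : ℝ, (∀ k, P.crossSign k x ≠ 0 → P.crossHeight k x ≠ y) →
      ∀ᶠ t in 𝓝 y, f t = f y := by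
    intro y hy
    have h1 : ∀ᶠ t in 𝓝 y, (if (⟨x, t⟩ : ℂ) ∈ P.region then (1 : ℝ) else 0) =
        if (⟨x, y⟩ : ℂ) ∈ P.region then (1 : ℝ) else 0 := by
      have hnf : (⟨x, y⟩ : ℂ) ∉ frontier P.region := by
        rw [frontier_eq, mem_iUnion]
        rintro ⟨k, hk⟩
        obtain ⟨a, b⟩ := hedge k y hk
        exact hy k a b
      by_cases hin : (⟨x, y⟩ : ℂ) ∈ P.region
      · have hint : (⟨x, y⟩ : ℂ) ∈ interior P.region := by
          by_contra hni
          exact hnf (P.isClosed_region.frontier_eq ▸ ⟨hin, hni⟩)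
        filter_upwards [hmk.continuousAt.preimage_mem_nhds (isOpen_interior.mem_nhds hint)]
          with t ht
        rw [if_pos hin, if_pos (interior_subset ht)]
      · filter_upwards [hmk.continuousAt.preimage_mem_nhds
          (P.isClosed_region.isOpen_compl.mem_nhds hin)] with t ht
        rw [if_neg hin, if_neg ht]
    filter_upwards [h1, Filter.eventually_all.2 fun k => hstep k y (hy k)] with t ht1 ht2
    simp only [hf]
    rw [ht1, Finset.sum_congr rfl fun k _ => ht2 k]
  have huniq : ∀ j k : Fin 5, P.crossSign j x ≠ 0 → P.crossSign k x ≠ 0 →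
      P.crossHeight j x = P.crossHeight k x → j = k := by
    have hadj : ∀ j, P.crossSign j x ≠ 0 → P.crossSign (j + 1) x ≠ 0 →
        P.crossHeight j x ≠ P.crossHeight (j + 1) x := by
      intro j hj hk heq
      have hmj := P.crossHeight_mem_edge hj
      have hmk := P.crossHeight_mem_edge hk
      rw [← heq] at hmk
      have : (⟨x, P.crossHeight j x⟩ : ℂ) ∈ P.edge j ∩ P.edge (j + 1) := ⟨hmj, hmk⟩
      rw [edge_inter, mem_singleton_iff] at this
      exact hx (j + 1) (by rw [← this])
    intro j k hj hk heq
    have hmj := P.crossHeight_mem_edge hj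
    have hmk := P.crossHeight_mem_edge hk
    rw [heq] at hmj
    rcases Fin.five_cases j k with h | h | h | h | h
    · exact h
    · exact absurd heq.symm (h ▸ hadj k hk (h ▸ hj))
    · exact absurd hmj (h ▸ Set.disjoint_left.1 (P.disjoint_edge k) hmk)
    · exact absurd hmj (h ▸ Set.disjoint_left.1 (P.disjoint_edge' k) hmk)
    · have : k = j + 1 := by rw [h, sub_add_cancel]
      exact absurd heq (this ▸ hadj j hj (this ▸ hk))
  obtain ⟨c, hc⟩ := exists_const_of_eventually_const (f := f) (by
    intro y₀
    by_cases hy₀ : ∀ k, P.crossSign k x ≠ 0 → P.crossHeight k x ≠ y₀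
    · exact ⟨f y₀, eventually_nhdsWithin_of_eventually_nhds (hreg y₀ hy₀)⟩
    push Not at hy₀
    obtain ⟨k, hk0, hk⟩ := hy₀
    have hrest : ∀ᶠ t in 𝓝 y₀, ∀ j, j ≠ k →
        P.crossSign j x * (if P.crossHeight j x < t then (1 : ℝ) else 0) =
        P.crossSign j x * (if P.crossHeight j x < y₀ then 1 else 0) := by
      refine Filter.eventually_all.2 fun j => ?_
      by_cases hjk : j = k
      · exact Eventually.of_forall fun t h => absurd hjk h
      · filter_upwards [hstep j y₀ fun h0 h1 => hjk (huniq j k h0 hk0 (h1.trans hk.symm))]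
          with t ht _ using ht
    have hcross := eventually_cross (hs k) hk0
    rw [hk] at hcross
    refine ⟨(if 0 < σ * P.crossSign k x then 0 else 1) - σ * ∑ j ∈ Finset.univ.erase k,
      P.crossSign j x * (if P.crossHeight j x < y₀ then 1 else 0), ?_⟩
    filter_upwards [eventually_nhdsWithin_of_eventually_nhds hrest,
      eventually_nhdsWithin_of_eventually_nhds hcross, self_mem_nhdsWithin] with t h1 h2 h3
    simp only [hf]
    rw [← Finset.add_sum_erase _ _ (Finset.mem_univ k),
      Finset.sum_congr rfl fun j hj => h1 j (Finset.ne_of_mem_erase hj), mul_add, hk, ← sub_sub]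
    congr 1
    have hσc : σ * P.crossSign k x = 1 ∨ σ * P.crossSign k x = -1 := by
      rcases (P.crossSign_cases k x).resolve_left hk0 with ⟨⟨h, -⟩ | ⟨h, -⟩, -⟩ <;>
        rcases hσ with rfl | rfl <;> rw [h] <;> norm_num
    rw [← mul_assoc]
    obtain ⟨h21, h22⟩ := h2
    rcases lt_or_gt_of_ne (show t ≠ y₀ from h3) with h | h
    · rw [if_neg (not_lt.2 h.le)]
      rcases hσc with h' | h' <;> rw [h'] at h21 h22 ⊢
      · rw [if_neg (h22 (by linarith))]; norm_num
      · rw [if_pos (h21 (by linarith))]; norm_num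
    · rw [if_pos h]
      rcases hσc with h' | h' <;> rw [h'] at h21 h22 ⊢
      · rw [if_pos (h21 (by linarith))]; norm_num
      · rw [if_neg (h22 (by linarith))]; norm_num)
  have hval : ∀ y : ℝ, (∀ k, P.crossSign k x ≠ 0 → P.crossHeight k x ≠ y) → f y = c := by
    intro y hy
    obtain ⟨t, h1, h2⟩ := ((hc y).and
      (eventually_nhdsWithin_of_eventually_nhds (hreg y hy))).exists
    rw [← h2, h1]
  have hlow : ∀ k, P.crossSign k x ≠ 0 → -M ≤ P.crossHeight k x := fun k hk =>
    (abs_le.1 (hM _ (P.edge_subset_region k (P.crossHeight_mem_edge hk)))).1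
  have hc0 : f (-M - 1) = 0 := by
    simp only [hf]
    rw [if_neg, Finset.sum_eq_zero, mul_zero, sub_zero]
    · intro k _
      by_cases h0 : P.crossSign k x = 0
      · rw [h0, zero_mul]
      · rw [if_neg, mul_zero]
        have := hlow k h0
        linarith
    · intro h
      have := (abs_le.1 (hM _ h)).1
      simp only at this
      linarith
  have h0 : c = 0 := by
    rw [← hval (-M - 1) fun k hk => by have := hlow k hk; linarith, hc0]
  have := hval y hy
  rw [h0] at this
  exact sub_eq_zero.1 this

end Pentagon

namespace Pentagon

theorem sum_crossSign {P : Pentagon} {σ x : ℝ} (hσ : σ = 1 ∨ σ = -1)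
    (hs : ∀ k, P.SideIn k σ) (hx : ∀ k, (P.vertices k).re ≠ x) :
    ∑ k, P.crossSign k x = 0 := by
  classical
  obtain ⟨M, hM⟩ := P.isCompact_region.isBounded.exists_norm_le
  have hM' : ∀ z ∈ P.region, |z.im| ≤ M := fun z hz => (Complex.abs_im_le_norm z).trans (hM z hz)
  have hup : ∀ k, P.crossSign k x ≠ 0 → P.crossHeight k x ≤ M := fun k hk =>
    (abs_le.1 (hM' _ (P.edge_subset_region k (P.crossHeight_mem_edge hk)))).2
  have h := indicator_eq_sum_cross hσ hs hx hM' (y := M + 1)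
    (fun k hk => by have := hup k hk; linarith)
  rw [if_neg, Finset.sum_congr rfl (g := fun k => P.crossSign k x)] at h
  · rcases mul_eq_zero.1 h.symm with h | h
    · rcases hσ with rfl | rfl <;> norm_num at h
    · exact h
  · intro k _
    by_cases h0 : P.crossSign k x = 0
    · rw [h0, zero_mul]
    · rw [if_pos, mul_one]
      have := hup k h0
      linarith
  · intro h
    have := (abs_le.1 (hM' _ h)).2
    simp only at this
    linarith

theorem continuous_mk_im (x : ℝ) : Continuous fun y : ℝ => (⟨x, y⟩ : ℂ) := by
  have : (fun y : ℝ => (⟨x, y⟩ : ℂ)) = fun y : ℝ => (x : ℂ) + y * Complex.I := by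
    funext y; apply Complex.ext <;> simp
  rw [this]; fun_prop

/-- The length of a vertical section of a pentagon. -/
theorem volume_section {P : Pentagon} {σ x : ℝ} (hσ : σ = 1 ∨ σ = -1)
    (hs : ∀ k, P.SideIn k σ) (hx : ∀ k, (P.vertices k).re ≠ x) :
    volume.real {y : ℝ | (⟨x, y⟩ : ℂ) ∈ P.region} =
      -σ * ∑ k, P.crossSign k x * P.crossHeight k x := by
  classical
  obtain ⟨M, hM⟩ := P.isCompact_region.isBounded.exists_norm_le
  have hM' : ∀ z ∈ P.region, |z.im| ≤ M := fun z hz => (Complex.abs_im_le_norm z).trans (hM z hz)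
  have hheight : ∀ k, P.crossSign k x ≠ 0 → |P.crossHeight k x| ≤ M := fun k hk =>
    hM' _ (P.edge_subset_region k (P.crossHeight_mem_edge hk))
  set S : Set ℝ := {y : ℝ | (⟨x, y⟩ : ℂ) ∈ P.region} with hS
  have hSm : MeasurableSet S := (P.isClosed_region.preimage (continuous_mk_im x)).measurableSet
  have hSM : S ⊆ Ioc (-M - 1) M := by
    intro y hy
    have := abs_le.1 (hM' _ hy)
    simp only at this
    exact ⟨by linarith [this.1], this.2⟩
  have hI : volume.real S = ∫ y in Ioc (-M - 1) M, S.indicator 1 y := by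
    rw [integral_indicator_one hSm, measureReal_restrict_apply hSm, inter_eq_left.2 hSM]
  have hae : ∀ᵐ y : ℝ, S.indicator 1 y =
      σ * ∑ k, P.crossSign k x * (Ioi (P.crossHeight k x)).indicator (1 : ℝ → ℝ) y := by
    filter_upwards [(Set.toFinite (range fun k => P.crossHeight k x)).countable.ae_notMem volume]
      with y hy
    have := indicator_eq_sum_cross hσ hs hx hM' (y := y) (fun k _ h => hy ⟨k, h⟩)
    simp only [indicator_apply, mem_Ioi, Pi.one_apply, hS, mem_ofPred_eq]
    exact this
  have hint : ∀ k, P.crossSign k x * ∫ y in Ioc (-M - 1) M,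
      (Ioi (P.crossHeight k x)).indicator (1 : ℝ → ℝ) y =
      P.crossSign k x * (M - P.crossHeight k x) := by
    intro k
    by_cases h0 : P.crossSign k x = 0
    · rw [h0, zero_mul, zero_mul]
    congr 1
    have := abs_le.1 (hheight k h0)
    rw [integral_indicator_one measurableSet_Ioi, measureReal_restrict_apply measurableSet_Ioi,
      show Ioi (P.crossHeight k x) ∩ Ioc (-M - 1) M = Ioc (P.crossHeight k x) M by
        ext y
        simp only [mem_inter_iff, mem_Ioi, mem_Ioc]
        exact ⟨fun h => ⟨h.1, h.2.2⟩, fun h => ⟨h.1, by linarith [h.1, this.1], h.2⟩⟩,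
      Real.volume_real_Ioc_of_le this.2]
  rw [hI, integral_congr_ae (ae_restrict_of_ae hae), integral_const_mul, integral_finsetSum]
  · simp only [integral_const_mul, hint, mul_sub, Finset.sum_sub_distrib]
    rw [← Finset.sum_mul, sum_crossSign hσ hs hx]
    ring
  · intro k _
    refine Integrable.const_mul ?_ _
    exact (integrable_const (1 : ℝ)).indicator measurableSet_Ioi

theorem integrable_crossSign_mul (P : Pentagon) (k : Fin 5) :
    Integrable (fun x => P.crossSign k x * P.crossHeight k x) ∧
    ∫ x, P.crossSign k x * P.crossHeight k x =
      ((P.vertices (k + 1)).re - (P.vertices k).re) *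
        ((P.vertices k).im + (P.vertices (k + 1)).im) / 2 := by
  have hcont : Continuous (P.crossHeight k) := by
    unfold crossHeight; fun_prop
  have hcalc : ∀ a b p q : ℝ, a ≠ b → ∫ x in a..b, (p + (x - a) / (b - a) * (q - p)) =
      (b - a) * (p + q) / 2 := by
    intro a b p q hab
    have hba : b - a ≠ 0 := sub_ne_zero.2 hab.symm
    have hderiv : ∀ x, HasDerivAt (fun x => p * x + (x - a) ^ 2 / (2 * (b - a)) * (q - p))
        (p + (x - a) / (b - a) * (q - p)) x := by
      intro x
      have h1 : HasDerivAt (fun x => p * x) p x := by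
        simpa using (hasDerivAt_id x).const_mul p
      have h2 : HasDerivAt (fun x => (x - a) ^ 2 / (2 * (b - a)) * (q - p))
          ((2 * (x - a)) / (2 * (b - a)) * (q - p)) x := by
        have := (((hasDerivAt_id x).sub_const a).pow 2).div_const (2 * (b - a))
        simpa using this.mul_const (q - p)
      rw [mul_div_mul_left _ _ two_ne_zero] at h2
      exact h1.add h2
    rw [intervalIntegral.integral_eq_sub_of_hasDerivAt (fun x _ => hderiv x)
      (by apply Continuous.intervalIntegrable; fun_prop)]
    field_simp
    ring
  rcases lt_trichotomy (P.vertices k).re (P.vertices (k + 1)).re with h | h | h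
  · have heq : (fun x => P.crossSign k x * P.crossHeight k x) =
        (Ioo (P.vertices k).re (P.vertices (k + 1)).re).indicator (P.crossHeight k) := by
      funext x
      unfold crossSign
      by_cases hx : x ∈ Ioo (P.vertices k).re (P.vertices (k + 1)).re
      · rw [indicator_of_mem hx, if_pos (mem_Ioo.1 hx), one_mul]
      · rw [indicator_of_notMem hx, if_neg (mem_Ioo.not.1 hx), if_neg, zero_mul]
        rintro ⟨h1, h2⟩; linarith
    rw [heq]
    constructor
    · rw [integrable_indicator_iff measurableSet_Ioo]
      exact (hcont.integrableOn_Icc).mono_set Ioo_subset_Icc_self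
    · rw [integral_indicator measurableSet_Ioo, ← integral_Ioc_eq_integral_Ioo,
        ← intervalIntegral.integral_of_le h.le]
      exact hcalc _ _ _ _ h.ne
  · have heq : (fun x => P.crossSign k x * P.crossHeight k x) = 0 := by
      funext x
      unfold crossSign
      rw [if_neg, if_neg, zero_mul]
      · rfl
      · rintro ⟨h1, h2⟩; linarith
      · rintro ⟨h1, h2⟩; linarith
    rw [heq]
    exact ⟨integrable_zero _ _ _, by simp [h]⟩
  · have heq : (fun x => P.crossSign k x * P.crossHeight k x) =
        (Ioo (P.vertices (k + 1)).re (P.vertices k).re).indicator (-P.crossHeight k) := by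
      funext x
      unfold crossSign
      by_cases hx : x ∈ Ioo (P.vertices (k + 1)).re (P.vertices k).re
      · rw [indicator_of_mem hx, if_neg, if_pos (mem_Ioo.1 hx), Pi.neg_apply]
        · ring
        · rintro ⟨h1, h2⟩; linarith
      · rw [indicator_of_notMem hx, if_neg, if_neg (mem_Ioo.not.1 hx), zero_mul]
        rintro ⟨h1, h2⟩; linarith
    rw [heq]
    constructor
    · rw [integrable_indicator_iff measurableSet_Ioo]
      exact (hcont.neg.integrableOn_Icc).mono_set Ioo_subset_Icc_self
    · rw [integral_indicator measurableSet_Ioo, ← integral_Ioc_eq_integral_Ioo]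
      simp only [Pi.neg_apply]
      rw [integral_neg, ← intervalIntegral.integral_of_le h.le, ← intervalIntegral.integral_symm]
      exact hcalc _ _ _ _ h.ne'

/-- The shoelace formula for the area of a pentagon. -/
theorem area_eq {P : Pentagon} {σ : ℝ} (hσ : σ = 1 ∨ σ = -1) (hs : ∀ k, P.SideIn k σ) :
    P.area = σ * shoelace P.vertices := by
  have hmp := Complex.volume_preserving_equiv_real_prod.symm
  set R : Set (ℝ × ℝ) := {p | (⟨p.1, p.2⟩ : ℂ) ∈ P.region} with hR
  have hRe : R = Complex.measurableEquivRealProd.symm ⁻¹' P.region := rfl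
  have hRm : MeasurableSet R := by
    rw [hRe]
    exact Complex.measurableEquivRealProd.symm.measurable P.isClosed_region.measurableSet
  have hvol : volume R = volume P.region := by
    rw [hRe]
    exact hmp.measure_preimage P.isClosed_region.measurableSet.nullMeasurableSet
  have hfin : volume R < ⊤ := by rw [hvol]; exact P.isCompact_region.measure_lt_top
  have hint : Integrable (R.indicator (1 : ℝ × ℝ → ℝ)) (volume.prod volume) := by
    rw [← Measure.volume_eq_prod]
    exact (integrable_indicator_iff hRm).2 (integrableOn_const hfin.ne)
  have h1 : P.area = ∫ x, volume.real {y : ℝ | (⟨x, y⟩ : ℂ) ∈ P.region} := by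
    have h2 : P.area = ∫ p, R.indicator (1 : ℝ × ℝ → ℝ) p := by
      rw [integral_indicator_one hRm, area, measureReal_def, measureReal_def, hvol]
    rw [h2, Measure.volume_eq_prod, integral_prod _ hint]
    congr 1
    funext x
    have hm : MeasurableSet {y : ℝ | (⟨x, y⟩ : ℂ) ∈ P.region} :=
      (P.isClosed_region.preimage (continuous_mk_im x)).measurableSet
    rw [← integral_indicator_one hm]
    rfl
  have hae : ∀ᵐ x : ℝ, volume.real {y : ℝ | (⟨x, y⟩ : ℂ) ∈ P.region} =
      -σ * ∑ k, P.crossSign k x * P.crossHeight k x := by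
    filter_upwards [(Set.toFinite (range fun k => (P.vertices k).re)).countable.ae_notMem volume]
      with x hx
    exact volume_section hσ hs fun k h => hx ⟨k, h⟩
  rw [h1, integral_congr_ae hae, integral_const_mul, integral_finsetSum _
    fun k _ => (P.integrable_crossSign_mul k).1]
  simp only [(P.integrable_crossSign_mul _).2]
  unfold shoelace
  simp only [Fin.sum_univ_five, Fin.isValue, Fin.reduceAdd, zero_add]
  ring

theorem perimeter_eq (P : Pentagon) : P.perimeter = polyLength P.vertices := rfl

end Pentagon

theorem shoelace_conj {n : ℕ} [NeZero n] (z : Fin n → ℂ) :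
    shoelace (fun k => (starRingEnd ℂ) (z k)) = -shoelace z := by
  unfold shoelace
  rw [← neg_div, ← Finset.sum_neg_distrib]
  congr 1
  refine Finset.sum_congr rfl fun k _ => ?_
  simp only [Complex.conj_re, Complex.conj_im]
  ring

/-- If `a` is the point of the segment from `a` to `a + w` nearest to `c`, the direction from `a` to
`c` makes an angle of at least `π / 2` with `w`. -/
theorem re_div_nonpos_of_nearest {a w c : ℂ} (hw : w ≠ 0)
    (h : ∀ t : ℝ, 0 ≤ t → t ≤ 1 → dist a c ≤ dist (a + t * w) c) : ((c - a) / w).re ≤ 0 := by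
  set ζ := (c - a) / w with hζ
  have hc : c = a + ζ * w := by rw [hζ, div_mul_cancel₀ _ hw]; ring
  have hwn : 0 < ‖w‖ := norm_pos_iff.2 hw
  by_contra! hpos
  set t := min 1 ζ.re with ht
  have ht0 : 0 < t := lt_min one_pos hpos
  have ht1 : t ≤ ζ.re := min_le_right _ _
  have h1 := h t ht0.le (min_le_left _ _)
  rw [dist_eq_norm, dist_eq_norm, hc, show a - (a + ζ * w) = -ζ * w by ring,
    show a + t * w - (a + ζ * w) = (t - ζ) * w by ring, norm_mul, norm_mul] at h1
  have h2 := le_of_mul_le_mul_right h1 hwn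
  have h3 := pow_le_pow_left₀ (norm_nonneg _) h2 2
  rw [Complex.sq_norm, Complex.sq_norm, Complex.normSq_apply, Complex.normSq_apply] at h3
  simp only [Complex.neg_re, Complex.neg_im, Complex.sub_re, Complex.sub_im, Complex.ofReal_re,
    Complex.ofReal_im] at h3
  nlinarith

namespace Pentagon

/-- Up to reflection, the vertices of a pentagon are in counterclockwise order. -/
theorem exists_counterclockwise (P : Pentagon) : ∃ z : Fin 5 → ℂ, shoelace z = P.area ∧
    polyLength z = P.perimeter ∧
    (∀ k, Disjoint (segment ℝ (z k) (z (k + 1))) (segment ℝ (z (k + 2)) (z (k + 3)))) ∧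
    (∀ k, z (k + 1) ≠ z k) ∧ ∀ k, (z (k - 1) - z k) * dist (z k) (z (k + 1)) =
      (z (k + 1) - z k) * dist (z (k - 1)) (z k) * Complex.exp (P.angle k * Complex.I) := by
  obtain ⟨σ, hσ, hs, hk⟩ := P.exists_orientation_angle
  have ha := area_eq hσ hs
  have hd : ∀ k, Disjoint (segment ℝ (P.vertices k) (P.vertices (k + 1)))
      (segment ℝ (P.vertices (k + 2)) (P.vertices (k + 3))) := by
    intro k
    have := P.disjoint_edge k
    rwa [edge_eq_segment, edge_eq_segment, add_assoc, show (2 : Fin 5) + 1 = 3 from rfl] at this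
  rcases hσ with rfl | rfl
  · refine ⟨P.vertices, by rw [ha, one_mul], rfl, hd, P.vertices_succ_ne, fun k => ?_⟩
    have := (hk k).2.2
    rwa [one_mul] at this
  · refine ⟨fun k => (starRingEnd ℂ) (P.vertices k), by rw [ha, shoelace_conj, neg_one_mul], ?_,
      fun k => ?_, fun k h => P.vertices_succ_ne k ((starRingEnd ℂ).injective h), fun k => ?_⟩
    · rw [perimeter_eq]
      unfold polyLength
      simp only [Complex.dist_conj_conj]
    · have himg : ∀ a b : ℂ, segment ℝ ((starRingEnd ℂ) a) ((starRingEnd ℂ) b) =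
          (starRingEnd ℂ) '' segment ℝ a b := by
        intro a b
        have := (image_segment ℝ Complex.conjLIE.toLinearEquiv.toLinearMap.toAffineMap a b).symm
        exact this
      rw [himg, himg, disjoint_image_iff (starRingEnd ℂ).injective]
      exact hd k
    · have := congrArg (starRingEnd ℂ) (hk k).2.2
      simp only [map_mul, map_sub, Complex.conj_ofReal, ← Complex.exp_conj, Complex.conj_I] at this
      simp only [Complex.dist_conj_conj]
      rw [this]
      congr 2
      push_cast; ring

theorem le_perimeter {P : Pentagon} (h : P.area = 1) : 3.811 ≤ P.perimeter := by
  obtain ⟨z, hS, hL, -⟩ := P.exists_counterclockwise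
  have := isoperimetric_pentagon z
  rw [hS, h, hL] at this
  have h0 : 0 ≤ P.perimeter := hL ▸ polyLength_nonneg z
  nlinarith

theorem lt_angle_of_perimeter_le {P : Pentagon} (h : P.area = 1) (hp : P.perimeter ≤ 3.8638)
    (k : Fin 5) : 2 * Real.pi / 5 < P.angle k := by
  obtain ⟨σ, -, -, hk⟩ := P.exists_orientation_angle
  obtain ⟨z, hS, hL, -, hne, hrel⟩ := P.exists_counterclockwise
  by_contra! hle
  have := lt_polyLength_of_angle_le (hS.trans h) (hne k) (hk k).1.1 hle (hrel k)
  linarith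

theorem le_perimeter_of_isType2 {P : Pentagon} (h : P.area = 1) (h2 : P.IsType2) :
    4.5589 ≤ P.perimeter := by
  obtain ⟨σ, -, -, hk⟩ := P.exists_orientation_angle
  obtain ⟨z, hS, hL, hd, hne, hrel⟩ := P.exists_counterclockwise
  obtain ⟨i, j, hij, hset⟩ := Set.ncard_eq_two.1 h2
  have hneg : ∀ k, Real.pi < P.angle k → crossArea (z (k - 1)) (z k) (z (k + 1)) < 0 := by
    intro k hkπ
    have hsin : Real.sin (P.angle k) < 0 := by
      have h1 := (hk k).1.2
      have := Real.sin_pos_of_pos_of_lt_pi (x := P.angle k - Real.pi) (by linarith) (by linarith)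
      rw [Real.sin_sub_pi] at this
      linarith
    have hr := hrel k
    have hu : 0 < dist (z k) (z (k + 1)) := dist_pos.2 (hne k).symm
    have hw : 0 < dist (z (k - 1)) (z k) := by
      have := hne (k - 1)
      rw [sub_add_cancel] at this
      exact dist_pos.2 this.symm
    set u := z (k + 1) - z k with hudef
    have hcr : crossArea (z (k - 1)) (z k) (z (k + 1)) =
        u.re * (z (k - 1) - z k).im - u.im * (z (k - 1) - z k).re := by
      simp only [crossArea, hudef, Complex.sub_re, Complex.sub_im]; ring
    have h1 := congrArg Complex.re hr
    have h2 := congrArg Complex.im hr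
    rw [Complex.re_mul_ofReal, mul_assoc, Complex.mul_re, Complex.re_ofReal_mul,
      Complex.im_ofReal_mul, Complex.exp_ofReal_mul_I_re, Complex.exp_ofReal_mul_I_im] at h1
    rw [Complex.im_mul_ofReal, mul_assoc, Complex.mul_im, Complex.re_ofReal_mul,
      Complex.im_ofReal_mul, Complex.exp_ofReal_mul_I_re, Complex.exp_ofReal_mul_I_im] at h2
    have hsq : u.re ^ 2 + u.im ^ 2 = dist (z k) (z (k + 1)) ^ 2 := by
      rw [dist_comm, dist_eq_norm, Complex.sq_norm, Complex.normSq_apply]; ring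
    have h3 : crossArea (z (k - 1)) (z k) (z (k + 1)) * dist (z k) (z (k + 1)) =
        dist (z k) (z (k + 1)) ^ 2 * dist (z (k - 1)) (z k) * Real.sin (P.angle k) := by
      rw [hcr, ← hsq]
      linear_combination u.re * h2 - u.im * h1
    have h4 : dist (z k) (z (k + 1)) ^ 2 * dist (z (k - 1)) (z k) * Real.sin (P.angle k) < 0 :=
      mul_neg_of_pos_of_neg (by positivity) hsin
    rw [← h3] at h4
    by_contra! hnn
    exact absurd h4 (not_lt.2 (mul_nonneg hnn hu.le))
  have hi : Real.pi < P.angle i := by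
    have : i ∈ {k | Real.pi < P.angle k} := by rw [hset]; simp
    exact this
  have hj : Real.pi < P.angle j := by
    have : j ∈ {k | Real.pi < P.angle k} := by rw [hset]; simp
    exact this
  have := le_polyLength_of_two_reflex (hS.trans h) hd hij (hneg i hi) (hneg j hj)
  rw [hL] at this
  have h0 : 0 ≤ P.perimeter := hL ▸ polyLength_nonneg z
  nlinarith

/-- Tangent lengths of a circumscribed pentagon with convex angles. -/
theorem IsCircumscribed.exists_tangent {P : Pentagon} (hP : P.IsCircumscribed)
    (hconv : ∀ k, P.angle k < Real.pi) : ∃ r > 0, ∃ τ τ' : Fin 5 → ℝ,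
      (∀ k, P.edgeLength k = τ k + τ' (k + 1)) ∧ P.area = r * P.perimeter / 2 ∧
      ∀ k, τ k = τ' k * Real.cos (P.angle k) + r * Real.sin (P.angle k) ∧
        r = τ' k * Real.sin (P.angle k) - r * Real.cos (P.angle k) := by
  obtain ⟨c, r, hr, hball, htouch⟩ := hP
  obtain ⟨σ, hσ, hside, hk⟩ := P.exists_orientation_angle
  have hσ2 : σ * σ = 1 := by rcases hσ with rfl | rfl <;> norm_num
  have hσabs : |σ| = 1 := by rcases hσ with rfl | rfl <;> norm_num
  have he : ∀ k, P.vertices (k + 1) - P.vertices k ≠ 0 := fun k =>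
    sub_ne_zero.2 (P.vertices_succ_ne k)
  have hint : ∀ z, dist z c < r → z ∈ interior P.region := fun z hz =>
    interior_maximal (Metric.ball_subset_closedBall.trans hball) Metric.isOpen_ball hz
  have hfar : ∀ k, ∀ z ∈ P.edge k, r ≤ dist z c := by
    intro k z hz
    by_contra! hlt
    have : z ∈ frontier P.region := by rw [frontier_eq]; exact mem_iUnion_of_mem k hz
    exact this.2 (hint z hlt)
  -- points between a point at distance `r` and the center are interior
  have hcone : ∀ z, dist z c = r → ∀ t : ℝ, 0 < t → t ≤ 1 → z + t * (c - z) ∈ interior P.region := by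
    intro z hz t ht0 ht1
    apply hint
    rw [dist_eq_norm, show z + t * (c - z) - c = ((1 - t : ℝ) : ℂ) * (z - c) by push_cast; ring,
      norm_mul, Complex.norm_real, Real.norm_of_nonneg (by linarith), ← dist_eq_norm, hz]
    nlinarith
  have hvertex : ∀ k, dist (P.vertices k) c ≠ r := by
    intro k hkr
    obtain ⟨⟨hα0, hα1⟩, ⟨ε, hε, hsec⟩, hrel⟩ := hk k
    set α := P.angle k
    set e := P.vertices (k + 1) - P.vertices k with hedef
    set w := P.vertices (k - 1) - P.vertices k with hwdef
    have hew : 0 < ‖e‖ := norm_pos_iff.2 (he k)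
    have hw0 : w ≠ 0 := by
      have := P.vertices_succ_ne (k - 1)
      rw [sub_add_cancel] at this
      exact sub_ne_zero.2 this.symm
    have hwn : 0 < ‖w‖ := norm_pos_iff.2 hw0
    set ζ := (c - P.vertices k) / e with hζ
    have hζe : c - P.vertices k = ζ * e := by rw [hζ, div_mul_cancel₀ _ (he k)]
    have h1 : ζ.re ≤ 0 := re_div_nonpos_of_nearest (he k) fun t ht0 ht1 => by
      rw [hkr]; exact hfar k _ (mem_edge.2 ⟨t, ht0, ht1, rfl⟩)
    have h2 : ((c - P.vertices k) / w).re ≤ 0 := re_div_nonpos_of_nearest hw0 fun t ht0 ht1 => by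
      rw [hkr]
      refine hfar (k - 1) _ (mem_edge.2 ⟨1 - t, by linarith, by linarith, ?_⟩)
      rw [sub_add_cancel, hwdef]; push_cast; ring
    have hζ0 : ζ ≠ 0 := by
      intro h
      rw [h, zero_mul, sub_eq_zero] at hζe
      rw [← hζe, dist_self] at hkr
      exact hr.ne hkr
    have hζn : 0 < ‖ζ‖ := norm_pos_iff.2 hζ0
    obtain ⟨φ, ⟨hφ0, hφ1⟩, hφ⟩ := exists_angle (q := ζ) (fun t ht h => by
      rw [h, Complex.ofReal_re] at h1
      exact hζ0 (by rw [h, le_antisymm h1 ht]; simp)) hσ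
    have hφα : φ ≤ α := by
      by_contra! hlt
      obtain ⟨t, ht0, ht1, htε⟩ : ∃ t > 0, t ≤ 1 ∧ t * ‖ζ‖ < ε := by
        refine ⟨min 1 (ε / ‖ζ‖ / 2), by positivity, min_le_left _ _, ?_⟩
        rw [← lt_div_iff₀ hζn]
        have : 0 < ε / ‖ζ‖ := by positivity
        exact (min_le_right _ _).trans_lt (by linarith)
      refine (hsec (t * ‖ζ‖) (by positivity) htε φ).2 hlt hφ1 ?_
      have := interior_subset (hcone _ hkr t ht0 ht1)
      rw [hζe] at this
      convert this using 2
      rw [Complex.ofReal_mul]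
      linear_combination (-(t : ℂ) * e) * hφ
    have hcosφ : Real.cos φ ≤ 0 := by
      have h3 : ζ.re = ‖ζ‖ * Real.cos φ := by
        conv_lhs => rw [hφ]
        rw [Complex.re_ofReal_mul, Complex.exp_ofReal_mul_I_re]
        rcases hσ with rfl | rfl <;> simp
      rw [h3] at h1
      exact nonpos_of_mul_nonpos_right h1 hζn
    have hφ2 : Real.pi / 2 ≤ φ := by
      by_contra! hlt
      have := Real.cos_pos_of_mem_Ioo (x := φ) ⟨by linarith [Real.pi_pos], hlt⟩
      linarith
    have hcos : 0 < Real.cos (φ - α) :=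
      Real.cos_pos_of_mem_Ioo ⟨by linarith [hconv k], by linarith [Real.pi_pos]⟩
    have h4 : (c - P.vertices k) / w = ((‖ζ‖ * ‖e‖ / ‖w‖ : ℝ) : ℂ) *
        Complex.exp ((σ * (φ - α) : ℝ) * Complex.I) := by
      rw [div_eq_iff hw0, hζe]
      have hwe : w * ‖e‖ = e * ‖w‖ * Complex.exp ((σ * α : ℝ) * Complex.I) := by
        rw [dist_comm, dist_eq_norm, dist_eq_norm] at hrel
        exact hrel
      have hwc : (‖w‖ : ℂ) ≠ 0 := by exact_mod_cast hwn.ne'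
      have hexp : Complex.exp ((σ * φ : ℝ) * Complex.I) =
          Complex.exp ((σ * (φ - α) : ℝ) * Complex.I) * Complex.exp ((σ * α : ℝ) * Complex.I) := by
        rw [← Complex.exp_add]; congr 1; push_cast; ring
      calc ζ * e = ‖ζ‖ * (e * ‖w‖ * Complex.exp ((σ * α : ℝ) * Complex.I)) *
          Complex.exp ((σ * (φ - α) : ℝ) * Complex.I) / ‖w‖ := by
            rw [eq_div_iff hwc]
            have : ζ * e * ‖w‖ = (‖ζ‖ * Complex.exp ((σ * φ : ℝ) * Complex.I)) * e * ‖w‖ := by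
              rw [← hφ]
            rw [this, hexp]; ring
        _ = _ := by rw [← hwe]; push_cast; ring
    rw [h4, Complex.re_ofReal_mul, Complex.exp_ofReal_mul_I_re] at h2
    have h5 : Real.cos (σ * (φ - α)) = Real.cos (φ - α) := by
      rcases hσ with rfl | rfl
      · rw [one_mul]
      · rw [neg_one_mul, Real.cos_neg]
    rw [h5] at h2
    have : 0 < ‖ζ‖ * ‖e‖ / ‖w‖ * Real.cos (φ - α) := by positivity
    linarith
  have htan : ∀ k, ∃ s : ℝ, c - P.vertices k =
      (s + (σ * (r / ‖P.vertices (k + 1) - P.vertices k‖) : ℝ) * Complex.I) *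
      (P.vertices (k + 1) - P.vertices k) := by
    intro k
    obtain ⟨z, hz, hzr⟩ := htouch k
    obtain ⟨s, hs0, hs1, hzs⟩ := mem_edge.1 hz
    have hek := he k
    obtain ⟨δ, hδ, hδs⟩ := hside k
    set e := P.vertices (k + 1) - P.vertices k with hedef
    have hen : 0 < ‖e‖ := norm_pos_iff.2 hek
    have hs0' : 0 < s := hs0.lt_of_ne fun h => hvertex k (by
      rw [← hzr, hzs, ← h]; simp)
    have hs1' : s < 1 := hs1.lt_of_ne fun h => hvertex (k + 1) (by
      rw [← hzr, hzs, h, hedef]; simp)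
    have hre1 : ((c - z) / ((1 - s : ℝ) * e)).re ≤ 0 := by
      refine re_div_nonpos_of_nearest (mul_ne_zero (by exact_mod_cast (sub_pos.2 hs1').ne') hek)
        fun t ht0 ht1 => ?_
      rw [hzr]
      refine hfar k _ (mem_edge.2 ⟨s + t * (1 - s), by nlinarith, by nlinarith, ?_⟩)
      rw [hzs]; push_cast; ring
    have hre2 : ((c - z) / ((-s : ℝ) * e)).re ≤ 0 := by
      refine re_div_nonpos_of_nearest (mul_ne_zero (by exact_mod_cast (neg_lt_zero.2 hs0').ne) hek)
        fun t ht0 ht1 => ?_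
      rw [hzr]
      refine hfar k _ (mem_edge.2 ⟨s - t * s, by nlinarith, by nlinarith, ?_⟩)
      rw [hzs]; push_cast; ring
    set ξ := (c - z) / e with hξ
    have hξe : c - z = ξ * e := by rw [hξ, div_mul_cancel₀ _ hek]
    have hdiv : ∀ a : ℝ, (c - z) / (a * e) = ((a⁻¹ : ℝ) : ℂ) * ξ := by
      intro a; rw [hξ]; push_cast; rw [div_mul_eq_div_div_swap, mul_comm, div_eq_mul_inv]
    rw [hdiv, Complex.re_ofReal_mul] at hre1 hre2
    have hξre : ξ.re = 0 := by
      have a1 : 0 < (1 - s)⁻¹ := inv_pos.2 (by linarith)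
      have a2 : (-s)⁻¹ < 0 := inv_lt_zero.2 (by linarith)
      apply le_antisymm
      · exact nonpos_of_mul_nonpos_right hre1 a1
      · by_contra! hlt
        have := mul_pos_of_neg_of_neg a2 hlt
        linarith
    have hξI : ξ = (ξ.im : ℂ) * Complex.I := by apply Complex.ext <;> simp [hξre]
    have hξn : |ξ.im| = r / ‖e‖ := by
      rw [eq_div_iff hen.ne', ← hzr, dist_comm, dist_eq_norm, hξe, norm_mul]
      congr 1
      conv_rhs => rw [hξI]
      rw [norm_mul, Complex.norm_I, mul_one, Complex.norm_real, Real.norm_eq_abs]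
    have hpos : 0 < r / ‖e‖ := div_pos hr hen
    have hsgn : 0 ≤ σ * ξ.im := by
      by_contra! hneg
      set t := min 1 (δ * min s (1 - s) / (r / ‖e‖) / 2) with ht
      have hm : 0 < min s (1 - s) := lt_min hs0' (by linarith)
      have ht0 : 0 < t := by positivity
      have htl : t * |ξ.im| < δ * min s (1 - s) := by
        rw [hξn, ← lt_div_iff₀ hpos]
        have : 0 < δ * min s (1 - s) / (r / ‖e‖) := by positivity
        exact (min_le_right _ _).trans_lt (by linarith)
      have hre : ((s : ℂ) + t * ξ).re = s := by simp [hξre]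
      have him : ((s : ℂ) + t * ξ).im = t * ξ.im := by simp
      refine (hδs (s + t * ξ) ?_ ?_).2 ?_ ?_
      · rw [hre, him, abs_mul, abs_of_pos ht0]
        exact htl.trans_le (by gcongr; exact min_le_left _ _)
      · rw [hre, him, abs_mul, abs_of_pos ht0]
        exact htl.trans_le (by gcongr; exact min_le_right _ _)
      · rw [him]; nlinarith
      · have := interior_subset (hcone z hzr t ht0 (min_le_left _ _))
        rw [hξe] at this
        convert this using 1
        rw [hzs]; ring
    refine ⟨s, ?_⟩
    have hval : ξ.im = σ * (r / ‖e‖) := by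
      have h1 : |σ * ξ.im| = r / ‖e‖ := by rw [abs_mul, hσabs, one_mul, hξn]
      rw [abs_of_nonneg hsgn] at h1
      linear_combination σ * h1 - ξ.im * hσ2
    rw [← hval, ← hξI]
    linear_combination hξe + hzs
  choose s hs using htan
  have hlen : ∀ k, P.edgeLength k = ‖P.vertices (k + 1) - P.vertices k‖ := by
    intro k; rw [edgeLength, dist_comm, dist_eq_norm]
  refine ⟨r, hr, fun k => s k * P.edgeLength k, fun k => (1 - s (k - 1)) * P.edgeLength (k - 1),
    fun k => ?_, ?_, fun k => ?_⟩
  · simp only [add_sub_cancel_right]; ring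
  · rw [area_eq hσ hside, ← shoelace_sub_const _ c]
    have hterm : ∀ k, (P.vertices k - c).re * (P.vertices (k + 1) - c).im -
        (P.vertices k - c).im * (P.vertices (k + 1) - c).re = σ * r * P.edgeLength k := by
      intro k
      have hen : 0 < ‖P.vertices (k + 1) - P.vertices k‖ := norm_pos_iff.2 (he k)
      have h1 : P.vertices (k + 1) - c = (P.vertices k - c) +
        (P.vertices (k + 1) - P.vertices k) := by ring
      have h2 := hs k
      rw [hlen]
      have hsq := Complex.sq_norm (P.vertices (k + 1) - P.vertices k)
      rw [Complex.normSq_apply] at hsq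
      set e := P.vertices (k + 1) - P.vertices k
      rw [h1, Complex.add_re, Complex.add_im]
      have h3 : P.vertices k - c = -((s k + (σ * (r / ‖e‖) : ℝ) * Complex.I) * e) := by
        rw [← h2]; ring
      have hre : (P.vertices k - c).re = -(s k * e.re - σ * (r / ‖e‖) * e.im) := by
        rw [h3]; simp [-Complex.ofReal_mul, -Complex.ofReal_div]
      have him : (P.vertices k - c).im = -(s k * e.im + σ * (r / ‖e‖) * e.re) := by
        rw [h3]; simp [-Complex.ofReal_mul, -Complex.ofReal_div]
      rw [hre, him]
      have : σ * (r / ‖e‖) * ‖e‖ ^ 2 = σ * r * ‖e‖ := by field_simp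
      rw [← this, hsq]
      ring
    unfold shoelace
    rw [Finset.sum_congr rfl fun k _ => hterm k, ← Finset.mul_sum, perimeter]
    linear_combination r * (∑ k, P.edgeLength k) / 2 * hσ2
  · obtain ⟨-, -, hrel⟩ := hk k
    have h1 := hs k
    have h2 := hs (k - 1)
    rw [sub_add_cancel] at h2
    have l1 := hlen k
    have l2 := hlen (k - 1)
    rw [sub_add_cancel] at l2
    have hen : 0 < P.edgeLength k := by rw [l1]; exact norm_pos_iff.2 (he k)
    have hen' : 0 < P.edgeLength (k - 1) := by rw [hlen]; exact norm_pos_iff.2 (he _)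
    rw [← l1] at h1
    rw [← l2] at h2
    have hd1 : dist (P.vertices k) (P.vertices (k + 1)) = P.edgeLength k := rfl
    have hd2 : dist (P.vertices (k - 1)) (P.vertices k) = P.edgeLength (k - 1) := by
      rw [edgeLength, sub_add_cancel]
    rw [hd1, hd2] at hrel
    have hek := he k
    set e := P.vertices (k + 1) - P.vertices k
    set ℓ := P.edgeLength k
    set ℓ' := P.edgeLength (k - 1)
    set s' := s (k - 1)
    have hℓ : (ℓ : ℂ) ≠ 0 := by exact_mod_cast hen.ne'
    have hℓ' : (ℓ' : ℂ) ≠ 0 := by exact_mod_cast hen'.ne'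
    set E := Complex.exp ((σ * P.angle k : ℝ) * Complex.I) with hE
    have h3 : (((s k * ℓ : ℝ) : ℂ) + (σ * r : ℝ) * Complex.I) * e =
        ((((1 - s') * ℓ' : ℝ) : ℂ) - (σ * r : ℝ) * Complex.I) * E * e := by
      have e1 : (c - P.vertices k) * ℓ =
          (((s k * ℓ : ℝ) : ℂ) + (σ * r : ℝ) * Complex.I) * e := by
        rw [h1]; push_cast; field_simp
      have e2 : (c - P.vertices k) * ℓ' = ((((1 - s') * ℓ' : ℝ) : ℂ) - (σ * r : ℝ) * Complex.I) *
          (P.vertices (k - 1) - P.vertices k) := by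
        have : c - P.vertices k = (c - P.vertices (k - 1)) -
            (P.vertices k - P.vertices (k - 1)) := by ring
        rw [this, h2]; push_cast; field_simp; ring
      rw [← e1]
      apply mul_right_cancel₀ hℓ'
      rw [mul_right_comm, e2]
      linear_combination ((((1 - s') * ℓ' : ℝ) : ℂ) - (σ * r : ℝ) * Complex.I) * hrel
    have h4 := mul_right_cancel₀ hek h3
    have hEre : E.re = Real.cos (P.angle k) := by
      rw [hE, Complex.exp_ofReal_mul_I_re]; rcases hσ with rfl | rfl <;> simp
    have hEim : E.im = σ * Real.sin (P.angle k) := by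
      rw [hE, Complex.exp_ofReal_mul_I_im]; rcases hσ with rfl | rfl <;> simp
    have h5 := congrArg Complex.re h4
    have h6 := congrArg Complex.im h4
    simp only [Complex.add_re, Complex.add_im, Complex.mul_re, Complex.mul_im, Complex.sub_re,
      Complex.sub_im, Complex.ofReal_re, Complex.ofReal_im, Complex.I_re, Complex.I_im, hEre,
      hEim] at h5 h6
    constructor
    · linear_combination h5 + r * Real.sin (P.angle k) * hσ2
    · linear_combination σ * h6 + (-r + (1 - s') * ℓ' * Real.sin (P.angle k) -
        r * Real.cos (P.angle k)) * hσ2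

theorem perimeter_le_of_tangent {P : Pentagon} (hP : P.IsCircumscribed) (ha : P.area = 1)
    {i j : Fin 5} (hij : i ≠ j) (hi : P.angle i = Real.pi / 2) (hj : P.angle j = Real.pi / 2)
    (hk : ∀ k, k ≠ i → k ≠ j → P.angle k = 2 * Real.pi / 3) : P.perimeter ≤ 3.8638 := by
  have hpi := Real.pi_pos
  have h3 : √3 ^ 2 = 3 := Real.sq_sqrt (by norm_num)
  have h3' : √3 ≤ 1.73206 := Real.sqrt_le_iff.2 (by norm_num)
  have h30 : 0 < √3 := by positivity
  have hconv : ∀ k, P.angle k < Real.pi := by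
    intro k
    by_cases h1 : k = i
    · rw [h1, hi]; linarith
    by_cases h2 : k = j
    · rw [h2, hj]; linarith
    rw [hk k h1 h2]; linarith
  obtain ⟨r, hr, τ, τ', hlen, harea, htan⟩ := hP.exists_tangent hconv
  have hright : ∀ k, P.angle k = Real.pi / 2 → τ k + τ' k = 2 * r := by
    intro k h
    obtain ⟨h1, h2⟩ := htan k
    rw [h, Real.cos_pi_div_two, Real.sin_pi_div_two] at h1 h2
    linarith
  have hobt : ∀ k, P.angle k = 2 * Real.pi / 3 → τ k + τ' k = 2 * √3 / 3 * r := by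
    intro k h
    obtain ⟨h1, h2⟩ := htan k
    have hc : Real.cos (2 * Real.pi / 3) = -(1 / 2) := by
      rw [show 2 * Real.pi / 3 = Real.pi - Real.pi / 3 by ring, Real.cos_pi_sub,
        Real.cos_pi_div_three]
    have hs : Real.sin (2 * Real.pi / 3) = √3 / 2 := by
      rw [show 2 * Real.pi / 3 = Real.pi - Real.pi / 3 by ring, Real.sin_pi_sub,
        Real.sin_pi_div_three]
    rw [h, hc, hs] at h1 h2
    have : τ' k = √3 / 3 * r := by
      have : √3 * τ' k = r := by linarith
      rw [← this]
      linear_combination (-τ' k / 3) * h3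
    rw [h1, this]
    ring
  have hsum : P.perimeter = ∑ k, (τ k + τ' k) := by
    rw [perimeter, Finset.sum_congr rfl fun k _ => hlen k, Finset.sum_add_distrib,
      Finset.sum_add_distrib]
    congr 1
    exact Equiv.sum_comp (Equiv.addRight (1 : Fin 5)) τ'
  have hper : P.perimeter = 2 * (2 + √3) * r := by
    rw [hsum, ← Finset.add_sum_erase _ _ (Finset.mem_univ i),
      ← Finset.add_sum_erase _ _ (Finset.mem_erase.2 ⟨hij.symm, Finset.mem_univ j⟩),
      hright i hi, hright j hj, Finset.sum_congr rfl (g := fun _ => 2 * √3 / 3 * r)]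
    · rw [Finset.sum_const, Finset.card_erase_of_mem
        (Finset.mem_erase.2 ⟨hij.symm, Finset.mem_univ j⟩),
        Finset.card_erase_of_mem (Finset.mem_univ i), Finset.card_univ, Fintype.card_fin]
      simp only [nsmul_eq_mul]
      push_cast
      ring
    · intro k hkm
      simp only [Finset.mem_erase] at hkm
      exact hobt k (hk k hkm.2.1 hkm.1)
  have hpos : 0 ≤ P.perimeter := by rw [hper]; positivity
  rw [ha] at harea
  have : P.perimeter ^ 2 = 4 * (2 + √3) := by
    have h1 : P.perimeter ^ 2 = 2 * (2 + √3) * (r * P.perimeter) := by rw [hper]; ring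
    rw [h1, show r * P.perimeter = 2 by linarith]; ring
  nlinarith

theorem IsCairo.perimeter_le {P : Pentagon} (hP : P.IsCairo) (ha : P.area = 1) :
    P.perimeter ≤ 3.8638 := by
  obtain ⟨hc, k, h0, h1, h2, h3, h4⟩ := hP
  refine perimeter_le_of_tangent hc ha (i := k) (j := k + 2) (by clear * -; revert k; decide) h0 h2
    fun j hj1 hj2 => ?_
  have : j = k + 1 ∨ j = k + 3 ∨ j = k + 4 := by clear * - hj1 hj2; revert j k; decide
  rcases this with rfl | rfl | rfl <;> assumption

theorem IsPrismatic.perimeter_le {P : Pentagon} (hP : P.IsPrismatic) (ha : P.area = 1) :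
    P.perimeter ≤ 3.8638 := by
  obtain ⟨hc, k, h0, h1, h2, h3, h4⟩ := hP
  refine perimeter_le_of_tangent hc ha (i := k) (j := k + 1) (by clear * -; revert k; decide) h0 h1
    fun j hj1 hj2 => ?_
  have : j = k + 2 ∨ j = k + 3 ∨ j = k + 4 := by clear * - hj1 hj2; revert j k; decide
  rcases this with rfl | rfl | rfl <;> assumption

theorem IsEfficient.perimeter_le {P : Pentagon} (hP : P.IsEfficient) : P.perimeter ≤ 3.8638 := by
  obtain ⟨-, C, hC, hCa, h⟩ := hP
  exact h.trans (hC.perimeter_le hCa)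

theorem IsEfficient.lt_angle {P : Pentagon} (hP : P.IsEfficient) (k : Fin 5) :
    2 * Real.pi / 5 < P.angle k :=
  lt_angle_of_perimeter_le hP.1 hP.perimeter_le k

end Pentagon

theorem segment_eq_segment {a b c d : ℂ} (hab : a ≠ b) (h : segment ℝ a b = segment ℝ c d) :
    (a = c ∧ b = d) ∨ (a = d ∧ b = c) := by
  have hdist : dist a b = dist c d := by
    have := congrArg Metric.diam h
    rwa [← convexHull_pair, ← convexHull_pair, convexHull_diam, convexHull_diam, Metric.diam_pair,
      Metric.diam_pair] at this
  have ha : a ∈ segment ℝ c d := h ▸ left_mem_segment ℝ a b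
  have hb : b ∈ segment ℝ c d := h ▸ right_mem_segment ℝ a b
  rw [segment_eq_image'] at ha hb
  obtain ⟨s, ⟨hs0, hs1⟩, hs⟩ := ha
  obtain ⟨t, ⟨ht0, ht1⟩, ht⟩ := hb
  simp only [Complex.real_smul] at hs ht
  have h0 : 0 < dist c d := hdist ▸ dist_pos.2 hab
  have h1 : |s - t| = 1 := by
    have : dist a b = |s - t| * dist c d := by
      rw [← hs, ← ht, dist_comm c d, dist_eq_norm, dist_eq_norm,
        show c + s * (d - c) - (c + t * (d - c)) = ((s - t : ℝ) : ℂ) * (d - c) by push_cast; ring,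
        norm_mul, Complex.norm_real, Real.norm_eq_abs]
    rw [hdist] at this
    exact (mul_eq_right₀ h0.ne').1 this.symm
  rcases (abs_eq one_pos.le).1 h1 with h2 | h2
  · obtain rfl : s = 1 := by linarith
    obtain rfl : t = 0 := by linarith
    right
    constructor
    · rw [← hs]; simp
    · rw [← ht]; simp
  · obtain rfl : s = 0 := by linarith
    obtain rfl : t = 1 := by linarith
    left
    constructor
    · rw [← hs]; simp
    · rw [← ht]; simp

namespace Pentagon

theorem translate_vertices (P : Pentagon) (w : ℂ) (k : Fin 5) :
    (P.translate w).vertices k = w + P.vertices k := rfl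

theorem mem_translate_region {P : Pentagon} {w z : ℂ} :
    z ∈ (P.translate w).region ↔ z - w ∈ P.region := by
  change z ∈ (w + ·) '' P.region ↔ _
  constructor
  · rintro ⟨x, hx, rfl⟩
    simpa using hx
  · intro h
    exact ⟨z - w, h, by simp⟩

theorem mem_interior_translate {P : Pentagon} {w z : ℂ} :
    z ∈ interior (P.translate w).region ↔ z - w ∈ interior P.region := by
  have : (P.translate w).region = (Homeomorph.subRight w) ⁻¹' P.region := by
    ext z
    rw [mem_translate_region]; rfl
  rw [this, ← Homeomorph.preimage_interior]
  rfl

theorem eq_of_vertex_mem_edge {P : Pentagon} {j k : Fin 5} (h : P.vertices k ∈ P.edge j) :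
    j = k ∨ j + 1 = k := by
  by_contra! hne
  exact P.vertex_notMem_edge hne.1 hne.2 h

theorem edge_injective (P : Pentagon) : Function.Injective P.edge := by
  intro j k h
  have h1 := eq_of_vertex_mem_edge (h ▸ P.vertex_mem_edge j)
  have h2 := eq_of_vertex_mem_edge (h ▸ P.vertex_succ_mem_edge j)
  clear h
  revert j k; decide

theorem edge_eq_edge {P Q : Pentagon} {k l : Fin 5} (h : P.edge k = Q.edge l) :
    (P.vertices k = Q.vertices l ∧ P.vertices (k + 1) = Q.vertices (l + 1)) ∨
    (P.vertices k = Q.vertices (l + 1) ∧ P.vertices (k + 1) = Q.vertices l) := by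
  rw [edge_eq_segment, edge_eq_segment] at h
  exact segment_eq_segment (P.vertices_succ_ne k).symm h

/-- The midpoint of the `k`-th edge. -/
noncomputable def edgeMidpoint (P : Pentagon) (k : Fin 5) : ℂ :=
  P.vertices k + (1 / 2 : ℝ) * (P.vertices (k + 1) - P.vertices k)

theorem edgeMidpoint_mem (P : Pentagon) (k : Fin 5) : P.edgeMidpoint k ∈ P.edge k :=
  mem_edge.2 ⟨1 / 2, by norm_num, by norm_num, rfl⟩

theorem edgeMidpoint_ne_vertex (P : Pentagon) (j k : Fin 5) : P.edgeMidpoint k ≠ P.vertices j := by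
  intro h
  have he : P.vertices (k + 1) - P.vertices k ≠ 0 := sub_ne_zero.2 (P.vertices_succ_ne k)
  rcases eq_of_vertex_mem_edge (h ▸ P.edgeMidpoint_mem k) with rfl | rfl
  · unfold edgeMidpoint at h
    rw [add_eq_left] at h
    rcases mul_eq_zero.1 h with h | h
    · norm_num at h
    · exact he h
  · unfold edgeMidpoint at h
    apply he
    push_cast at h
    linear_combination (-2 : ℂ) * h

theorem eq_of_edgeMidpoint_mem {P : Pentagon} {j k : Fin 5} (h : P.edgeMidpoint k ∈ P.edge j) :
    j = k := by
  have hk := P.edgeMidpoint_mem k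
  rcases Fin.five_cases j k with h1 | rfl | rfl | rfl | rfl
  · exact h1
  · have : P.edgeMidpoint k ∈ P.edge k ∩ P.edge (k + 1) := ⟨hk, h⟩
    rw [edge_inter] at this
    exact absurd this (P.edgeMidpoint_ne_vertex _ _)
  · exact absurd h (Set.disjoint_left.1 (P.disjoint_edge k) hk)
  · exact absurd h (Set.disjoint_left.1 (P.disjoint_edge' k) hk)
  · have : P.edgeMidpoint k ∈ P.edge (k - 1) ∩ P.edge (k - 1 + 1) :=
      ⟨h, by rw [sub_add_cancel]; exact hk⟩
    rw [edge_inter] at this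
    exact absurd this (P.edgeMidpoint_ne_vertex _ _)

/-- On the normal through the midpoint of an edge, one side is inside and the other is outside. -/
theorem exists_normal (P : Pentagon) (k : Fin 5) : ∃ σ : ℝ, (σ = 1 ∨ σ = -1) ∧
    ∀ᶠ δ : ℝ in 𝓝[>] 0,
      P.edgeMidpoint k + (σ * δ : ℝ) * Complex.I * (P.vertices (k + 1) - P.vertices k) ∈
        interior P.region ∧
      P.edgeMidpoint k - (σ * δ : ℝ) * Complex.I * (P.vertices (k + 1) - P.vertices k) ∉
        P.region := by
  obtain ⟨σ, hσ, δ₀, hδ₀, hs⟩ := P.exists_sideIn k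
  have hσabs : |σ| = 1 := by rcases hσ with rfl | rfl <;> norm_num
  have hσ2 : σ * σ = 1 := by rcases hσ with rfl | rfl <;> norm_num
  refine ⟨σ, hσ, ?_⟩
  filter_upwards [Ioo_mem_nhdsGT (show 0 < δ₀ / 2 by positivity)] with δ hδ
  have hre : ∀ s : ℝ, (((1 / 2 : ℝ) : ℂ) + (s : ℝ) * Complex.I).re = 1 / 2 := by intro s; simp
  have him : ∀ s : ℝ, (((1 / 2 : ℝ) : ℂ) + (s : ℝ) * Complex.I).im = s := by intro s; simp
  constructor
  · have := (hs ((1 / 2 : ℝ) + (σ * δ : ℝ) * Complex.I) ?_ ?_).1 ?_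
    · convert this using 1
      unfold edgeMidpoint; ring
    · rw [hre, him, abs_mul, hσabs, abs_of_pos hδ.1]; linarith [hδ.2]
    · rw [hre, him, abs_mul, hσabs, abs_of_pos hδ.1]; linarith [hδ.2]
    · rw [him, ← mul_assoc, hσ2, one_mul]; exact hδ.1
  · have := (hs ((1 / 2 : ℝ) + (-(σ * δ) : ℝ) * Complex.I) ?_ ?_).2 ?_
    · convert this using 2
      unfold edgeMidpoint; push_cast; ring
    · rw [hre, him, abs_neg, abs_mul, hσabs, abs_of_pos hδ.1]; linarith [hδ.2]
    · rw [hre, him, abs_neg, abs_mul, hσabs, abs_of_pos hδ.1]; linarith [hδ.2]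
    · rw [him, mul_neg, ← mul_assoc, hσ2, one_mul]; linarith [hδ.1]

/-- A pentagon with a given edge lies on one of the two sides of that edge. -/
theorem exists_normal_of_edge_eq {P Q : Pentagon} {k l : Fin 5} (h : P.edge k = Q.edge l) :
    ∃ σ : ℝ, (σ = 1 ∨ σ = -1) ∧ ∀ᶠ δ : ℝ in 𝓝[>] 0,
      Q.edgeMidpoint l + (σ * δ : ℝ) * Complex.I * (Q.vertices (l + 1) - Q.vertices l) ∈
        interior P.region := by
  obtain ⟨σ, hσ, hev⟩ := P.exists_normal k
  rcases edge_eq_edge h with ⟨h1, h2⟩ | ⟨h1, h2⟩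
  · refine ⟨σ, hσ, hev.mono fun δ hδ => ?_⟩
    have := hδ.1
    unfold edgeMidpoint at this ⊢
    rwa [h1, h2] at this
  · refine ⟨-σ, by rcases hσ with rfl | rfl <;> norm_num, hev.mono fun δ hδ => ?_⟩
    have := hδ.1
    unfold edgeMidpoint at this ⊢
    rw [h1, h2] at this
    convert this using 1
    push_cast; ring

end Pentagon

namespace TorusTiling

variable {Λ : Submodule ℤ ℂ} {ι : Type*}

/-- The tiles of the plane which are the lifts of the tiles of the torus. -/
noncomputable def lift (T : TorusTiling Λ ι) (p : ι × Λ) : Pentagon := (T.tile p.1).translate p.2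

theorem eq_of_interior_inter (T : TorusTiling Λ ι) {p q : ι × Λ} {z : ℂ}
    (hp : z ∈ interior (T.lift p).region) (hq : z ∈ interior (T.lift q).region) : p = q := by
  by_contra hne
  exact Set.disjoint_left.1 (T.disjoint hne) hp hq

theorem exists_mem_lift (T : TorusTiling Λ ι) (z : ℂ) : ∃ p, z ∈ (T.lift p).region := by
  have : z ∈ ⋃ p : ι × Λ, ((T.tile p.1).translate p.2).region := by rw [T.cover]; trivial
  exact mem_iUnion.1 this

open scoped Pointwise in
/-- Near a point, only the tiles which contain it occur. -/
theorem eventually_mem_lift [DiscreteTopology Λ] [Finite ι] (T : TorusTiling Λ ι) (z : ℂ) :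
    ∀ᶠ y in 𝓝 z, ∀ p, y ∈ (T.lift p).region → z ∈ (T.lift p).region := by
  have hΛ : IsClosed (Λ : Set ℂ) := by
    change IsClosed (Λ.toAddSubgroup : Set ℂ)
    have : DiscreteTopology Λ.toAddSubgroup := inferInstanceAs (DiscreteTopology Λ)
    exact AddSubgroup.isClosed_of_discrete
  have hfin : ∀ i, {w : Λ | ∃ y ∈ Metric.closedBall z 1,
      y ∈ (T.lift (i, w)).region}.Finite := by
    intro i
    have hb : Bornology.IsBounded (Metric.closedBall z 1 - (T.tile i).region) :=
      (Metric.isBounded_closedBall).sub (T.tile i).isCompact_region.isBounded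
    have hf := Metric.finite_isBounded_inter_isClosed
      (DiscreteTopology.isDiscrete : IsDiscrete (Λ : Set ℂ)) hb hΛ
    refine Set.Finite.of_finite_image (f := ((↑) : Λ → ℂ)) (hf.subset ?_)
      Subtype.val_injective.injOn
    rintro _ ⟨w, ⟨y, hy, hyw⟩, rfl⟩
    refine ⟨?_, w.2⟩
    have : y - w ∈ (T.tile i).region := Pentagon.mem_translate_region.1 hyw
    exact ⟨y, hy, y - w, this, by simp⟩
  have hi : ∀ i, ∀ᶠ y in 𝓝 z, ∀ w : Λ, y ∈ (T.lift (i, w)).region → z ∈ (T.lift (i, w)).region := by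
    intro i
    have h1 : ∀ᶠ y in 𝓝 z, ∀ w ∈ {w : Λ | ∃ y ∈ Metric.closedBall z 1,
        y ∈ (T.lift (i, w)).region}, y ∈ (T.lift (i, w)).region → z ∈ (T.lift (i, w)).region := by
      rw [Filter.eventually_all_finite (hfin i)]
      intro w _
      by_cases hz : z ∈ (T.lift (i, w)).region
      · exact Eventually.of_forall fun _ _ => hz
      · filter_upwards [(T.lift (i, w)).isClosed_region.isOpen_compl.mem_nhds hz] with y hy h
        exact absurd h hy
    filter_upwards [h1, Metric.closedBall_mem_nhds z one_pos] with y hy hyb w hw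
    exact hy w ⟨y, hyb, hw⟩ hw
  filter_upwards [Filter.eventually_all.2 hi] with y hy p hp
  exact hy p.1 p.2 hp

theorem exists_vertex_of_mem (T : TorusTiling Λ ι) {p q : ι × Λ} {k : Fin 5}
    (h : (T.lift p).vertices k ∈ (T.lift q).region) :
    ∃ l, (T.lift q).vertices l = (T.lift p).vertices k := by
  by_cases hpq : p = q
  · exact ⟨k, by rw [hpq]⟩
  rcases T.edgeToEdge hpq _ ⟨(T.lift p).edge_subset_region k ((T.lift p).vertex_mem_edge k), h⟩ with
    ⟨k', l, -, h2⟩ | ⟨k', l, h1, h2⟩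
  · exact ⟨l, h2.symm⟩
  · rcases Pentagon.edge_eq_edge h1 with ⟨e1, e2⟩ | ⟨e1, e2⟩ <;>
      rcases Pentagon.eq_of_vertex_mem_edge h2 with rfl | rfl
    · exact ⟨l, e1.symm⟩
    · exact ⟨l + 1, e2.symm⟩
    · exact ⟨l + 1, e1.symm⟩
    · exact ⟨l, e2.symm⟩

/-- Two corners of tiles lie at the same vertex of the torus. -/
def cornerSetoid (T : TorusTiling Λ ι) : Setoid (ι × Fin 5) where
  r c d := (T.tile c.1).vertices c.2 - (T.tile d.1).vertices d.2 ∈ Λ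
  iseqv := by
    refine ⟨fun c => by simp, fun {c d} h => ?_, fun {c d e} h h' => ?_⟩
    · simpa using Λ.neg_mem h
    · simpa using Λ.add_mem h h'

open Classical in
/-- The angles of the tiles at a vertex of the torus add up to `2π`. -/
theorem sum_angle [DiscreteTopology Λ] [Fintype ι] (T : TorusTiling Λ ι) (c : ι × Fin 5) :
    ∑ d with T.cornerSetoid c d, (T.tile d.1).angle d.2 = 2 * Real.pi := by
  have hpi := Real.pi_pos
  set v := (T.tile c.1).vertices c.2 with hv
  set S : Finset (ι × Fin 5) := Finset.univ.filter fun d => T.cornerSetoid c d with hS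
  have hmem : ∀ d, d ∈ S ↔ v - (T.tile d.1).vertices d.2 ∈ Λ := by
    intro d
    simp only [hS, Finset.mem_filter, Finset.mem_univ, true_and]
    rfl
  have hdir := Filter.eventually_all.2 fun d : ι × Fin 5 =>
    (T.tile d.1).ae_direction d.2
  have hshift : ∀ (d : ι × Fin 5) (y : ℂ), (T.tile d.1).vertices d.2 + y =
      v + y - (v - (T.tile d.1).vertices d.2) := by intros; ring
  have hdisj : Set.Pairwise (S : Set (ι × Fin 5)) (Function.onFun (AEDisjoint volume)
      fun d => (T.tile d.1).directions d.2) := by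
    intro d hd d' hd' hne
    change volume ((T.tile d.1).directions d.2 ∩ (T.tile d'.1).directions d'.2) = 0
    rw [measure_eq_zero_iff_ae_notMem]
    filter_upwards [hdir] with θ hθ
    rintro ⟨⟨-, h1⟩, -, h2⟩
    have i1 : ∀ᶠ t : ℝ in 𝓝[>] 0, (T.tile d.1).vertices d.2 + t * Complex.exp (θ * Complex.I) ∈
        interior (T.tile d.1).region := by
      refine (hθ d).resolve_right fun hout => ?_
      obtain ⟨t, ht, ht'⟩ := (h1.and hout).exists
      exact ht' ht
    have i2 : ∀ᶠ t : ℝ in 𝓝[>] 0, (T.tile d'.1).vertices d'.2 + t * Complex.exp (θ * Complex.I) ∈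
        interior (T.tile d'.1).region := by
      refine (hθ d').resolve_right fun hout => ?_
      obtain ⟨t, ht, ht'⟩ := (h2.and hout).exists
      exact ht' ht
    obtain ⟨t, ht, ht'⟩ := (i1.and i2).exists
    rw [hshift] at ht ht'
    have heq := T.eq_of_interior_inter
      (p := (d.1, ⟨v - (T.tile d.1).vertices d.2, (hmem d).1 hd⟩))
      (q := (d'.1, ⟨v - (T.tile d'.1).vertices d'.2, (hmem d').1 hd'⟩))
      (Pentagon.mem_interior_translate.2 ht) (Pentagon.mem_interior_translate.2 ht')
    apply hne
    obtain ⟨i, k⟩ := d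
    obtain ⟨i', k'⟩ := d'
    simp only [Prod.mk.injEq, Subtype.mk.injEq] at heq
    obtain ⟨rfl, h⟩ := heq
    rw [sub_right_inj] at h
    rw [(T.tile i).vertices_injective h]
  have hcover : (⋃ d ∈ S, (T.tile d.1).directions d.2 : Set ℝ) =ᵐ[volume]
      Ioc (-Real.pi) Real.pi := by
    filter_upwards [hdir] with θ hθ
    apply propext
    constructor
    · intro h
      obtain ⟨d, -, hd⟩ := mem_iUnion₂.1 h
      exact hd.1
    · intro h
      by_contra hnot
      have hout : ∀ d ∈ S, ∀ᶠ t : ℝ in 𝓝[>] 0,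
          (T.tile d.1).vertices d.2 + t * Complex.exp (θ * Complex.I) ∉ (T.tile d.1).region := by
        intro d hd
        refine (hθ d).resolve_left fun hin => hnot ?_
        exact mem_iUnion₂.2 ⟨d, hd, h, hin.mono fun t ht => interior_subset ht⟩
      have hout' : ∀ᶠ t : ℝ in 𝓝[>] 0, ∀ d ∈ S,
          (T.tile d.1).vertices d.2 + t * Complex.exp (θ * Complex.I) ∉ (T.tile d.1).region :=
        (Filter.eventually_all_finset S).2 hout
      have htend : Tendsto (fun t : ℝ => v + t * Complex.exp (θ * Complex.I)) (𝓝[>] 0) (𝓝 v) := by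
        have : Continuous fun t : ℝ => v + t * Complex.exp (θ * Complex.I) := by fun_prop
        have h0 := this.tendsto 0
        simp only [Complex.ofReal_zero, zero_mul, add_zero] at h0
        exact h0.mono_left nhdsWithin_le_nhds
      obtain ⟨t, ht1, ht2⟩ := (hout'.and (htend.eventually (T.eventually_mem_lift v))).exists
      obtain ⟨p, hp⟩ := T.exists_mem_lift (v + t * Complex.exp (θ * Complex.I))
      have hvp := ht2 p hp
      have hv0 : (T.lift (c.1, 0)).vertices c.2 = v := by
        rw [lift, Pentagon.translate_vertices]; simp [hv]
      obtain ⟨l, hl⟩ := T.exists_vertex_of_mem (p := (c.1, 0)) (q := p) (k := c.2)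
        (by rw [hv0]; exact hvp)
      rw [hv0, lift, Pentagon.translate_vertices] at hl
      have hpw : v - (T.tile p.1).vertices l = p.2 := by rw [← hl]; ring
      have hd : (p.1, l) ∈ S := by
        rw [hmem, hpw]; exact p.2.2
      refine ht1 _ hd ?_
      rw [hshift, hpw]
      exact Pentagon.mem_translate_region.1 hp
  have hvol : volume.real (⋃ d ∈ S, (T.tile d.1).directions d.2 : Set ℝ) = 2 * Real.pi := by
    rw [measureReal_congr hcover, Real.volume_real_Ioc_of_le (by linarith)]; ring
  rw [← hvol, measureReal_biUnion_finset₀ hdisj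
    (fun d _ => (T.tile d.1).nullMeasurableSet_directions d.2)
    (fun d _ => ((measure_mono (fun θ hθ => hθ.1)).trans_lt
      (measure_Ioc_lt_top (a := -Real.pi) (b := Real.pi))).ne)]
  rfl

theorem edgeSetoid_iff (T : TorusTiling Λ ι) {e f : ι × Fin 5} : T.edgeSetoid e f ↔
    ∃ w : Λ, (T.lift (e.1, w)).edge e.2 = (T.lift (f.1, 0)).edge f.2 := by
  have h0 : ∀ P : Pentagon, ∀ k, (P.translate (0 : Λ)).edge k = P.edge k := by
    intro P k
    rw [Pentagon.translate_edge]; simp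
  constructor
  · rintro ⟨w, hw, h⟩
    exact ⟨⟨w, hw⟩, h.trans (h0 _ _).symm⟩
  · rintro ⟨w, h⟩
    exact ⟨w, w.2, h.trans (h0 _ _)⟩

theorem fst_eq_of_edge_eq (T : TorusTiling Λ ι) {i : ι} {w w' : Λ} {k : Fin 5}
    (h : (T.lift (i, w)).edge k = (T.lift (i, w')).edge k) : w = w' := by
  rcases Pentagon.edge_eq_edge h with ⟨h1, -⟩ | ⟨h1, h2⟩
  · simp only [lift, Pentagon.translate_vertices, add_left_inj] at h1
    exact Subtype.ext h1
  · simp only [lift, Pentagon.translate_vertices] at h1 h2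
    apply Subtype.ext
    linear_combination (h1 + h2) / 2

/-- At most two tiles meet along an edge. -/
theorem eq_of_edgeSetoid (T : TorusTiling Λ ι) {e f g : ι × Fin 5} (hf : T.edgeSetoid f e)
    (hg : T.edgeSetoid g e) (hfe : f ≠ e) (hge : g ≠ e) : f = g := by
  obtain ⟨w, hw⟩ := T.edgeSetoid_iff.1 hf
  obtain ⟨w', hw'⟩ := T.edgeSetoid_iff.1 hg
  have key : ∀ (a b : ι × Fin 5) (u u' : Λ) (σ : ℝ),
      (T.lift (a.1, u)).edge a.2 = (T.lift (e.1, 0)).edge e.2 →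
      (T.lift (b.1, u')).edge b.2 = (T.lift (e.1, 0)).edge e.2 →
      (∀ᶠ δ : ℝ in 𝓝[>] 0, (T.lift (e.1, 0)).edgeMidpoint e.2 + (σ * δ : ℝ) * Complex.I *
        ((T.lift (e.1, 0)).vertices (e.2 + 1) - (T.lift (e.1, 0)).vertices e.2) ∈
        interior (T.lift (a.1, u)).region) →
      (∀ᶠ δ : ℝ in 𝓝[>] 0, (T.lift (e.1, 0)).edgeMidpoint e.2 + (σ * δ : ℝ) * Complex.I *
        ((T.lift (e.1, 0)).vertices (e.2 + 1) - (T.lift (e.1, 0)).vertices e.2) ∈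
        interior (T.lift (b.1, u')).region) → a = b := by
    rintro ⟨i, k⟩ ⟨j, l⟩ u u' σ h1 h2 h3 h4
    obtain ⟨δ, hδ, hδ'⟩ := (h3.and h4).exists
    have heq := T.eq_of_interior_inter hδ hδ'
    simp only [Prod.mk.injEq] at heq
    obtain ⟨rfl, rfl⟩ := heq
    have hkl : k = l := (T.lift (i, u)).edge_injective (h1.trans h2.symm)
    rw [hkl]
  obtain ⟨σ₀, h0, H0⟩ := Pentagon.exists_normal_of_edge_eq
    (rfl : (T.lift (e.1, 0)).edge e.2 = (T.lift (e.1, 0)).edge e.2)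
  obtain ⟨σ₁, h1, H1⟩ := Pentagon.exists_normal_of_edge_eq hw
  obtain ⟨σ₂, h2, H2⟩ := Pentagon.exists_normal_of_edge_eq hw'
  have h01 : σ₁ ≠ σ₀ := fun h => hfe (key f e w 0 σ₀ hw rfl (h ▸ H1) H0)
  have h02 : σ₂ ≠ σ₀ := fun h => hge (key g e w' 0 σ₀ hw' rfl (h ▸ H2) H0)
  have h12 : σ₁ = σ₂ := by
    rcases h0 with rfl | rfl <;> rcases h1 with rfl | rfl <;> rcases h2 with rfl | rfl <;>
      first | rfl | exact absurd rfl h01 | exact absurd rfl h02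
  exact key f g w w' σ₂ hw hw' (h12 ▸ H1) H2

/-- Along each edge of a tile there is another tile. -/
theorem exists_edgeSetoid [DiscreteTopology Λ] [Finite ι] (T : TorusTiling Λ ι) (e : ι × Fin 5) :
    ∃ f, f ≠ e ∧ T.edgeSetoid f e := by
  set P := T.lift (e.1, 0) with hP
  obtain ⟨σ, hσ, hev⟩ := P.exists_normal e.2
  have htend : Tendsto (fun δ : ℝ => P.edgeMidpoint e.2 - (σ * δ : ℝ) * Complex.I *
      (P.vertices (e.2 + 1) - P.vertices e.2)) (𝓝[>] 0) (𝓝 (P.edgeMidpoint e.2)) := by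
    have : Continuous fun δ : ℝ => P.edgeMidpoint e.2 - (σ * δ : ℝ) * Complex.I *
      (P.vertices (e.2 + 1) - P.vertices e.2) := by fun_prop
    have h0 := this.tendsto 0
    simp only [mul_zero, Complex.ofReal_zero, zero_mul, sub_zero] at h0
    exact h0.mono_left nhdsWithin_le_nhds
  obtain ⟨δ, ⟨-, h1⟩, h2⟩ :=
    (hev.and (htend.eventually (T.eventually_mem_lift (P.edgeMidpoint e.2)))).exists
  obtain ⟨p, hp⟩ := T.exists_mem_lift (P.edgeMidpoint e.2 - (σ * δ : ℝ) * Complex.I *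
      (P.vertices (e.2 + 1) - P.vertices e.2))
  have hmp := h2 p hp
  have hne : (e.1, 0) ≠ p := by
    rintro rfl
    exact h1 hp
  rcases T.edgeToEdge hne _ ⟨P.edge_subset_region _ (P.edgeMidpoint_mem e.2), hmp⟩ with
    ⟨k', l, h3, -⟩ | ⟨k', l, h3, h4⟩
  · exact absurd h3 (P.edgeMidpoint_ne_vertex _ _)
  · obtain rfl := Pentagon.eq_of_edgeMidpoint_mem h4
    have hedge : (T.lift p).edge l = (T.lift (e.1, 0)).edge e.2 := h3.symm
    refine ⟨(p.1, l), ?_, T.edgeSetoid_iff.2 ⟨p.2, hedge⟩⟩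
    rintro rfl
    exact hne (Prod.ext rfl (T.fst_eq_of_edge_eq hedge).symm)

theorem exists_corner_of_edgeSetoid (T : TorusTiling Λ ι) {e f : ι × Fin 5}
    (h : T.edgeSetoid f e) (hne : f ≠ e) {k : Fin 5} (hk : k = e.2 ∨ k = e.2 + 1) :
    ∃ l, (f.1, l) ≠ (e.1, k) ∧ T.cornerSetoid (e.1, k) (f.1, l) := by
  obtain ⟨i, m⟩ := e
  obtain ⟨j, n⟩ := f
  obtain ⟨w, hw⟩ := T.edgeSetoid_iff.1 h
  have hvert : ∃ l, w + (T.tile j).vertices l = (T.tile i).vertices k := by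
    rcases Pentagon.edge_eq_edge hw with ⟨h1, h2⟩ | ⟨h1, h2⟩ <;>
      simp only [lift, Pentagon.translate_vertices, ZeroMemClass.coe_zero, zero_add] at h1 h2 <;>
      rcases hk with rfl | rfl
    · exact ⟨_, h1⟩
    · exact ⟨_, h2⟩
    · exact ⟨_, h2⟩
    · exact ⟨_, h1⟩
  obtain ⟨l, hl⟩ := hvert
  refine ⟨l, ?_, ?_⟩
  · intro heq
    simp only [Prod.mk.injEq] at heq
    obtain ⟨rfl, rfl⟩ := heq
    have hw0 : w = 0 := by
      rw [add_eq_right] at hl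
      exact Subtype.ext hl
    subst hw0
    have hnm : n = m := (T.lift (j, 0)).edge_injective hw
    exact hne (by rw [hnm])
  · change (T.tile i).vertices k - (T.tile j).vertices l ∈ Λ
    rw [← hl, add_sub_cancel_right]
    exact w.2

/-- The other side of an edge. -/
noncomputable def opposite [DiscreteTopology Λ] [Finite ι] (T : TorusTiling Λ ι)
    (e : ι × Fin 5) : ι × Fin 5 := (T.exists_edgeSetoid e).choose

theorem opposite_ne [DiscreteTopology Λ] [Finite ι] (T : TorusTiling Λ ι) (e : ι × Fin 5) :
    T.opposite e ≠ e := (T.exists_edgeSetoid e).choose_spec.1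

theorem edgeSetoid_opposite [DiscreteTopology Λ] [Finite ι] (T : TorusTiling Λ ι)
    (e : ι × Fin 5) : T.edgeSetoid (T.opposite e) e := (T.exists_edgeSetoid e).choose_spec.2

theorem opposite_involutive [DiscreteTopology Λ] [Finite ι] (T : TorusTiling Λ ι) :
    Function.Involutive T.opposite := fun e =>
  T.eq_of_edgeSetoid (T.edgeSetoid_opposite _) (T.edgeSetoid.symm (T.edgeSetoid_opposite e))
    (T.opposite_ne _) (T.opposite_ne e).symm

/-- Every edge of the tiling is an edge of at most two tiles. -/
theorem sum_perimeter_le [Fintype ι] (T : TorusTiling Λ ι) :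
    ∑ i, (T.tile i).perimeter ≤ 2 * T.perimeter := by
  classical
  have : Finite T.Edge := Quotient.finite _
  have := Fintype.ofFinite T.Edge
  rw [perimeter, finsum_eq_sum_of_fintype, Finset.mul_sum]
  have h1 : ∑ i, (T.tile i).perimeter =
      ∑ e : ι × Fin 5, T.edgeLength (Quotient.mk T.edgeSetoid e) := by
    rw [Fintype.sum_prod_type]
    rfl
  rw [h1, ← Finset.sum_fiberwise (κ := T.Edge) Finset.univ
    (fun e => Quotient.mk T.edgeSetoid e)]
  apply Finset.sum_le_sum
  intro q _
  have hlen : 0 ≤ T.edgeLength q := by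
    induction q using Quotient.inductionOn with
    | h e => exact dist_nonneg
  rw [Finset.sum_congr rfl (g := fun _ => T.edgeLength q)
    (fun e he => by rw [(Finset.mem_filter.1 he).2]), Finset.sum_const, nsmul_eq_mul]
  have hcard : (Finset.univ.filter fun e => Quotient.mk T.edgeSetoid e = q).card ≤ 2 := by
    by_contra! hlt
    obtain ⟨a, b, c, ha, hb, hc, hab, hac, hbc⟩ := Finset.two_lt_card_iff.1 hlt
    have ha' := (Finset.mem_filter.1 ha).2
    have hb' := (Finset.mem_filter.1 hb).2
    have hc' := (Finset.mem_filter.1 hc).2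
    exact hbc (T.eq_of_edgeSetoid (e := a) (Quotient.exact (hb'.trans ha'.symm))
      (Quotient.exact (hc'.trans ha'.symm)) hab.symm hac.symm)
  exact mul_le_mul_of_nonneg_right (by exact_mod_cast hcard) hlen

end TorusTiling

theorem Fin.five_add_four_mul_card_le (A B : Finset (Fin 5)) (h : B.Nonempty)
    (h0 : ∀ k ∈ A, k ∈ B) (h1 : ∀ k ∈ A, k + 1 ∈ B) : 5 + 4 * A.card ≤ 5 * B.card := by
  revert A B; decide

open Classical in
/-- Double counting of the corners and edges at which tiles with large angles (those in `E`) meet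
the other tiles, which have two reflex angles. -/
theorem card_le_of_corners {ι : Type*} [Fintype ι] (E : ι → Prop) (r : Setoid (ι × Fin 5))
    (a : ι × Fin 5 → ℝ) (hsum : ∀ c, ∑ d with r c d, a d = 2 * Real.pi) (hpos : ∀ c, 0 < a c)
    (hE : ∀ i k, E i → 2 * Real.pi / 5 < a (i, k))
    (hrefl : ∀ i, ¬ E i → {k | Real.pi < a (i, k)}.ncard = 2)
    (π : ι × Fin 5 → ι × Fin 5) (hinv : Function.Involutive π)
    (hπ : ∀ i k k', k' = k ∨ k' = k + 1 → ∃ l,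
      ((π (i, k)).1, l) ≠ (i, k') ∧ r (i, k') ((π (i, k)).1, l))
    (hmix : ∀ i, E i → ∃ k d, r (i, k) d ∧ ¬ E d.1) :
    Fintype.card {i // E i} ≤ 12 * Fintype.card {i // ¬ E i} := by
  have hpi := Real.pi_pos
  set p : ι × Fin 5 → ℕ := fun c => (Finset.univ.filter fun d => r c d ∧ E d.1).card with hp
  set q : ι × Fin 5 → ℕ := fun c => (Finset.univ.filter fun d => r c d ∧ ¬ E d.1).card with hq
  set x : ι × Fin 5 → ℝ := fun e => if E (π e).1 then 1 else 0 with hx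
  have hqcongr : ∀ c d, r c d → q c = q d := by
    intro c d h
    simp only [hq]
    congr 1
    ext e
    simp only [Finset.mem_filter, Finset.mem_univ, true_and]
    exact and_congr_left fun _ => ⟨fun h' => r.trans (r.symm h) h', fun h' => r.trans h h'⟩
  -- the number of mixed corners of tiles in `E`
  have hM : ∑ c with ¬ E c.1, (p c : ℝ) / q c = ∑ d with E d.1, if 1 ≤ q d then (1 : ℝ) else 0 := by
    have h1 : ∀ c : ι × Fin 5, (p c : ℝ) / q c =
        ∑ d with E d.1, if r c d then (1 : ℝ) / q d else 0 := by
      intro c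
      rw [← Finset.sum_filter, Finset.filter_filter, Finset.sum_congr rfl
        (g := fun _ => (1 : ℝ) / q c)]
      · rw [Finset.sum_const, nsmul_eq_mul, hp]
        simp only [and_comm]
        ring
      · intro d hd
        rw [hqcongr c d (Finset.mem_filter.1 hd).2.2]
    rw [Finset.sum_congr rfl fun c _ => h1 c, Finset.sum_comm]
    refine Finset.sum_congr rfl fun d _ => ?_
    rw [← Finset.sum_filter, Finset.filter_filter, Finset.sum_const, nsmul_eq_mul]
    have h2 : (Finset.univ.filter fun c : ι × Fin 5 => ¬ E c.1 ∧ r c d).card = q d := by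
      simp only [hq]
      congr 1
      ext c
      simp only [Finset.mem_filter, Finset.mem_univ, true_and]
      exact ⟨fun h => ⟨r.symm h.2, h.1⟩, fun h => ⟨h.2, r.symm h.1⟩⟩
    rw [h2]
    split_ifs with h
    · have : (q d : ℝ) ≠ 0 := by exact_mod_cast (by omega : q d ≠ 0)
      field_simp
    · have : q d = 0 := by omega
      simp [this]
  have hq1 : ∀ c d, r c d → ¬ E d.1 → 1 ≤ q c := fun c d h hd =>
    Finset.card_pos.2 ⟨d, by simp [h, hd]⟩
  have hEtile : ∀ i, E i → 5 + 4 * ∑ k, (1 - x (i, k)) ≤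
      5 * ∑ k, if 1 ≤ q (i, k) then (1 : ℝ) else 0 := by
    intro i hi
    set A : Finset (Fin 5) := Finset.univ.filter fun k => ¬ E (π (i, k)).1 with hA
    set B : Finset (Fin 5) := Finset.univ.filter fun k => 1 ≤ q (i, k) with hB
    have hAB : ∀ k ∈ A, ∀ k', k' = k ∨ k' = k + 1 → k' ∈ B := by
      intro k hk k' hk'
      obtain ⟨l, -, hl⟩ := hπ i k k' hk'
      simp only [hA, Finset.mem_filter, Finset.mem_univ, true_and] at hk
      simp only [hB, Finset.mem_filter, Finset.mem_univ, true_and]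
      exact hq1 _ _ hl hk
    obtain ⟨k, d, hkd, hd⟩ := hmix i hi
    have := Fin.five_add_four_mul_card_le A B
      ⟨k, by simp only [hB, Finset.mem_filter, Finset.mem_univ, true_and]; exact hq1 _ _ hkd hd⟩
      (fun k hk => hAB k hk k (Or.inl rfl)) (fun k hk => hAB k hk (k + 1) (Or.inr rfl))
    have e1 : ∑ k, (1 - x (i, k)) = A.card := by
      rw [hA, Finset.card_filter]
      push_cast
      refine Finset.sum_congr rfl fun k _ => ?_
      simp only [hx]
      split_ifs <;> norm_num
    have e2 : (∑ k, if 1 ≤ q (i, k) then (1 : ℝ) else 0) = B.card := by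
      rw [hB, Finset.card_filter]
      push_cast; rfl
    rw [e1, e2]
    exact_mod_cast this
  have hcorner : ∀ i k, ¬ E i → 5 * ((p (i, k) : ℝ) / q (i, k)) ≤
      2 * x (i, k) + 2 * x (i, k - 1) + if Real.pi < a (i, k) then 6 else 16 := by
    intro i k hi
    have hself : (i, k) ∈ Finset.univ.filter fun d => r (i, k) d ∧ ¬ E d.1 := by
      simp [hi]
    have hqpos : 1 ≤ q (i, k) := hq1 _ _ (r.refl _) hi
    have hangle : (p (i, k) : ℝ) * (2 * Real.pi / 5) + a (i, k) ≤ 2 * Real.pi := by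
      have hs := hsum (i, k)
      rw [← Finset.sum_filter_add_sum_filter_not
        (Finset.univ.filter fun d => r (i, k) d) (fun d => E d.1), Finset.filter_filter,
        Finset.filter_filter] at hs
      refine (add_le_add ?_ (Finset.single_le_sum (fun d _ => (hpos d).le) hself)).trans hs.le
      rw [← nsmul_eq_mul]
      refine Finset.card_nsmul_le_sum _ _ _ fun d hd => ?_
      exact (hE d.1 d.2 (Finset.mem_filter.1 hd).2.2).le
    have hp4 : p (i, k) ≤ 4 := by
      by_contra! h
      have : (5 : ℝ) ≤ p (i, k) := by exact_mod_cast h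
      nlinarith [hpos (i, k)]
    have hp2 : Real.pi < a (i, k) → p (i, k) ≤ 2 := by
      intro ha
      by_contra! h
      have : (3 : ℝ) ≤ p (i, k) := by exact_mod_cast h
      nlinarith
    have hx0 : ∀ e, x e = 0 ∨ x e = 1 := by
      intro e; simp only [hx]; split_ifs <;> simp
    have hq2 : ∀ k₀, (k = k₀ ∨ k = k₀ + 1) → x (i, k₀) = 0 → 2 ≤ q (i, k) := by
      intro k₀ hk hxk
      have hnE : ¬ E (π (i, k₀)).1 := by
        intro h
        simp only [hx] at hxk
        rw [if_pos h] at hxk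
        exact one_ne_zero hxk
      obtain ⟨l, hne, hl⟩ := hπ i k₀ k hk
      refine Finset.one_lt_card.2 ⟨_, hself, ((π (i, k₀)).1, l), ?_, hne.symm⟩
      simp [hl, hnE]
    have hp4' : (p (i, k) : ℝ) ≤ 4 := by exact_mod_cast hp4
    have hqpos' : (1 : ℝ) ≤ q (i, k) := by exact_mod_cast hqpos
    have key : (x (i, k) = 1 ∧ x (i, k - 1) = 1) ∨ 2 ≤ q (i, k) := by
      rcases hx0 (i, k) with h | h
      · exact Or.inr (hq2 k (Or.inl rfl) h)
      · rcases hx0 (i, k - 1) with h' | h'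
        · exact Or.inr (hq2 (k - 1) (Or.inr (by rw [sub_add_cancel])) h')
        · exact Or.inl ⟨h, h'⟩
    have hxnn : ∀ e, 0 ≤ x e := fun e => by rcases hx0 e with h | h <;> rw [h]; norm_num
    have hbound : ∀ m : ℝ, (p (i, k) : ℝ) ≤ m → 5 * ((p (i, k) : ℝ) / q (i, k)) ≤
        2 * x (i, k) + 2 * x (i, k - 1) + max (5 * m - 4) (5 * m / 2) := by
      intro m hm
      rcases key with ⟨h, h'⟩ | h
      · have : (p (i, k) : ℝ) / q (i, k) ≤ m :=
          (div_le_self (Nat.cast_nonneg _) hqpos').trans hm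
        rw [h, h']
        linarith [le_max_left (5 * m - 4) (5 * m / 2)]
      · have h2 : (2 : ℝ) ≤ q (i, k) := by exact_mod_cast h
        have : (p (i, k) : ℝ) / q (i, k) ≤ m / 2 :=
          div_le_div₀ ((Nat.cast_nonneg _).trans hm) hm (by norm_num) h2
        linarith [le_max_right (5 * m - 4) (5 * m / 2), hxnn (i, k), hxnn (i, k - 1)]
    split_ifs with ha
    · have := hbound 2 (by exact_mod_cast hp2 ha)
      norm_num at this
      exact this
    · have := hbound 4 hp4'
      norm_num at this
      exact this
  have hNtile : ∀ i, ¬ E i → 5 * ∑ k, (p (i, k) : ℝ) / q (i, k) ≤ 4 * ∑ k, x (i, k) + 60 := by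
    intro i hi
    have h1 : ∑ k : Fin 5, x (i, k - 1) = ∑ k, x (i, k) :=
      Equiv.sum_comp (Equiv.subRight (1 : Fin 5)) (fun k => x (i, k))
    have h2 : ∑ k : Fin 5, (if Real.pi < a (i, k) then (6 : ℝ) else 16) = 60 := by
      have h3 : ∀ k : Fin 5, (if Real.pi < a (i, k) then (6 : ℝ) else 16) =
          16 - 10 * (if Real.pi < a (i, k) then 1 else 0) := by
        intro k; split_ifs <;> norm_num
      rw [Finset.sum_congr rfl fun k _ => h3 k, Finset.sum_sub_distrib, ← Finset.mul_sum,
        Finset.sum_boole]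
      have h4 : (Finset.univ.filter fun k => Real.pi < a (i, k)).card = 2 := by
        rw [← hrefl i hi, ← Set.ncard_coe_finset]
        simp
      rw [h4]
      norm_num
    rw [Finset.mul_sum]
    refine (Finset.sum_le_sum fun k _ => hcorner i k hi).trans ?_
    rw [Finset.sum_add_distrib, Finset.sum_add_distrib, ← Finset.mul_sum, ← Finset.mul_sum, h1, h2]
    linarith
  have hprod : ∀ (S : ι → Prop) [DecidablePred S] (f : ι × Fin 5 → ℝ), ∑ c with S c.1, f c =
      ∑ i with S i, ∑ k, f (i, k) := by
    intro S _ f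
    rw [Finset.sum_filter, Finset.sum_filter, Fintype.sum_prod_type]
    refine Finset.sum_congr rfl fun i _ => ?_
    by_cases h : S i
    · simp [h]
    · simp [h]
  -- the edges between the two kinds of tiles, counted from either side
  have hX : ∑ e with E e.1, (1 - x e) = ∑ e with ¬ E e.1, x e := by
    have h1 : ∑ e with E e.1, (1 - x e) = ((Finset.univ.filter fun e : ι × Fin 5 =>
        E e.1 ∧ ¬ E (π e).1).card : ℝ) := by
      rw [← Finset.filter_filter, Finset.card_filter]
      push_cast
      refine Finset.sum_congr rfl fun e _ => ?_
      simp only [hx]; split_ifs <;> norm_num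
    have h2 : ∑ e with ¬ E e.1, x e = ((Finset.univ.filter fun e : ι × Fin 5 =>
        ¬ E e.1 ∧ E (π e).1).card : ℝ) := by
      rw [← Finset.filter_filter, Finset.card_filter]
      push_cast
      rfl
    rw [h1, h2]
    congr 1
    refine Finset.card_bij (fun e _ => π e) ?_ (fun e _ f _ h => hinv.injective h) ?_
    · intro e he
      simp only [Finset.mem_filter, Finset.mem_univ, true_and] at he ⊢
      rw [hinv e]
      exact ⟨he.2, he.1⟩
    · intro e he
      simp only [Finset.mem_filter, Finset.mem_univ, true_and] at he
      refine ⟨π e, ?_, hinv e⟩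
      simp only [Finset.mem_filter, Finset.mem_univ, true_and]
      rw [hinv e]
      exact ⟨he.2, he.1⟩
  have hs1 := Finset.sum_le_sum fun i (hi : i ∈ Finset.univ.filter E) =>
    hEtile i (Finset.mem_filter.1 hi).2
  have hs2 := Finset.sum_le_sum fun i (hi : i ∈ Finset.univ.filter fun i => ¬ E i) =>
    hNtile i (Finset.mem_filter.1 hi).2
  rw [Finset.sum_add_distrib, ← Finset.mul_sum, ← Finset.mul_sum, ← hprod E fun e => 1 - x e,
    ← hprod E fun c => if 1 ≤ q c then 1 else 0, ← hM,
    Finset.sum_const, nsmul_eq_mul, hX] at hs1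
  rw [Finset.sum_add_distrib, ← Finset.mul_sum, ← Finset.mul_sum, ← hprod (fun i => ¬ E i) fun c => (p c : ℝ) / q c,
    ← hprod (fun i => ¬ E i) x, Finset.sum_const, nsmul_eq_mul] at hs2
  rw [Fintype.card_subtype, Fintype.card_subtype]
  have : ((Finset.univ.filter E).card : ℝ) ≤ 12 * (Finset.univ.filter fun i => ¬ E i).card := by
    linarith
  exact_mod_cast this

namespace TorusTiling

variable {Λ : Submodule ℤ ℂ} {ι : Type*}

theorem nonempty_of_cover (T : TorusTiling Λ ι) : Nonempty ι :=
  (T.exists_mem_lift 0).nonempty.map Prod.fst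

open Classical in
/-- A corner that meets only efficient tiles has an angle that tiles. -/
theorem angleTiles_of_forall_isEfficient [DiscreteTopology Λ] [Fintype ι] (T : TorusTiling Λ ι)
    (c : T.EfficientCorner)
    (h : ∀ d, T.cornerSetoid (c.1.1, c.2) d → (T.tile d.1).IsEfficient) :
    AngleTiles T.cornerAngle c := by
  let g : T.EfficientCorner → ι × Fin 5 := fun e => (e.1.1, e.2)
  have hg : Function.Injective g := by
    rintro ⟨⟨i, hi⟩, k⟩ ⟨⟨j, hj⟩, l⟩ h
    simp only [g, Prod.mk.injEq] at h
    obtain ⟨rfl, rfl⟩ := h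
    rfl
  have : Finite T.EfficientCorner := Finite.of_injective g hg
  have := Fintype.ofFinite T.EfficientCorner
  refine ⟨Finsupp.equivFunOnFinite.symm
    (fun e => if T.cornerSetoid (g c) (g e) then 1 else 0), ?_, ?_⟩
  · simp
  rw [Finsupp.sum_fintype _ _ (by simp), ← T.sum_angle (g c)]
  have him : (Finset.univ.filter fun d => T.cornerSetoid (g c) d) =
      (Finset.univ.filter fun e => T.cornerSetoid (g c) (g e)).image g := by
    ext d
    simp only [Finset.mem_filter, Finset.mem_univ, true_and, Finset.mem_image]
    constructor
    · intro hd
      exact ⟨(⟨d.1, h d hd⟩, d.2), hd, rfl⟩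
    · rintro ⟨e, he, rfl⟩
      exact he
  rw [him, Finset.sum_image hg.injOn, Finset.sum_filter]
  refine Finset.sum_congr rfl fun e _ => ?_
  by_cases he : T.cornerSetoid (g c) (g e) <;> simp [he, cornerAngle, g]

end TorusTiling

theorem proposition2p13 (Λ : Submodule ℤ ℂ) [DiscreteTopology Λ] [IsZLattice ℝ Λ]
    {ι : Type*} [Finite ι] (T : TorusTiling Λ ι)
    (harea : ∀ i, (T.tile i).area = 1)
    (htypes : ∀ i, (T.tile i).IsEfficient ∨ (T.tile i).IsType2)
    (hfour : ∀ (i : ι) (hi : (T.tile i).IsEfficient),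
      {k : Fin 5 | AngleTiles T.cornerAngle (⟨i, hi⟩, k)}.ncard ≤ 4)
    (Q : Pentagon) (hQ : Q.IsPrismatic) (hQarea : Q.area = 1) :
    Q.perimeter / 2 < T.perimeterPerTile := by
  classical
  have := Fintype.ofFinite ι
  have hne := T.nonempty_of_cover
  have htype2 : ∀ i, ¬ (T.tile i).IsEfficient → (T.tile i).IsType2 := fun i hi =>
    (htypes i).resolve_left hi
  have hmix : ∀ i, (T.tile i).IsEfficient →
      ∃ k d, T.cornerSetoid (i, k) d ∧ ¬ (T.tile d.1).IsEfficient := by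
    intro i hi
    by_contra! hall
    have huniv : {k : Fin 5 | AngleTiles T.cornerAngle (⟨i, hi⟩, k)} = univ :=
      eq_univ_of_forall fun k => T.angleTiles_of_forall_isEfficient (⟨i, hi⟩, k) (hall k)
    have h4 := hfour i hi
    rw [huniv, ncard_univ, Nat.card_eq_fintype_card, Fintype.card_fin] at h4
    omega
  have hcount := card_le_of_corners (fun i => (T.tile i).IsEfficient) T.cornerSetoid
    (fun c => (T.tile c.1).angle c.2)
    (fun c => by convert T.sum_angle c)
    (fun c => by
      obtain ⟨σ, -, -, h⟩ := (T.tile c.1).exists_orientation_angle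
      exact (h c.2).1.1)
    (fun i k hi => hi.lt_angle k) (fun i hi => htype2 i hi) T.opposite T.opposite_involutive
    (fun i k k' hk => T.exists_corner_of_edgeSetoid (T.edgeSetoid_opposite (i, k))
      (T.opposite_ne (i, k)) hk) hmix
  have hcompl := Fintype.card_subtype_compl (fun i => (T.tile i).IsEfficient)
  have hle := Fintype.card_subtype_le (fun i => (T.tile i).IsEfficient)
  have hpos : 0 < Fintype.card ι := Fintype.card_pos
  set m := Fintype.card {i // (T.tile i).IsEfficient} with hm
  set n := Fintype.card {i // ¬ (T.tile i).IsEfficient} with hn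
  have hmn : m + n = Fintype.card ι := by omega
  have hn0 : 1 ≤ n := by omega
  have hsum : 3.811 * (m : ℝ) + 4.5589 * n ≤ ∑ i, (T.tile i).perimeter := by
    rw [hm, hn, Fintype.card_subtype, Fintype.card_subtype,
      ← Finset.sum_filter_add_sum_filter_not Finset.univ (fun i => (T.tile i).IsEfficient)]
    refine add_le_add ?_ ?_
    · rw [mul_comm, ← nsmul_eq_mul]
      exact Finset.card_nsmul_le_sum _ _ _ fun i _ => Pentagon.le_perimeter (harea i)
    · rw [mul_comm, ← nsmul_eq_mul]
      exact Finset.card_nsmul_le_sum _ _ _ fun i hi =>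
        Pentagon.le_perimeter_of_isType2 (harea i) (htype2 i (Finset.mem_filter.1 hi).2)
  have hQ' := hQ.perimeter_le hQarea
  have htotal := T.sum_perimeter_le
  have hposR : (0 : ℝ) < m + n := by exact_mod_cast hmn ▸ hpos
  rw [TorusTiling.perimeterPerTile, Nat.card_eq_fintype_card, ← hmn, Nat.cast_add,
    lt_div_iff₀ hposR]
  have h12 : (m : ℝ) ≤ 12 * n := by exact_mod_cast hcount
  have h1 : (1 : ℝ) ≤ n := by exact_mod_cast hn0
  have := mul_le_mul_of_nonneg_right hQ' hposR.le
  linarith
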